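/- For a real interval $J=(a,b)$ and $\theta\in(0,\pi/2]$ let $D(J;\theta)\subset\mathbb C$ be the Poincaré neighbourhood of $J$ with external angle $\theta$: the union of the two open discs, symmetric to each other in the real axis, whose boundary circles pass through $a,b$ and whose outer arcs make the angle $\theta$ with the two components of $\mathbb R\setminus[a,b]$. (Thus $D(J;\pi/2)=D_*(J)$ is the Euclidean disc with diameter $J$, and $D(J;\theta)$ increases to $\mathbb C_J=(\mathbb C\setminus\mathbb R)\cup J$ as $\theta\downarrow0$.) Let $f(z)=z^2+c_1$ with $c_1\in\mathbb R$. For $s\ge 2$, a periodic interval of period $s$ is an interval $V=[-u,u]$, $u>0$, such that $V,f(V),\dots,f^{s-1}(V)$ have pairwise disjoint interiors, $f^s(V)\subset V$ and $f^s(\partial V)\subset\partial V$; $f$ is called renormalizable of period $s$ if such an interval exists, and infinitely renormalizable if it is renormalizable of arbitrarily large periods. For such a $V$ put $I=(0,\tfrac65u)$ and $$\Omega(\theta)=D\big((-u,u);\theta\big)\cup D_*(I)\cup D_*(-I).$$ **Proposition.** There is an absolute constant $\theta_0\in(0,\pi/2]$ with the following property. Suppose that $f(z)=z^2+c_1$,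 $c_1\in\mathbb R$, is infinitely renormalizable or, more generally, that $f$ has no attracting and no neutral periodic point on the real line. Let $V=[-u,u]$ be a periodic interval of $f$ of period $s\ge2$, and suppose that $f$ is not also renormalizable of period $s/2$. Then the following hold. 1. The inverse branch $F$ of $f^{s-1}$ with $F(f^s(0))=c_1$ extends holomorphically to $\mathbb C_T$ for some interval $T=(-M,M)$ with $M>\tfrac65u$; that is, $f^{s-1}\circ F=\mathrm{id}$ on $\mathbb C_T$. 2. For every such extension $F$ and every $\theta\in(0,\theta_0)$, $$f^{-1}\big(F(\partial\Omega(\theta))\big)\subset\Omega(\theta),$$ where $f^{-1}$ denotes the full preimage. Moreover, with $\Omega'(\theta)=f^{-1}(F(\Omega(\theta)))$, the map $f^s\colon\Omega'(\theta)\to\Omega(\theta)$ is polynomial-like of degree $2$: $\Omega'(\theta)$ and $\Omega(\theta)$ are simply connected domains, the closure of $\Omega'(\theta)$ is a compact subset of $\Omega(\theta)$, and $f^s\colon\Omega'(\theta)\to\Omega(\theta)$ is a proper holomorphic map for which each point of $\Omega(\theta)$ has exactly two preimages counted with multiplicity. -/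

import Mathlib

open Set

noncomputable section

/-- The real quadratic map `x ↦ x ^ 2 + c₁`; its critical point is `0`, its critical value is
`c₁`. -/
def quad (c₁ : ℝ) (x : ℝ) : ℝ := x ^ 2 + c₁

/-- The same quadratic map on the complex plane. -/
def quadC (c₁ : ℝ) (z : ℂ) : ℂ := z ^ 2 + (c₁ : ℂ)

/-- `V = [-u, u]` is a periodic (restrictive) interval of period `s ≥ 2` of `f = quad c₁`:
`V, f V, …, f^(s-1) V` have pairwise disjoint interiors, `f^s V ⊆ V`, and `f^s` maps the
boundary of `V` into itself. Since `f^s` is even, the last condition says that one of the two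
endpoints `u`, `-u` is fixed by `f^s` and that the other one is mapped to it. -/
structure IsPeriodicInterval (c₁ u : ℝ) (s : ℕ) : Prop where
  two_le : 2 ≤ s
  pos : 0 < u
  disjoint : ∀ i j : ℕ, i < j → j < s →
    Disjoint (interior ((quad c₁)^[i] '' Icc (-u) u)) (interior ((quad c₁)^[j] '' Icc (-u) u))
  mapsTo : MapsTo (quad c₁)^[s] (Icc (-u) u) (Icc (-u) u)
  endpoint : (quad c₁)^[s] u = u ∨ (quad c₁)^[s] u = -u

/-- `f = quad c₁` is renormalizable of period `s`. -/
def IsRenormalizable (c₁ : ℝ) (s : ℕ) : Prop := ∃ u : ℝ, IsPeriodicInterval c₁ u s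

/-- `f = quad c₁` is infinitely renormalizable: it has renormalizations of arbitrarily large
period. -/
def IsInfinitelyRenormalizable (c₁ : ℝ) : Prop := ∀ N : ℕ, ∃ s : ℕ, N ≤ s ∧ IsRenormalizable c₁ s

/-- `f = quad c₁` has no attracting and no neutral periodic point on the real line. -/
def AllPeriodicRepelling (c₁ : ℝ) : Prop :=
  ∀ (n : ℕ) (x : ℝ), 0 < n → (quad c₁)^[n] x = x → 1 < |deriv (quad c₁)^[n] x|

/-- The open Euclidean disc `D_*((a, b))` that has the real interval `(a, b)` as a diameter. -/
def discStar (a b : ℝ) : Set ℂ := Metric.ball (((a + b) / 2 : ℝ) : ℂ) ((b - a) / 2)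

/-- The Poincaré neighbourhood `D((a, b); θ)` of the real interval `(a, b)` with external angle
`θ ∈ (0, π / 2]`: the union of the two open discs, symmetric to each other in the real axis, whose
boundary circles pass through `a` and `b`; their outer arcs make the angle `θ` with the two
components of `ℝ \ [a, b]`. For `θ = π / 2` it is the disc `D_*((a, b))`, and as `θ` decreases to
`0` it increases to the slit plane `(ℂ \ ℝ) ∪ (a, b)`. -/
def poincareNhd (a b θ : ℝ) : Set ℂ :=
  Metric.ball (⟨(a + b) / 2, (b - a) / 2 * (Real.cos θ / Real.sin θ)⟩ : ℂ)
      ((b - a) / 2 / Real.sin θ) ∪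
    Metric.ball (⟨(a + b) / 2, -((b - a) / 2 * (Real.cos θ / Real.sin θ))⟩ : ℂ)
      ((b - a) / 2 / Real.sin θ)

/-- `Ω(θ) = D(V; θ) ∪ D_*(I) ∪ D_*(-I)` with `V = (-u, u)` and `I = (0, 6u/5)`. -/
def Omega (u θ : ℝ) : Set ℂ :=
  poincareNhd (-u) u θ ∪ discStar 0 (6 / 5 * u) ∪ discStar (-(6 / 5 * u)) 0

/-- The slit plane `ℂ_T = (ℂ \ ℝ) ∪ T` for `T = (-M, M)`. -/
def slitPlaneOf (M : ℝ) : Set ℂ := {z | z.im ≠ 0 ∨ z.re ∈ Ioo (-M) M}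

/-- `F` is the holomorphic inverse branch of `f^(s-1)` on the slit plane over `(-M, M)` that
takes `f^s(0) = f^(s-1)(c₁)` to the critical value `c₁`. -/
structure IsInverseBranch (c₁ : ℝ) (s : ℕ) (M : ℝ) (F : ℂ → ℂ) : Prop where
  differentiableOn : DifferentiableOn ℂ F (slitPlaneOf M)
  right_inv : ∀ z ∈ slitPlaneOf M, (quadC c₁)^[s - 1] (F z) = z
  apply_critical : F ((quadC c₁)^[s] 0) = (c₁ : ℂ)

/-- `g : U' → U` is a polynomial-like map of degree `d`: `U'` and `U` are simply connected
domains, `U'` is relatively compact in `U`, and `g` is a proper holomorphic map from `U'` to `U`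
for which every point of `U` has exactly `d` preimages in `U'`, counted with multiplicity. -/
structure IsPolynomialLike (g : ℂ → ℂ) (U' U : Set ℂ) (d : ℕ) : Prop where
  isOpen_source : IsOpen U'
  isOpen_target : IsOpen U
  simplyConnected_source : IsSimplyConnected U'
  simplyConnected_target : IsSimplyConnected U
  isCompact_closure : IsCompact (closure U')
  closure_subset : closure U' ⊆ U
  differentiableOn : DifferentiableOn ℂ g U'
  mapsTo : MapsTo g U' U
  proper : ∀ K : Set ℂ, K ⊆ U → IsCompact K → IsCompact (U' ∩ g ⁻¹' K)
  finite_fibre : ∀ w ∈ U, (U' ∩ g ⁻¹' {w}).Finite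
  degree : ∀ w ∈ U, ∑ᶠ z ∈ U' ∩ g ⁻¹' {w}, analyticOrderNatAt (fun y => g y - w) z = d

end

/-!
The argument has a real part, which gives definite space around `V = [-u, u]`, and a complex part,
which turns this space into the inclusion of the preimage of `Ω` in `Ω`.

The only dynamical tool on the line is that a monotone branch of `f^n` expands cross-ratios
(`NoZero.crossRatio_le`, `NoZero.deriv_expansion`), because `x ↦ x ^ 2` does so on each side of
`0`. It implies that all real periodic points of an infinitely renormalizable map are repelling
(`allPeriodicRepelling_of_isInfinitelyRenormalizable`): otherwise a critical point of an iterate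
`f^N` next to a nonrepelling point is attracted under `f^N` to a fixed point, which would be common
to `V` and to two further intervals of a cycle of period larger than `2 N`. When all cycles are
repelling, the return map, multiplied by the sign `ε` for which `f^s u = ε u`, is increasing on
`[0, u]` with the repelling fixed point `u`. The absence of further fixed points gives the position
`-m u`, `0 < m ≤ 1`, of its critical value, shows that the map lies above the diagonal beyond `u`,
and bounds its positive zero by `m u`.

The real bounds are obtained at a shortest interval `f^k V` of the cycle. The maximal monotone
branch of `f^k` covers an interval around it that ends at points of the critical orbit, and the
spaces between these points and `f^k V` contain further intervals of the cycle, none of which is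
shorter. Pulling the space back (`IsRepellingInterval.koebe`) gives `3 / 2 u ^ 2 ≤ |f^κ 0| ^ 2` for
every interval of the cycle whose critical end is the far one (`IsRepellingInterval.real_bound`).
The monotone branch of `f^(s-1)` around `f V` ends at such points, hence covers
`(-11 u / 9, 11 u / 9)` (`IsRepellingInterval.exists_extension`).

Its inverse is a composition of square roots. It extends to the slit plane, where it preserves the
half-planes up to orientation and, by the Schwarz lemma for each root, does not increase the angles
of Poincaré neighbourhoods (`exists_complex_branch`). In the coordinate in which `V = [-1, 1]` it
has the form `z ↦ c + u ^ 2 ψ (ε z / u)` with the properties collected in `NormalizedBranch`, and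
the inclusion says that `ζ ^ 2 = ψ w` with `w` in the closure of `Ω` implies `ζ ∈ Ω`. The two discs
and the Poincaré neighbourhood that form `Ω` are treated separately, each by the Schwarz lemma for
the interval on which it stands (`NormalizedBranch.mem_normOmega`). For the Poincaré neighbourhood
one needs that `ψ (-1)` is not far to the left of `-1`. This follows from a Pick-type inequality: a
suitable combination of the values of `ψ` at `-1`, `-m`, `0`, `1` and `6 / 5` is the integral of a
nonnegative kernel against `|Im ψ|` (`NormalizedBranch.neg_one`).

Finally `Ω` is star-shaped about the real critical value of the return map, so the contraction of
`Ω` to it lifts to the double cover `f⁻¹ (F Ω)` (`isSimplyConnected_preimage_quadC`). The remaining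
properties of a polynomial-like map follow from `f^(s-1) ∘ F = id`. All inverse branches agree by
the identity theorem (`IsInverseBranch.eqOn`).
-/

noncomputable section

/-! ### Iterates of the real quadratic map -/

theorem continuous_quad_iterate (c : ℝ) (n : ℕ) : Continuous (quad c)^[n] := by
  have h : Continuous (quad c) := by unfold quad; fun_prop
  exact h.iterate n

theorem differentiable_quad_iterate (c : ℝ) (n : ℕ) : Differentiable ℝ (quad c)^[n] := by
  have h : Differentiable ℝ (quad c) := by unfold quad; fun_prop
  exact h.iterate n

theorem hasDerivAt_quad (c x : ℝ) : HasDerivAt (quad c) (2 * x) x := by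
  have h := (hasDerivAt_pow 2 x).add_const c
  simp only [Nat.cast_ofNat, Nat.add_one_sub_one, pow_one] at h
  exact h

theorem differentiable_signed_iterate (c ε : ℝ) (n : ℕ) :
    Differentiable ℝ fun x => ε * (quad c)^[n] x :=
  (differentiable_quad_iterate c n).const_mul ε

theorem quad_iterate_neg (c : ℝ) {n : ℕ} (hn : n ≠ 0) (x : ℝ) :
    (quad c)^[n] (-x) = (quad c)^[n] x := by
  obtain ⟨m, rfl⟩ := Nat.exists_eq_succ_of_ne_zero hn
  simp [Function.iterate_succ_apply, quad]

theorem quad_iterate_abs (c : ℝ) {n : ℕ} (hn : n ≠ 0) (x : ℝ) :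
    (quad c)^[n] |x| = (quad c)^[n] x := by
  rcases abs_choice x with h | h <;> simp [h, quad_iterate_neg c hn]

theorem quad_strictMonoOn (c : ℝ) : StrictMonoOn (quad c) (Ici 0) := by
  intro x hx y hy hxy
  simp only [mem_Ici] at hx hy
  simp only [quad]; nlinarith

theorem quad_strictAntiOn (c : ℝ) : StrictAntiOn (quad c) (Iic 0) := by
  intro x hx y hy hxy
  simp only [mem_Iic] at hx hy
  simp only [quad]; nlinarith

/-- The iterates `f^j`, `j < n`, have no zero in the open interval `(a, b)`; equivalently, `f^n`
has no critical point there. -/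
def NoZero (c : ℝ) (n : ℕ) (a b : ℝ) : Prop :=
  ∀ j < n, ∀ x ∈ Ioo a b, (quad c)^[j] x ≠ 0

theorem NoZero.mono {c : ℝ} {n m : ℕ} {a b a' b' : ℝ} (h : NoZero c n a b) (hm : m ≤ n)
    (ha : a ≤ a') (hb : b' ≤ b) : NoZero c m a' b' :=
  fun j hj x hx => h j (hj.trans_le hm) x ⟨ha.trans_lt hx.1, hx.2.trans_le hb⟩

theorem nonneg_or_nonpos_of_ne_zero {g : ℝ → ℝ} (hg : Continuous g) {a b : ℝ} (hab : a < b)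
    (h : ∀ x ∈ Ioo a b, g x ≠ 0) : (∀ x ∈ Icc a b, 0 ≤ g x) ∨ (∀ x ∈ Icc a b, g x ≤ 0) := by
  have key : (∀ x ∈ Ioo a b, 0 < g x) ∨ (∀ x ∈ Ioo a b, g x < 0) := by
    by_contra! hcon
    obtain ⟨⟨x, hx, hx'⟩, y, hy, hy'⟩ := hcon
    obtain ⟨z, hz, hz'⟩ := isPreconnected_Ioo.intermediate_value hx hy hg.continuousOn ⟨hx', hy'⟩
    exact h z hz hz'
  rw [← closure_Ioo hab.ne]
  rcases key with k | k
  · exact Or.inl fun x hx => closure_minimal (fun y hy => (k y hy).le)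
      (isClosed_le continuous_const hg) hx
  · exact Or.inr fun x hx => closure_minimal (fun y hy => (k y hy).le)
      (isClosed_le hg continuous_const) hx

theorem NoZero.nonneg_or_nonpos {c : ℝ} {n j : ℕ} {a b : ℝ} (h : NoZero c n a b) (hab : a < b)
    (hj : j < n) :
    (∀ x ∈ Icc a b, 0 ≤ (quad c)^[j] x) ∨ (∀ x ∈ Icc a b, (quad c)^[j] x ≤ 0) :=
  nonneg_or_nonpos_of_ne_zero (continuous_quad_iterate c j) hab (h j hj)

theorem NoZero.strictMonoOn_or_strictAntiOn {c : ℝ} {n : ℕ} {a b : ℝ} (h : NoZero c n a b)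
    (hab : a < b) :
    StrictMonoOn (quad c)^[n] (Icc a b) ∨ StrictAntiOn (quad c)^[n] (Icc a b) := by
  induction n with
  | zero => exact Or.inl fun x _ y _ hxy => hxy
  | succ n ih =>
    rw [Function.iterate_succ']
    have hs := h.nonneg_or_nonpos hab (Nat.lt_succ_self n)
    rcases ih (h.mono n.le_succ le_rfl le_rfl) with hm | hm <;> rcases hs with hs | hs
    · exact Or.inl ((quad_strictMonoOn c).comp hm hs)
    · exact Or.inr ((quad_strictAntiOn c).comp_strictMonoOn hm hs)
    · exact Or.inr ((quad_strictMonoOn c).comp_strictAntiOn hm hs)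
    · exact Or.inl ((quad_strictAntiOn c).comp hm hs)

/-- The image under `f^i` of an interval without critical points of `f^(n+i)` is an interval without
critical points of `f^n`; its ends may come in either order. -/
theorem NoZero.comp {c : ℝ} {n i : ℕ} {a b x y : ℝ} (h : NoZero c (n + i) a b) (hab : a < b)
    (hx : x ∈ Icc a b) (hy : y ∈ Icc a b) :
    NoZero c n ((quad c)^[i] x) ((quad c)^[i] y) := by
  intro j hj w hw h0
  have hsub : uIcc x y ⊆ Icc a b := by
    rw [← uIcc_of_le hab.le] at *
    exact uIcc_subset_uIcc hx hy
  obtain ⟨z, hz, rfl⟩ : w ∈ (quad c)^[i] '' uIcc x y :=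
    intermediate_value_uIcc (continuous_quad_iterate c i).continuousOn
      (Icc_subset_uIcc ⟨hw.1.le, hw.2.le⟩)
  have hzx : z ≠ x := by rintro rfl; exact lt_irrefl _ hw.1
  have hzy : z ≠ y := by rintro rfl; exact lt_irrefl _ hw.2
  refine h (j + i) (by omega) z ?_ (by rwa [Function.iterate_add_apply])
  have hz' := hsub hz
  refine ⟨lt_of_le_of_ne hz'.1 ?_, lt_of_le_of_ne hz'.2 ?_⟩
  · rintro rfl
    rcases mem_uIcc.1 hz with h | h
    · exact hzx (le_antisymm hx.1 h.1)
    · exact hzy (le_antisymm hy.1 h.1)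
  · rintro rfl
    rcases mem_uIcc.1 hz with h | h
    · exact hzy (le_antisymm h.2 hy.2)
    · exact hzx (le_antisymm h.2 hx.2)

/-! ### Expansion of cross-ratios -/

/-- The cross-ratio of four points; it is positive when they are in monotone order. -/
def crossRatio (a p q b : ℝ) : ℝ := (b - a) * (q - p) / ((p - a) * (b - q))

theorem crossRatio_neg (a p q b : ℝ) : crossRatio (-a) (-p) (-q) (-b) = crossRatio a p q b := by
  unfold crossRatio
  rw [show -b - -a = -(b - a) by ring, show -q - -p = -(q - p) by ring,
    show -p - -a = -(p - a) by ring, show -b - -q = -(b - q) by ring, neg_mul_neg, neg_mul_neg]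

theorem crossRatio_lt_quad (c : ℝ) {a p q b : ℝ} (ha : 0 ≤ a) (hap : a < p) (hpq : p < q)
    (hqb : q < b) :
    crossRatio a p q b < crossRatio (quad c a) (quad c p) (quad c q) (quad c b) := by
  unfold crossRatio quad
  have h1 : 0 < p - a := by linarith
  have h2 : 0 < b - q := by linarith
  have h3 : 0 < (b - p) * (q - a) := mul_pos (by linarith) (by linarith)
  have h4 : 0 < (b - a) * (q - p) := mul_pos (by linarith) (by linarith)
  rw [show b ^ 2 + c - (a ^ 2 + c) = (b - a) * (b + a) by ring,
    show q ^ 2 + c - (p ^ 2 + c) = (q - p) * (q + p) by ring,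
    show p ^ 2 + c - (a ^ 2 + c) = (p - a) * (p + a) by ring,
    show b ^ 2 + c - (q ^ 2 + c) = (b - q) * (b + q) by ring]
  have h5 : 0 < (p + a) * (b + q) := mul_pos (by linarith) (by linarith)
  rw [show (b - a) * (b + a) * ((q - p) * (q + p)) =
      (b - a) * (q - p) * ((b + a) * (q + p)) by ring,
    show (p - a) * (p + a) * ((b - q) * (b + q)) = (p - a) * (b - q) * ((p + a) * (b + q)) by ring,
    mul_div_mul_comm ((b - a) * (q - p))]
  refine lt_mul_of_one_lt_right (div_pos h4 (mul_pos h1 h2)) ?_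
  rw [one_lt_div h5]
  nlinarith

/-- Four points in monotone order, increasing or decreasing. -/
def Ordered4 (a p q b : ℝ) : Prop := (a < p ∧ p < q ∧ q < b) ∨ (b < q ∧ q < p ∧ p < a)

theorem crossRatio_lt_quad_of_ordered (c : ℝ) {a p q b : ℝ} (h : Ordered4 a p q b)
    (hs : (0 ≤ a ∧ 0 ≤ b) ∨ (a ≤ 0 ∧ b ≤ 0)) :
    crossRatio a p q b < crossRatio (quad c a) (quad c p) (quad c q) (quad c b) := by
  have rev : ∀ a p q b : ℝ, crossRatio a p q b = crossRatio b q p a := by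
    intro a p q b; unfold crossRatio
    rw [show (b - a) * (q - p) = (a - b) * (p - q) by ring,
      show (p - a) * (b - q) = (q - b) * (a - p) by ring]
  have neg : ∀ x, quad c (-x) = quad c x := by intro x; simp [quad]
  rcases h with ⟨h1, h2, h3⟩ | ⟨h1, h2, h3⟩ <;> rcases hs with ⟨h4, h5⟩ | ⟨h4, h5⟩
  · exact crossRatio_lt_quad c h4 h1 h2 h3
  · have := crossRatio_lt_quad c (a := -b) (p := -q) (q := -p) (b := -a) (by linarith)
      (by linarith) (by linarith) (by linarith)
    rwa [crossRatio_neg, neg, neg, neg, neg, rev, rev (quad c b)] at this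
  · rw [rev, rev (quad c a)]
    exact crossRatio_lt_quad c h5 h1 h2 h3
  · have := crossRatio_lt_quad c (a := -a) (p := -p) (q := -q) (b := -b) (by linarith)
      (by linarith) (by linarith) (by linarith)
    rwa [crossRatio_neg, neg, neg, neg, neg] at this

/-- Where `f^n` is monotone it does not decrease cross-ratios. -/
theorem NoZero.crossRatio_le {c : ℝ} {n : ℕ} {a p q b : ℝ} (h : NoZero c n a b) (hap : a < p)
    (hpq : p < q) (hqb : q < b) :
    crossRatio a p q b ≤
      crossRatio ((quad c)^[n] a) ((quad c)^[n] p) ((quad c)^[n] q) ((quad c)^[n] b) := by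
  have hab : a < b := hap.trans (hpq.trans hqb)
  have ma : a ∈ Icc a b := left_mem_Icc.2 hab.le
  have mb : b ∈ Icc a b := right_mem_Icc.2 hab.le
  have mp : p ∈ Icc a b := ⟨hap.le, (hpq.trans hqb).le⟩
  have mq : q ∈ Icc a b := ⟨(hap.trans hpq).le, hqb.le⟩
  induction n with
  | zero => exact le_rfl
  | succ n ih =>
    have h' := h.mono n.le_succ le_rfl le_rfl
    refine (ih h').trans ?_
    simp only [Function.iterate_succ_apply']
    refine (crossRatio_lt_quad_of_ordered c ?_ ?_).le
    · rcases h'.strictMonoOn_or_strictAntiOn hab with m | m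
      · exact Or.inl ⟨m ma mp hap, m mp mq hpq, m mq mb hqb⟩
      · exact Or.inr ⟨m mq mb hqb, m mp mq hpq, m ma mp hap⟩
    · rcases h.nonneg_or_nonpos hab n.lt_succ_self with m | m
      · exact Or.inl ⟨m a ma, m b mb⟩
      · exact Or.inr ⟨m a ma, m b mb⟩

/-- The infinitesimal form of the expansion of cross-ratios. -/
theorem NoZero.deriv_expansion {c : ℝ} {n : ℕ} (hn : n ≠ 0) {a p b : ℝ} (h : NoZero c n a b)
    (hap : a < p) (hpb : p < b) :
    (b - a) / ((p - a) * (b - p)) <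
      deriv (quad c)^[n] p * (((quad c)^[n] b - (quad c)^[n] a) /
        (((quad c)^[n] p - (quad c)^[n] a) * ((quad c)^[n] b - (quad c)^[n] p))) := by
  have hab : a < b := hap.trans hpb
  have ma : a ∈ Icc a b := left_mem_Icc.2 hab.le
  have mb : b ∈ Icc a b := right_mem_Icc.2 hab.le
  have mp : p ∈ Icc a b := ⟨hap.le, hpb.le⟩
  have step : ∀ m, NoZero c (m + 1) a b →
      (b - a) / ((p - a) * (b - p)) ≤ deriv (quad c)^[m] p * (((quad c)^[m] b - (quad c)^[m] a) /
        (((quad c)^[m] p - (quad c)^[m] a) * ((quad c)^[m] b - (quad c)^[m] p))) →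
      (b - a) / ((p - a) * (b - p)) < deriv (quad c)^[m+1] p *
        (((quad c)^[m+1] b - (quad c)^[m+1] a) /
        (((quad c)^[m+1] p - (quad c)^[m+1] a) * ((quad c)^[m+1] b - (quad c)^[m+1] p))) := by
    intro m hm hle
    have hd : deriv (quad c)^[m+1] p = 2 * (quad c)^[m] p * deriv (quad c)^[m] p := by
      rw [Function.iterate_succ']
      have := (hasDerivAt_quad c ((quad c)^[m] p)).comp p
        (differentiable_quad_iterate c m p).hasDerivAt
      exact this.deriv
    rw [hd]
    simp only [Function.iterate_succ_apply']
    have hmono := (hm.mono m.le_succ le_rfl le_rfl).strictMonoOn_or_strictAntiOn hab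
    have hsgn := hm.nonneg_or_nonpos hab m.lt_succ_self
    have hall : (0 ≤ (quad c)^[m] a ∧ 0 ≤ (quad c)^[m] b) ∨
      ((quad c)^[m] a ≤ 0 ∧ (quad c)^[m] b ≤ 0) :=
      hsgn.imp (fun h => ⟨h a ma, h b mb⟩) (fun h => ⟨h a ma, h b mb⟩)
    have hord : ((quad c)^[m] a < (quad c)^[m] p ∧ (quad c)^[m] p < (quad c)^[m] b) ∨
        ((quad c)^[m] b < (quad c)^[m] p ∧ (quad c)^[m] p < (quad c)^[m] a) :=
      hmono.imp (fun h => ⟨h ma mp hap, h mp mb hpb⟩) (fun h => ⟨h mp mb hpb, h ma mp hap⟩)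
    set A := (quad c)^[m] a
    set P := (quad c)^[m] p
    set B := (quad c)^[m] b
    set D := deriv (quad c)^[m] p
    have hpos : 0 < (b - a) / ((p - a) * (b - p)) :=
      div_pos (by linarith) (mul_pos (by linarith) (by linarith))
    have hPA : P - A ≠ 0 := by rcases hord with h | h <;> intro h0 <;> linarith [h.1, h.2]
    have hBP : B - P ≠ 0 := by rcases hord with h | h <;> intro h0 <;> linarith [h.1, h.2]
    have h5 : 0 < (P + A) * (B + P) := by
      rcases hord with h | h <;> rcases hall with h' | h'
      · exact mul_pos (by linarith [h.1, h.2, h'.1]) (by linarith [h.1, h.2, h'.1])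
      · exact mul_pos_of_neg_of_neg (by linarith [h.1, h.2, h'.2]) (by linarith [h.1, h.2, h'.2])
      · exact mul_pos (by linarith [h.1, h.2, h'.2]) (by linarith [h.1, h.2, h'.2])
      · exact mul_pos_of_neg_of_neg (by linarith [h.1, h.2, h'.1]) (by linarith [h.1, h.2, h'.1])
    have h6 : 0 < (B - P) * (P - A) := by
      rcases hord with h | h
      · exact mul_pos (by linarith [h.2]) (by linarith [h.1])
      · exact mul_pos_of_neg_of_neg (by linarith [h.1]) (by linarith [h.2])
    have hPA' : P + A ≠ 0 := left_ne_zero_of_mul h5.ne'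
    have hBP' : B + P ≠ 0 := right_ne_zero_of_mul h5.ne'
    have key : 2 * P * D * ((quad c B - quad c A) / ((quad c P - quad c A) * (quad c B - quad c P)))
        = D * ((B - A) / ((P - A) * (B - P))) * (2 * P * (B + A) / ((P + A) * (B + P))) := by
      unfold quad
      rw [show B ^ 2 + c - (A ^ 2 + c) = (B - A) * (B + A) by ring,
        show P ^ 2 + c - (A ^ 2 + c) = (P - A) * (P + A) by ring,
        show B ^ 2 + c - (P ^ 2 + c) = (B - P) * (B + P) by ring]
      field_simp
    rw [key]
    refine hle.trans_lt (lt_mul_of_one_lt_right (hpos.trans_le hle) ?_)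
    rw [one_lt_div h5]
    nlinarith
  have weak : ∀ m, NoZero c m a b → (b - a) / ((p - a) * (b - p)) ≤
      deriv (quad c)^[m] p * (((quad c)^[m] b - (quad c)^[m] a) /
        (((quad c)^[m] p - (quad c)^[m] a) * ((quad c)^[m] b - (quad c)^[m] p))) := by
    intro m
    induction m with
    | zero => intro _; simp
    | succ m ih => intro hm; exact (step m hm (ih (hm.mono m.le_succ le_rfl le_rfl))).le
  obtain ⟨m, rfl⟩ := Nat.exists_eq_succ_of_ne_zero hn
  exact step m h (weak m (h.mono m.le_succ le_rfl le_rfl))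

/-! ### The cycle of a periodic interval -/

/-- A monotone map sends interior points of an interval to interior points of the image. -/
theorem image_mem_interior {g : ℝ → ℝ} (hg : Continuous g) {a b : ℝ}
    (hm : StrictMonoOn g (Icc a b) ∨ StrictAntiOn g (Icc a b)) {S : Set ℝ} (hS : Icc a b ⊆ S)
    {x : ℝ} (hx : x ∈ Ioo a b) : g x ∈ interior (g '' S) := by
  have hab : a < b := hx.1.trans hx.2
  have ma : a ∈ Icc a b := left_mem_Icc.2 hab.le
  have mb : b ∈ Icc a b := right_mem_Icc.2 hab.le
  have mx : x ∈ Icc a b := ⟨hx.1.le, hx.2.le⟩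
  have key : ∀ y ∈ uIcc (g a) (g b), y ∈ g '' S := fun y hy => by
    have := intermediate_value_uIcc hg.continuousOn hy
    rw [uIcc_of_le hab.le] at this
    exact image_mono hS this
  rcases hm with hm | hm
  · exact mem_interior.2 ⟨Ioo (g a) (g b), fun y hy => key y (Icc_subset_uIcc ⟨hy.1.le, hy.2.le⟩),
      isOpen_Ioo, hm ma mx hx.1, hm mx mb hx.2⟩
  · exact mem_interior.2 ⟨Ioo (g b) (g a), fun y hy => key y (Icc_subset_uIcc' ⟨hy.1.le, hy.2.le⟩),
      isOpen_Ioo, hm mx mb hx.2, hm ma mx hx.1⟩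

/-- Two continuous functions on `[a, b]` with no common value on `(a, b)` have separated images. -/
theorem separated_of_ne {g h : ℝ → ℝ} (hg : Continuous g) (hh : Continuous h) {a b : ℝ}
    (hab : a < b) (hne : ∀ x ∈ Ioo a b, ∀ y ∈ Ioo a b, g x ≠ h y) :
    (∀ x ∈ Icc a b, ∀ y ∈ Icc a b, g x ≤ h y) ∨ (∀ x ∈ Icc a b, ∀ y ∈ Icc a b, h y ≤ g x) := by
  have hc : Continuous fun p : ℝ × ℝ => g p.1 - h p.2 := by fun_prop
  have hpre : IsPreconnected (Ioo a b ×ˢ Ioo a b) := isPreconnected_Ioo.prod isPreconnected_Ioo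
  have hcl : Icc a b ×ˢ Icc a b = closure (Ioo a b ×ˢ Ioo a b) := by
    rw [closure_prod_eq, closure_Ioo hab.ne]
  have key : (∀ p ∈ Ioo a b ×ˢ Ioo a b, g p.1 - h p.2 < 0) ∨
      (∀ p ∈ Ioo a b ×ˢ Ioo a b, 0 < g p.1 - h p.2) := by
    by_contra! hcon
    obtain ⟨⟨x, hx, hx'⟩, y, hy, hy'⟩ := hcon
    obtain ⟨z, hz, hz'⟩ := hpre.intermediate_value hy hx hc.continuousOn ⟨hy', hx'⟩
    exact hne z.1 hz.1 z.2 hz.2 (sub_eq_zero.1 hz')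
  rcases key with k | k
  · left; intro x hx y hy
    have : (x, y) ∈ closure (Ioo a b ×ˢ Ioo a b) := hcl ▸ ⟨hx, hy⟩
    exact closure_minimal (t := {p : ℝ × ℝ | g p.1 ≤ h p.2}) (fun p hp => by
      have := k p hp; simp only [mem_ofPred_eq]; linarith)
      (isClosed_le (by fun_prop) (by fun_prop)) this
  · right; intro x hx y hy
    have : (x, y) ∈ closure (Ioo a b ×ˢ Ioo a b) := hcl ▸ ⟨hx, hy⟩
    exact closure_minimal (t := {p : ℝ × ℝ | h p.2 ≤ g p.1}) (fun p hp => by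
      have := k p hp; simp only [mem_ofPred_eq]; linarith)
      (isClosed_le (by fun_prop) (by fun_prop)) this

namespace IsPeriodicInterval

variable {c u : ℝ} {s : ℕ}

/-- For `0 < j < s`, a zero of `f^j` in `(0, u)` would put `0` into the interiors of both `V` and
`f^j V`. -/
theorem noZero (h : IsPeriodicInterval c u s) : NoZero c s 0 u := by
  have key : ∀ k ≤ s, NoZero c k 0 u := by
    intro k
    induction k with
    | zero => intro _ j hj; omega
    | succ k ih =>
      intro hk j hj x hx h0
      have hN := ih (by omega)
      rcases Nat.lt_succ_iff_lt_or_eq.1 hj with hj | rfl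
      · exact hN j hj x hx h0
      rcases Nat.eq_zero_or_pos j with rfl | hjpos
      · simp only [Function.iterate_zero, id] at h0; exact hx.1.ne' h0
      have hsub : Icc 0 u ⊆ Icc (-u) u := Icc_subset_Icc_left (by linarith [h.pos])
      have h1 := image_mem_interior (continuous_quad_iterate c j)
        (hN.strictMonoOn_or_strictAntiOn h.pos) hsub hx
      rw [h0] at h1
      have h2 : (0:ℝ) ∈ interior ((quad c)^[0] '' Icc (-u) u) := by
        simp [interior_Icc, h.pos]
      exact (h.disjoint 0 j hjpos (by omega)).le_bot ⟨h2, h1⟩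
  exact key s le_rfl

theorem strictMonoOn_or (h : IsPeriodicInterval c u s) {k : ℕ} (hk : k ≤ s) :
    StrictMonoOn (quad c)^[k] (Icc 0 u) ∨ StrictAntiOn (quad c)^[k] (Icc 0 u) :=
  (h.noZero.mono hk le_rfl le_rfl).strictMonoOn_or_strictAntiOn h.pos

theorem mem_interior (h : IsPeriodicInterval c u s) {k : ℕ} (hk : k ≤ s) {x : ℝ}
    (hx : x ∈ Ioo 0 u) : (quad c)^[k] x ∈ interior ((quad c)^[k] '' Icc (-u) u) :=
  image_mem_interior (continuous_quad_iterate c k) (h.strictMonoOn_or hk)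
    (Icc_subset_Icc_left (by linarith [h.pos])) hx

/-- The intervals of the cycle other than `V` lie outside `(-u, u)`. -/
theorem le_abs (h : IsPeriodicInterval c u s) {k : ℕ} (hk : 0 < k) (hks : k < s) {x : ℝ}
    (hx : x ∈ Icc 0 u) : u ≤ |(quad c)^[k] x| := by
  rw [← closure_Ioo h.pos.ne] at hx
  refine closure_minimal (t := {x | u ≤ |(quad c)^[k] x|}) (fun x hx => ?_)
    (isClosed_le continuous_const (continuous_quad_iterate c k).abs) hx
  by_contra hlt
  simp only [mem_ofPred_eq, not_le, abs_lt] at hlt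
  refine (h.disjoint 0 k hk hks).le_bot ⟨?_, h.mem_interior hks.le hx⟩
  simpa [interior_Icc] using hlt

theorem abs_le (h : IsPeriodicInterval c u s) {x : ℝ} (hx : x ∈ Icc 0 u) :
    |(quad c)^[s] x| ≤ u :=
  _root_.abs_le.2 (h.mapsTo ⟨by linarith [hx.1, h.pos], hx.2⟩)

/-- Different intervals of the cycle `f V, …, f^s V` lie side by side, with at most an end in
common. -/
theorem separated (h : IsPeriodicInterval c u s) {i j : ℕ} (hij : i < j) (hi : 0 < i)
    (hj : j ≤ s) :
    (∀ x ∈ Icc 0 u, ∀ y ∈ Icc 0 u, (quad c)^[i] x ≤ (quad c)^[j] y) ∨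
      (∀ x ∈ Icc 0 u, ∀ y ∈ Icc 0 u, (quad c)^[j] y ≤ (quad c)^[i] x) := by
  rcases hj.lt_or_eq with hj | rfl
  · refine separated_of_ne (continuous_quad_iterate c i) (continuous_quad_iterate c j) h.pos ?_
    intro x hx y hy hxy
    refine (h.disjoint i j hij hj).le_bot ⟨h.mem_interior (by omega) hx, ?_⟩
    rw [hxy]; exact h.mem_interior hj.le hy
  · have hne : ∀ x ∈ Ioo 0 u, (quad c)^[i] x ≠ 0 := fun x hx h0 => by
      have := h.le_abs hi hij (Ioo_subset_Icc_self hx)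
      rw [h0, abs_zero] at this; linarith [h.pos]
    rcases nonneg_or_nonpos_of_ne_zero (continuous_quad_iterate c i) h.pos hne with k | k
    · right; intro x hx y hy
      have h1 := h.le_abs hi hij hx
      rw [abs_of_nonneg (k x hx)] at h1
      exact (le_abs_self _).trans ((h.abs_le hy).trans h1)
    · left; intro x hx y hy
      have h1 := h.le_abs hi hij hx
      rw [abs_of_nonpos (k x hx)] at h1
      have h2 := neg_abs_le ((quad c)^[j] y)
      linarith [h.abs_le hy]

/-- The moduli of two different intervals of the cycle are separated as well. -/
theorem separated_abs (h : IsPeriodicInterval c u s) {i j : ℕ} (hij : i ≠ j)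
    (his : i < s) (hjs : j < s) :
    (∀ x ∈ Icc 0 u, ∀ y ∈ Icc 0 u, |(quad c)^[i] x| ≤ |(quad c)^[j] y|) ∨
      (∀ x ∈ Icc 0 u, ∀ y ∈ Icc 0 u, |(quad c)^[j] y| ≤ |(quad c)^[i] x|) := by
  have sq : ∀ i j : ℕ, ∀ x y : ℝ, (quad c)^[i+1] x ≤ (quad c)^[j+1] y →
      |(quad c)^[i] x| ≤ |(quad c)^[j] y| := by
    intro i j x y hxy
    simp only [Function.iterate_succ_apply', quad] at hxy
    exact sq_le_sq.1 (by simpa using hxy)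
  rcases lt_or_gt_of_ne hij with hlt | hlt
  · exact (h.separated (Nat.succ_lt_succ hlt) i.succ_pos hjs).imp
      (fun k x hx y hy => sq _ _ _ _ (k x hx y hy)) (fun k x hx y hy => sq _ _ _ _ (k x hx y hy))
  · exact ((h.separated (Nat.succ_lt_succ hlt) j.succ_pos his).imp
      (fun k x hx y hy => sq _ _ _ _ (k y hy x hx))
      (fun k x hx y hy => sq _ _ _ _ (k y hy x hx))).symm

end IsPeriodicInterval

section

open Filter Topology

/-! ### Periodic points of infinitely renormalizable maps are repelling -/

theorem deriv_quad_iterate_add_self {c p : ℝ} {n : ℕ} (hp : (quad c)^[n] p = p) :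
    deriv (quad c)^[n + n] p = deriv (quad c)^[n] p ^ 2 := by
  rw [Function.iterate_add, deriv_comp _ (differentiable_quad_iterate c n _)
    (differentiable_quad_iterate c n _), hp, sq]

theorem le_quad_iterate {c x : ℝ} (hx : 1 + |c| ≤ x) (n : ℕ) :
    x ≤ (quad c)^[n] x := by
  induction n with
  | zero => exact le_rfl
  | succ n ih =>
    rw [Function.iterate_succ_apply']
    refine ih.trans ?_
    have h1 := neg_abs_le c
    have h2 := abs_nonneg c
    generalize (quad c)^[n] x = y at *
    unfold quad
    nlinarith [mul_nonneg h2 (sub_nonneg.2 (hx.trans ih)), mul_nonneg (sub_nonneg.2 (hx.trans ih))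
      (sub_nonneg.2 (hx.trans ih))]

theorem isClosed_precritical (c : ℝ) (n : ℕ) : IsClosed {x : ℝ | ∃ j < n, (quad c)^[j] x = 0} := by
  have : {x : ℝ | ∃ j < n, (quad c)^[j] x = 0} = ⋃ j ∈ Iio n, (quad c)^[j] ⁻¹' {0} := by
    ext x; simp
  rw [this]
  exact (finite_Iio n).isClosed_biUnion fun j _ =>
    isClosed_singleton.preimage (continuous_quad_iterate c j)

namespace IsPeriodicInterval

variable {c u : ℝ} {s : ℕ}

/-- An interval of the cycle other than `V` does not consist of the points `u` and `-u` alone. -/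
theorem exists_lt_abs (h : IsPeriodicInterval c u s) {k : ℕ} (hk : 0 < k) (hks : k < s) :
    ∃ x ∈ Icc 0 u, u < |(quad c)^[k] x| := by
  by_contra! hcon
  have hu := h.pos
  have key : ∀ x ∈ Icc 0 u, (quad c)^[k] x = u ∨ (quad c)^[k] x = -u := fun x hx =>
    eq_or_eq_neg_of_abs_eq (le_antisymm (hcon x hx) (h.le_abs hk hks hx))
  have m0 : (0:ℝ) ∈ Icc 0 u := ⟨le_rfl, hu.le⟩
  have m1 : u / 2 ∈ Icc 0 u := ⟨by linarith, by linarith⟩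
  have m2 : u ∈ Icc 0 u := ⟨hu.le, le_rfl⟩
  have k0 := key 0 m0
  have k1 := key _ m1
  have k2 := key _ m2
  rcases h.strictMonoOn_or hks.le with m | m
  all_goals
    have l1 := m m0 m1 (by linarith)
    have l2 := m m1 m2 (by linarith)
    rcases k0 with k0 | k0 <;> rcases k1 with k1 | k1 <;> rcases k2 with k2 | k2 <;> linarith

/-- The orbit of a critical point of `f^N` under `f^N` does not converge when `f` has a
renormalization of period larger than `2 N`: the limit would give a common point of `V` and two
further intervals of the cycle. -/
theorem not_tendsto_of_precritical (h : IsPeriodicInterval c u s) {N : ℕ} (hN : 0 < N)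
    (hNs : 2 * N < s) {b : ℝ} {j : ℕ} (hb : (quad c)^[j] b = 0) (e : ℝ)
    (ht : Tendsto (fun k => ((quad c)^[N])^[k] b) atTop (𝓝 e)) : False := by
  have hu := h.pos
  have hfix : (quad c)^[N] e = e :=
    isFixedPt_of_tendsto_iterate ht (continuous_quad_iterate c N).continuousAt
  set e₀ := (quad c)^[j] e with he₀
  have hfix₀ : (quad c)^[N] e₀ = e₀ := by
    rw [he₀, ← Function.iterate_add_apply, add_comm, Function.iterate_add_apply, hfix]
  have hlim : Tendsto (fun k => ((quad c)^[s])^[N * k] 0) atTop (𝓝 e₀) := by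
    have h1 : Tendsto (fun k => (quad c)^[j] (((quad c)^[N])^[k] b)) atTop (𝓝 e₀) :=
      ((continuous_quad_iterate c j).tendsto e).comp ht
    have h2 : Tendsto (fun k : ℕ => s * k) atTop atTop :=
      tendsto_id.const_mul_atTop' (by have := h.two_le; omega)
    refine (h1.comp h2).congr fun k => ?_
    simp only [Function.comp]
    rw [← Function.iterate_mul, ← Function.iterate_add_apply, add_comm,
      Function.iterate_add_apply, hb, ← Function.iterate_mul]
    rw [mul_left_comm]
  have hV : e₀ ∈ Icc (-u) u := by
    refine isClosed_Icc.mem_of_tendsto hlim (Eventually.of_forall fun k => ?_)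
    exact h.mapsTo.iterate _ ⟨by linarith, hu.le⟩
  have habs : |e₀| ∈ Icc 0 u := ⟨abs_nonneg _, _root_.abs_le.2 hV⟩
  have hN1 : |(quad c)^[N] (|e₀|)| = |e₀| := by rw [quad_iterate_abs c hN.ne', hfix₀]
  have hN2 : |(quad c)^[2 * N] (|e₀|)| = |e₀| := by
    rw [quad_iterate_abs c (by omega), two_mul, Function.iterate_add_apply, hfix₀, hfix₀]
  obtain ⟨x, hx, hxu⟩ := h.exists_lt_abs hN (by omega)
  obtain ⟨y, hy, hyu⟩ := h.exists_lt_abs (k := 2 * N) (by omega) hNs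
  rcases h.separated_abs (i := N) (j := 2 * N) (by omega) (by omega) hNs with k | k
  · have := k x hx _ habs
    rw [hN2] at this; linarith [habs.2]
  · have := k _ habs y hy
    rw [hN1] at this; linarith [habs.2]

end IsPeriodicInterval

/-- An infinitely renormalizable map has no attracting and no neutral real cycle. For a point `p` of
such a cycle, fixed by `f^N` with a derivative in `[0, 1]`, the nearest critical points of `f^N` on
both sides of `p` are moved away from `p`, and this contradicts the expansion of cross-ratios. -/
theorem allPeriodicRepelling_of_isInfinitelyRenormalizable {c : ℝ}
    (hinf : IsInfinitelyRenormalizable c) : AllPeriodicRepelling c := by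
  intro n p hn hp
  by_contra hle
  rw [not_lt] at hle
  obtain ⟨s, hs, u, h⟩ := hinf (2 * (n + n) + 1)
  have hu := h.pos
  set N := n + n with hNdef
  have hN : 0 < N := by omega
  have hpN : (quad c)^[N] p = p := by rw [hNdef, Function.iterate_add_apply, hp, hp]
  have hd : deriv (quad c)^[N] p = deriv (quad c)^[n] p ^ 2 := deriv_quad_iterate_add_self hp
  have hd0 : 0 ≤ deriv (quad c)^[N] p := by rw [hd]; positivity
  have hd1 : deriv (quad c)^[N] p ≤ 1 := by
    rw [hd]; exact (sq_le_one_iff_abs_le_one _).2 hle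
  set S := {x : ℝ | ∃ j < N, (quad c)^[j] x = 0} with hS
  have hSc : IsClosed S := isClosed_precritical c N
  have hpS : p ∉ S := by
    rintro ⟨j, _, hj0⟩
    have h0 : (quad c)^[N] 0 = 0 := by
      rw [← hj0, ← Function.iterate_add_apply, add_comm, Function.iterate_add_apply, hpN]
    have := h.le_abs (k := N) hN (by omega) (x := 0) ⟨le_rfl, hu.le⟩
    rw [h0, abs_zero] at this; linarith
  have noZero_of : ∀ a b, (∀ x ∈ Ioo a b, x ∉ S) → NoZero c N a b :=
    fun a b hab j hj x hx h0 => hab x hx ⟨j, hj, h0⟩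
  obtain ⟨δ, hδ, hball⟩ := Metric.isOpen_iff.1 hSc.isOpen_compl p hpS
  -- near `p`, which is not precritical, `f^N` preserves the orientation
  have hmono : StrictMonoOn (quad c)^[N] (Icc (p - δ) (p + δ)) := by
    have hnz : NoZero c N (p - δ) (p + δ) := noZero_of _ _ fun x hx => hball (by
      rw [Metric.mem_ball, Real.dist_eq, abs_lt]; constructor <;> linarith [hx.1, hx.2])
    rcases hnz.strictMonoOn_or_strictAntiOn (by linarith) with m | m
    · exact m
    exfalso
    have h1 := m.antitoneOn.derivWithin_nonpos (x := p)
    rw [derivWithin_of_mem_nhds (Icc_mem_nhds (by linarith) (by linarith))] at h1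
    have h2 := hnz.deriv_expansion hN.ne' (p := p) (by linarith) (by linarith)
    rw [le_antisymm h1 hd0, zero_mul] at h2
    have : (0:ℝ) < (p + δ - (p - δ)) / ((p - (p - δ)) * (p + δ - p)) := by
      have e1 : p + δ - (p - δ) = 2 * δ := by ring
      have e2 : (p - (p - δ)) * (p + δ - p) = δ * δ := by ring
      rw [e1, e2]; positivity
    linarith
  -- the nearest critical point on the right of `p` is moved away from `p`, for otherwise its orbit
  -- under `f^N` decreases to a fixed point
  have right : ∃ b, p < b ∧ NoZero c N p b ∧ b ≤ (quad c)^[N] b := by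
    by_cases hne : (S ∩ Ici p).Nonempty
    · have hbdd : BddBelow (S ∩ Ici p) := ⟨p, fun x hx => hx.2⟩
      have hb := (hSc.inter isClosed_Ici).csInf_mem hne hbdd
      set b := sInf (S ∩ Ici p)
      have hpb : p < b := lt_of_le_of_ne hb.2 fun h => hpS (h ▸ hb.1)
      have hnz : NoZero c N p b := noZero_of _ _ fun x hx hxS =>
        absurd (csInf_le hbdd ⟨hxS, hx.1.le⟩) (not_le.2 hx.2)
      refine ⟨b, hpb, hnz, ?_⟩
      by_contra! hlt
      have hm : StrictMonoOn (quad c)^[N] (Icc p b) := by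
        rcases hnz.strictMonoOn_or_strictAntiOn hpb with m | m
        · exact m
        exfalso
        have hq : p < min b (p + δ) := lt_min hpb (by linarith)
        have l1 := m ⟨le_rfl, hpb.le⟩ ⟨hq.le, min_le_left _ _⟩ hq
        have l2 := hmono ⟨by linarith, by linarith⟩
          ⟨by linarith, min_le_right _ _⟩ hq
        linarith
      have hseq : ∀ k, ((quad c)^[N])^[k] b ∈ Icc p b ∧
          ((quad c)^[N])^[k + 1] b ≤ ((quad c)^[N])^[k] b := by
        intro k
        induction k with
        | zero => exact ⟨⟨hpb.le, le_rfl⟩, hlt.le⟩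
        | succ k ih =>
          have m1 : ((quad c)^[N])^[k + 1] b ∈ Icc p b := by
            refine ⟨?_, ih.2.trans ih.1.2⟩
            rw [Function.iterate_succ_apply']
            have := hm.monotoneOn ⟨le_rfl, hpb.le⟩ ih.1 ih.1.1
            rwa [hpN] at this
          refine ⟨m1, ?_⟩
          have := hm.monotoneOn m1 ih.1 ih.2
          rw [← Function.iterate_succ_apply' ((quad c)^[N]),
            ← Function.iterate_succ_apply' ((quad c)^[N])] at this
          exact this
      obtain ⟨j, _, hj0⟩ := hb.1
      refine h.not_tendsto_of_precritical hN (by omega) hj0 _ (tendsto_atTop_ciInf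
        (antitone_nat_of_succ_le fun k => (hseq k).2) ⟨p, ?_⟩)
      rintro _ ⟨k, rfl⟩
      exact (hseq k).1.1
    · refine ⟨max (p + 1) (1 + |c|), lt_max_of_lt_left (by linarith), ?_,
        le_quad_iterate (le_max_right _ _) N⟩
      exact noZero_of _ _ fun x hx hxS => hne ⟨x, hxS, hx.1.le⟩
  -- the mirror image on the left of `p`
  have left : ∃ a, a < p ∧ NoZero c N a p ∧ (quad c)^[N] a ≤ a := by
    have hm : ∀ a < p, NoZero c N a p → StrictMonoOn (quad c)^[N] (Icc a p) := by
      intro a hap hnz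
      rcases hnz.strictMonoOn_or_strictAntiOn hap with m | m
      · exact m
      exfalso
      have hq : max a (p - δ) < p := max_lt hap (by linarith)
      have l1 := m ⟨le_max_left _ _, hq.le⟩ ⟨hap.le, le_rfl⟩ hq
      have l2 := hmono ⟨le_max_right _ _, by linarith⟩ ⟨by linarith, by linarith⟩ hq
      linarith
    by_cases hne : (S ∩ Iic p).Nonempty
    · have hbdd : BddAbove (S ∩ Iic p) := ⟨p, fun x hx => hx.2⟩
      have hb := (hSc.inter isClosed_Iic).csSup_mem hne hbdd
      set b := sSup (S ∩ Iic p)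
      have hpb : b < p := lt_of_le_of_ne hb.2 fun h => hpS (h ▸ hb.1)
      have hnz : NoZero c N b p := noZero_of _ _ fun x hx hxS =>
        absurd (le_csSup hbdd ⟨hxS, hx.2.le⟩) (not_le.2 hx.1)
      refine ⟨b, hpb, hnz, ?_⟩
      by_contra! hlt
      have hm := hm b hpb hnz
      have hseq : ∀ k, ((quad c)^[N])^[k] b ∈ Icc b p ∧
          ((quad c)^[N])^[k] b ≤ ((quad c)^[N])^[k + 1] b := by
        intro k
        induction k with
        | zero => exact ⟨⟨le_rfl, hpb.le⟩, hlt.le⟩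
        | succ k ih =>
          have m1 : ((quad c)^[N])^[k + 1] b ∈ Icc b p := by
            refine ⟨ih.1.1.trans ih.2, ?_⟩
            rw [Function.iterate_succ_apply']
            have := hm.monotoneOn ih.1 ⟨hpb.le, le_rfl⟩ ih.1.2
            rwa [hpN] at this
          refine ⟨m1, ?_⟩
          have := hm.monotoneOn ih.1 m1 ih.2
          rw [← Function.iterate_succ_apply' ((quad c)^[N]),
            ← Function.iterate_succ_apply' ((quad c)^[N])] at this
          exact this
      obtain ⟨j, _, hj0⟩ := hb.1
      refine h.not_tendsto_of_precritical hN (by omega) hj0 _ (tendsto_atTop_ciSup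
        (monotone_nat_of_le_succ fun k => (hseq k).2) ⟨p, ?_⟩)
      rintro _ ⟨k, rfl⟩
      exact (hseq k).1.2
    · -- without critical points on the left, `f^N` would increase from `+∞`
      exfalso
      set R := max (|p| + 1) (1 + |c|)
      have hR : -R < p := by
        have := le_max_left (|p| + 1) (1 + |c|)
        linarith [neg_abs_le p]
      have h1 := hm (-R) hR (noZero_of _ _ fun x hx hxS => hne ⟨x, hxS, hx.2.le⟩)
        ⟨le_rfl, hR.le⟩ ⟨hR.le, le_rfl⟩ hR
      rw [hpN, quad_iterate_neg c hN.ne'] at h1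
      have h2 := le_quad_iterate (c := c) (x := R) (le_max_right _ _) N
      have := le_max_left (|p| + 1) (1 + |c|)
      linarith [le_abs_self p]
  obtain ⟨b, hpb, hnzb, hGb⟩ := right
  obtain ⟨a, hap, hnza, hGa⟩ := left
  have hnz : NoZero c N a b := noZero_of _ _ fun x hx hxS => by
    obtain ⟨j, hj, h0⟩ := hxS
    rcases lt_trichotomy x p with hxp | rfl | hxp
    · exact hnza j hj x ⟨hx.1, hxp⟩ h0
    · exact hpS ⟨j, hj, h0⟩
    · exact hnzb j hj x ⟨hxp, hx.2⟩ h0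
  have hexp := hnz.deriv_expansion hN.ne' hap hpb
  rw [hpN] at hexp
  set A := (quad c)^[N] a
  set B := (quad c)^[N] b
  -- moving both ends away from `p` decreases the cross-ratio, so the derivative exceeds `1`
  have split : ∀ x y : ℝ, x < p → p < y → (y - x) / ((p - x) * (y - p)) =
      1 / (p - x) + 1 / (y - p) := by
    intro x y hx hy
    have h1 : p - x ≠ 0 := by intro h; linarith
    have h2 : y - p ≠ 0 := by intro h; linarith
    field_simp
    ring
  rw [split a b hap hpb, split A B (by linarith) (by linarith)] at hexp
  have h1 : 1 / (p - A) ≤ 1 / (p - a) := one_div_le_one_div_of_le (by linarith) (by linarith)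
  have h2 : 1 / (B - p) ≤ 1 / (b - p) := one_div_le_one_div_of_le (by linarith) (by linarith)
  have h3 : 0 < 1 / (p - A) := one_div_pos.2 (by linarith)
  have h4 : 0 < 1 / (B - p) := one_div_pos.2 (by linarith)
  nlinarith

end

section

open Filter Topology

/-! ### Consequences of the absence of attracting and neutral cycles -/

/-- A function that starts above the diagonal and arrives at a repelling fixed point has another
fixed point in between, with multiplier at most `1`. -/
theorem exists_fixedPoint_left {g : ℝ → ℝ} (hg : Differentiable ℝ g) {a p : ℝ} (hap : a < p)
    (hp : g p = p) (hdp : 1 < deriv g p) (ha : a ≤ g a) :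
    ∃ x ∈ Ico a p, g x = x ∧ deriv g x ≤ 1 := by
  have hk : ∀ x, HasDerivAt (fun x => g x - x) (deriv g x - 1) x := fun x =>
    (hg x).hasDerivAt.sub (hasDerivAt_id x)
  have hkc : Continuous fun x => g x - x := hg.continuous.sub continuous_id
  -- close to `p`, on its left, the graph lies below the diagonal
  obtain ⟨q, hqp, hq⟩ : ∃ q < p, ∀ x ∈ Ioo q p, g x - x < 0 := by
    have h1 := (hasDerivAt_iff_tendsto_slope_left_right.1 (hk p)).1
    have h2 : ∀ᶠ x in 𝓝[<] p, 0 < slope (fun x => g x - x) p x :=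
      h1.eventually (lt_mem_nhds (by linarith))
    obtain ⟨q, hq, hq'⟩ := mem_nhdsLT_iff_exists_Ioo_subset.1 h2
    refine ⟨q, hq, fun x hx => ?_⟩
    have := hq' hx
    simp only [mem_ofPred_eq, slope_def_field, hp, sub_self, sub_zero] at this
    rcases div_pos_iff.1 this with h | h
    · linarith [h.2, hx.2]
    · exact h.1
  set T := {x : ℝ | 0 ≤ g x - x} ∩ Icc a (max a ((q + p) / 2)) with hT
  have hm : max a ((q + p) / 2) < p := max_lt hap (by linarith)
  have hTc : IsCompact T := isCompact_Icc.inter_left (isClosed_le continuous_const hkc)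
  have hne : T.Nonempty := ⟨a, by simpa using ha, le_rfl, le_max_left _ _⟩
  have hx := hTc.sSup_mem hne
  set x := sSup T
  have hxp : x < p := hx.2.2.trans_lt hm
  have hright : ∀ y ∈ Ioo x p, g y - y < 0 := by
    intro y hy
    by_cases hyq : q < y
    · exact hq y ⟨hyq, hy.2⟩
    · by_contra! h0
      have : y ∈ T := ⟨h0, hx.2.1.trans hy.1.le, le_max_of_le_right (by linarith)⟩
      exact absurd (le_csSup hTc.bddAbove this) (not_le.2 hy.1)
  have hev : ∀ᶠ y in 𝓝[>] x, g y - y < 0 := by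
    filter_upwards [Ioo_mem_nhdsGT hxp] with y hy using hright y hy
  have h0 : g x - x = 0 := by
    refine le_antisymm ?_ hx.1
    exact le_of_tendsto (hkc.continuousWithinAt (s := Ioi x) (x := x)) (hev.mono fun y hy => hy.le)
  refine ⟨x, ⟨hx.2.1, hxp⟩, by linarith, ?_⟩
  have h1 := (hasDerivAt_iff_tendsto_slope_left_right.1 (hk x)).2
  have : deriv g x - 1 ≤ 0 := by
    refine le_of_tendsto h1 ?_
    filter_upwards [hev, self_mem_nhdsWithin] with y hy hy'
    rw [slope_def_field, h0, sub_zero]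
    exact div_nonpos_of_nonpos_of_nonneg hy.le (sub_nonneg.2 (le_of_lt hy'))
  linarith

theorem exists_fixedPoint_right {g : ℝ → ℝ} (hg : Differentiable ℝ g) {p b : ℝ} (hpb : p < b)
    (hp : g p = p) (hdp : 1 < deriv g p) (hb : g b ≤ b) :
    ∃ x ∈ Ioc p b, g x = x ∧ deriv g x ≤ 1 := by
  have hd : ∀ x, deriv (fun x => -g (-x)) x = deriv g (-x) := by
    intro x
    have := ((hg (-x)).hasDerivAt.comp x (hasDerivAt_neg x)).neg
    rw [mul_neg_one, neg_neg] at this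
    exact this.deriv
  obtain ⟨x, hx, hx1, hx2⟩ := exists_fixedPoint_left (g := fun x => -g (-x))
    (hg.comp differentiable_neg).neg (neg_lt_neg hpb) (by simp [hp]) (by rw [hd]; simpa using hdp)
    (by simpa using hb)
  refine ⟨-x, ⟨by linarith [hx.2], by linarith [hx.1]⟩, by linarith, ?_⟩
  rwa [hd] at hx2

/-- A fixed point of `-f^n` is the negative of a fixed point of `f^n`, so it is repelling as well.
-/
theorem AllPeriodicRepelling.one_lt_abs_deriv {c : ℝ} (h : AllPeriodicRepelling c) {ε : ℝ}
    (hε : ε = 1 ∨ ε = -1) {n : ℕ} (hn : 0 < n) {x : ℝ} (hx : ε * (quad c)^[n] x = x) :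
    1 < |deriv (fun x => ε * (quad c)^[n] x) x| := by
  have hd : deriv (fun x => ε * (quad c)^[n] x) x = ε * deriv (quad c)^[n] x :=
    deriv_const_mul _ (differentiable_quad_iterate c n x)
  rw [hd]
  rcases hε with rfl | rfl
  · rw [one_mul] at hx ⊢
    exact h n x hn hx
  · have h1 := h n (-x) hn (by rw [quad_iterate_neg c hn.ne']; linarith)
    have h2 : deriv (quad c)^[n] (-x) = -deriv (quad c)^[n] x := by
      have h3 := deriv_comp_neg (quad c)^[n] x
      rw [show (fun x => (quad c)^[n] (-x)) = (quad c)^[n] from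
        funext (quad_iterate_neg c hn.ne')] at h3
      linarith
    rw [h2] at h1
    simpa using h1

/-- A periodic interval `[-u, u]` of a quadratic map without attracting and neutral cycles,
together with the sign `ε` for which `f^s u = ε u`. -/
structure IsRepellingInterval (c u ε : ℝ) (s : ℕ) : Prop where
  repelling : AllPeriodicRepelling c
  interval : IsPeriodicInterval c u s
  sign : ε = 1 ∨ ε = -1
  endpoint : (quad c)^[s] u = ε * u

theorem IsPeriodicInterval.exists_sign {c u : ℝ} {s : ℕ} (h : IsPeriodicInterval c u s)
    (hr : AllPeriodicRepelling c) : ∃ ε, IsRepellingInterval c u ε s := by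
  rcases h.endpoint with k | k
  · exact ⟨1, hr, h, Or.inl rfl, by linarith⟩
  · exact ⟨-1, hr, h, Or.inr rfl, by linarith⟩

namespace IsRepellingInterval

variable {c u ε : ℝ} {s : ℕ}

theorem pos (h : IsRepellingInterval c u ε s) : 0 < u := h.interval.pos

theorem period_pos (h : IsRepellingInterval c u ε s) : 0 < s := by have := h.interval.two_le; omega

theorem sign_mul_self (h : IsRepellingInterval c u ε s) : ε * ε = 1 := by
  rcases h.sign with h | h <;> rw [h] <;> norm_num

theorem abs_sign (h : IsRepellingInterval c u ε s) : |ε| = 1 := by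
  rcases h.sign with h | h <;> rw [h] <;> norm_num

theorem iterate_sign_mul (h : IsRepellingInterval c u ε s) {n : ℕ} (hn : n ≠ 0) (x : ℝ) :
    (quad c)^[n] (ε * x) = (quad c)^[n] x := by
  rcases h.sign with h | h <;> rw [h]
  · rw [one_mul]
  · rw [neg_one_mul, quad_iterate_neg c hn]

theorem signed_endpoint (h : IsRepellingInterval c u ε s) : ε * (quad c)^[s] u = u := by
  rw [h.endpoint, ← mul_assoc, h.sign_mul_self, one_mul]

/-- The first return map, with the sign that makes it fix the endpoint `u`, is increasing. -/
theorem strictMonoOn_return (h : IsRepellingInterval c u ε s) {p : ℝ} (hup : u ≤ p)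
    (hnz : NoZero c s 0 p) : StrictMonoOn (fun x => ε * (quad c)^[s] x) (Icc 0 p) := by
  have hu := h.pos
  have m0 : (0:ℝ) ∈ Icc 0 p := ⟨le_rfl, hu.le.trans hup⟩
  have mu : u ∈ Icc 0 p := ⟨hu.le, hup⟩
  have h1 := h.interval.abs_le (x := 0) ⟨le_rfl, hu.le⟩
  have h2 := abs_le.1 h1
  have h3 := h.endpoint
  rcases hnz.strictMonoOn_or_strictAntiOn (hu.trans_le hup) with m | m <;>
    rcases h.sign with rfl | rfl
  · exact fun x hx y hy hxy => by simpa using m hx hy hxy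
  · have := m m0 mu hu; linarith
  · have := m m0 mu hu; linarith
  · exact fun x hx y hy hxy => by simpa using m hx hy hxy

theorem deriv_nonneg (h : IsRepellingInterval c u ε s) {p : ℝ} (hup : u ≤ p)
    (hnz : NoZero c s 0 p) {x : ℝ} (hx : x ∈ Icc 0 p) :
    0 ≤ deriv (fun x => ε * (quad c)^[s] x) x := by
  have h1 := (h.strictMonoOn_return hup hnz).monotoneOn.derivWithin_nonneg (x := x)
  rwa [((differentiable_signed_iterate c ε s) x).derivWithin
    (uniqueDiffOn_Icc (h.pos.trans_le hup) x hx)] at h1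

theorem one_lt_deriv_endpoint (h : IsRepellingInterval c u ε s) :
    1 < deriv (fun x => ε * (quad c)^[s] x) u := by
  have h1 := h.repelling.one_lt_abs_deriv h.sign h.period_pos h.signed_endpoint
  rwa [abs_of_nonneg (h.deriv_nonneg le_rfl h.interval.noZero ⟨h.pos.le, le_rfl⟩)] at h1

/-- The critical value of the return map lies on the other side of the critical point. -/
theorem return_zero_neg (h : IsRepellingInterval c u ε s) : ε * (quad c)^[s] 0 < 0 := by
  by_contra! hcon
  obtain ⟨x, hx, hx1, hx2⟩ := exists_fixedPoint_left (differentiable_signed_iterate c ε s) h.pos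
    h.signed_endpoint h.one_lt_deriv_endpoint hcon
  have h1 := h.repelling.one_lt_abs_deriv h.sign h.period_pos hx1
  rw [abs_of_nonneg (h.deriv_nonneg le_rfl h.interval.noZero ⟨hx.1, hx.2.le⟩)] at h1
  linarith

theorem neg_le_return_zero (h : IsRepellingInterval c u ε s) : -u ≤ ε * (quad c)^[s] 0 := by
  have h1 := h.interval.abs_le (x := 0) ⟨le_rfl, h.pos.le⟩
  have h2 := neg_abs_le (ε * (quad c)^[s] 0)
  rw [abs_mul, h.abs_sign, one_mul] at h2
  linarith

/-- Beyond the endpoint the return map stays above the diagonal. -/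
theorem lt_return (h : IsRepellingInterval c u ε s) {p : ℝ} (hup : u < p) (hnz : NoZero c s 0 p) :
    p < ε * (quad c)^[s] p := by
  by_contra! hcon
  obtain ⟨x, hx, hx1, hx2⟩ := exists_fixedPoint_right (differentiable_signed_iterate c ε s) hup
    h.signed_endpoint h.one_lt_deriv_endpoint hcon
  have h1 := h.repelling.one_lt_abs_deriv h.sign h.period_pos hx1
  rw [abs_of_nonneg (h.deriv_nonneg hup.le hnz ⟨h.pos.le.trans hx.1.le, hx.2⟩)] at h1
  linarith

/-- The positive zero of the return map is smaller than the modulus of its critical value, for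
otherwise the second iterate of the return map would preserve an interval that ends at a fixed
point. -/
theorem zero_lt_abs_return_zero (h : IsRepellingInterval c u ε s) {α : ℝ} (hα : α ∈ Icc 0 u)
    (hα0 : (quad c)^[s] α = 0) : α < -(ε * (quad c)^[s] 0) := by
  by_contra! hcon
  set g : ℝ → ℝ := fun x => ε * (quad c)^[s] x with hg
  have hs := h.period_pos
  have hu := h.pos
  have heven : ∀ x, g (-x) = g x := fun x => by simp only [hg, quad_iterate_neg c hs.ne']
  have hmono : StrictMonoOn g (Icc 0 u) := h.strictMonoOn_return le_rfl h.interval.noZero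
  have hdiff : Differentiable ℝ g := differentiable_signed_iterate c ε s
  have hcont := hdiff.continuous
  have hneg : g 0 < 0 := h.return_zero_neg
  set m := -g 0 with hm
  have hmu : m ≤ u := hcon.trans hα.2
  have hgm : g m ≤ 0 := by
    have := hmono.monotoneOn ⟨by linarith, hmu⟩ hα hcon
    simpa [hg, hα0] using this
  have hg0m : g 0 ≤ g m := hmono.monotoneOn ⟨le_rfl, hu.le⟩ ⟨by linarith, hmu⟩ (by linarith)
  -- `e` is the fixed point of the return map in `[-m, 0]`, where the map reverses orientation; if
  -- the claim fails, `g ∘ g` maps `[e, 0]` into itself although `e` is repelling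
  obtain ⟨e, he, hge⟩ : ∃ e ∈ Icc (-m) 0, g e - e = 0 := by
    have := intermediate_value_Icc' (a := -m) (b := 0) (by linarith)
      (f := fun x => g x - x) (by fun_prop)
    obtain ⟨e, he, h0⟩ := this (⟨by linarith, by rw [heven]; linarith⟩ :
      (0:ℝ) ∈ Icc (g 0 - 0) (g (-m) - -m))
    exact ⟨e, he, h0⟩
  have hge : g e = e := by linarith
  have he0 : e < 0 := lt_of_le_of_ne he.2 (by rintro rfl; linarith)
  have hodd : ∀ x, deriv g (-x) = -deriv g x := fun x => by
    have h3 := deriv_comp_neg g x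
    rw [show (fun x => g (-x)) = g from funext heven] at h3
    linarith
  have hdneg : ∀ x ∈ Icc (-u) 0, deriv g x ≤ 0 := fun x hx => by
    have := h.deriv_nonneg le_rfl h.interval.noZero (x := -x)
      ⟨by linarith [hx.2], by linarith [hx.1]⟩
    have h2 := hodd x
    change 0 ≤ deriv g (-x) at this
    linarith
  have hd2 : ∀ x, deriv (g ∘ g) x = deriv g (g x) * deriv g x := fun x =>
    deriv_comp x (hdiff _) (hdiff _)
  have hgg : g ∘ g = fun x => ε * (quad c)^[s + s] x := by
    funext x
    simp only [hg, Function.comp, h.iterate_sign_mul hs.ne', Function.iterate_add_apply]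
  have hde : 1 < deriv (g ∘ g) e := by
    rw [hd2, hge]
    have h1 := h.repelling.one_lt_abs_deriv h.sign h.period_pos (x := e) hge
    change 1 < |deriv g e| at h1
    rw [← abs_mul_abs_self]
    nlinarith
  have hgg0 : (g ∘ g) 0 ≤ 0 := by
    have : g (g 0) = g m := by rw [← heven, ← hm]
    simpa only [Function.comp, this] using hgm
  obtain ⟨x, hx, hx1, hx2⟩ := exists_fixedPoint_right (hdiff.comp hdiff) he0
    (by simp [hge]) hde hgg0
  have h1 := h.repelling.one_lt_abs_deriv h.sign (n := s + s) (by omega) (x := x)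
    (by rw [hgg] at hx1; exact hx1)
  rw [← hgg, abs_of_nonneg ?_] at h1
  · linarith
  · have hgx : g x ∈ Icc (-u) 0 := by
      have e1 : g (-x) = g x := heven x
      have i1 : -x ∈ Icc 0 u := ⟨by linarith [hx.2], by linarith [hx.1, he.1]⟩
      have i2 : -e ∈ Icc 0 u := ⟨by linarith, by linarith [he.1]⟩
      have l1 := hmono.monotoneOn ⟨le_rfl, hu.le⟩ i1 i1.1
      have l2 := hmono.monotoneOn i1 i2 (by linarith [hx.1])
      rw [heven e, hge, e1] at l2
      rw [e1] at l1
      exact ⟨by linarith, by linarith⟩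
    rw [hd2]
    exact mul_nonneg_of_nonpos_of_nonpos (hdneg _ hgx)
      (hdneg x ⟨by linarith [hx.1, he.1], hx.2⟩)

end IsRepellingInterval

end

/-! ### Real bounds -/

theorem strictMonoOn_quotient {g : ℝ → ℝ} {A B p q : ℝ}
    (hg : StrictMonoOn g (Icc A B) ∨ StrictAntiOn g (Icc A B)) (hp : p ∈ Icc A B)
    (hq : q ∈ Icc A B) (hpq : p < q) :
    StrictMonoOn (fun x => (g x - g p) / (g q - g p)) (Icc A B) := by
  rcases hg with m | m
  · have h1 := m hp hq hpq
    exact fun x hx y hy hxy => div_lt_div_of_pos_right (by linarith [m hx hy hxy]) (by linarith)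
  · have h1 := m hp hq hpq
    exact fun x hx y hy hxy => (div_lt_div_right_of_neg (by linarith)).2 (by linarith [m hx hy hxy])

theorem strictAntiOn_quotient {g : ℝ → ℝ} {A B p q : ℝ}
    (hg : StrictMonoOn g (Icc A B) ∨ StrictAntiOn g (Icc A B)) (hp : p ∈ Icc A B)
    (hq : q ∈ Icc A B) (hpq : q < p) :
    StrictAntiOn (fun x => (g x - g p) / (g q - g p)) (Icc A B) := by
  rcases hg with m | m
  · have h1 := m hq hp hpq
    exact fun x hx y hy hxy => (div_lt_div_right_of_neg (by linarith)).2 (by linarith [m hx hy hxy])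
  · have h1 := m hq hp hpq
    exact fun x hx y hy hxy => div_lt_div_of_pos_right (by linarith [m hx hy hxy]) (by linarith)

theorem crossRatio_affine (a p q b e d : ℝ) (hd : d ≠ 0) :
    crossRatio ((a - e) / d) ((p - e) / d) ((q - e) / d) ((b - e) / d) = crossRatio a p q b := by
  unfold crossRatio
  rw [show (b - e) / d - (a - e) / d = (b - a) / d by ring,
    show (q - e) / d - (p - e) / d = (q - p) / d by ring,
    show (p - e) / d - (a - e) / d = (p - a) / d by ring,
    show (b - e) / d - (q - e) / d = (b - q) / d by ring, div_mul_div_comm, div_mul_div_comm,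
    div_div_div_cancel_right₀ (mul_ne_zero hd hd)]

theorem noZero_abs {c w : ℝ} {n : ℕ} (h1 : NoZero c n 0 w) (h2 : NoZero c n w 0) :
    NoZero c n 0 |w| := by
  rcases abs_choice w with h | h <;> rw [h]
  · exact h1
  · intro j hj x hx
    rcases Nat.eq_zero_or_pos j with rfl | hj0
    · exact hx.1.ne'
    · rw [← quad_iterate_neg c hj0.ne']
      exact h2 j hj (-x) ⟨by linarith [hx.2], by linarith [hx.1]⟩

/-- A monotone branch of `f^n` on `[a, b]` can be continued to the right until a critical point is
met or a prescribed point is reached. -/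
theorem NoZero.exists_right {c : ℝ} {n : ℕ} {a b Y : ℝ} (h : NoZero c n a b)
    (hbY : b ≤ Y) (hb : ∀ j < n, (quad c)^[j] b ≠ 0) :
    ∃ y ∈ Icc b Y, NoZero c n a y ∧ (y = Y ∨ ∃ j < n, (quad c)^[j] y = 0) := by
  set S := {x : ℝ | ∃ j < n, (quad c)^[j] x = 0}
  have hnz : ∀ y, (∀ x ∈ Ioo b y, x ∉ S) → NoZero c n a y := by
    intro y hy j hj x hx h0
    rcases lt_trichotomy x b with hxb | rfl | hxb
    · exact h j hj x ⟨hx.1, hxb⟩ h0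
    · exact hb j hj h0
    · exact hy x ⟨hxb, hx.2⟩ ⟨j, hj, h0⟩
  by_cases hne : (S ∩ Icc b Y).Nonempty
  · have hcomp : IsCompact (S ∩ Icc b Y) := isCompact_Icc.inter_left (isClosed_precritical c n)
    have hy := hcomp.sInf_mem hne
    refine ⟨_, hy.2, hnz _ fun x hx hxS => ?_, Or.inr hy.1⟩
    exact absurd (csInf_le hcomp.bddBelow ⟨hxS, hx.1.le, hx.2.le.trans hy.2.2⟩) (not_le.2 hx.2)
  · exact ⟨Y, ⟨hbY, le_rfl⟩, hnz _ fun x hx hxS => hne ⟨x, hxS, hx.1.le, hx.2.le⟩, Or.inl rfl⟩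

theorem NoZero.exists_left {c : ℝ} {n : ℕ} {a b Y : ℝ} (h : NoZero c n a b)
    (hYa : Y ≤ a) (ha : ∀ j < n, (quad c)^[j] a ≠ 0) :
    ∃ y ∈ Icc Y a, NoZero c n y b ∧ (y = Y ∨ ∃ j < n, (quad c)^[j] y = 0) := by
  set S := {x : ℝ | ∃ j < n, (quad c)^[j] x = 0}
  have hnz : ∀ y, (∀ x ∈ Ioo y a, x ∉ S) → NoZero c n y b := by
    intro y hy j hj x hx h0
    rcases lt_trichotomy x a with hxa | rfl | hxa
    · exact hy x ⟨hx.1, hxa⟩ ⟨j, hj, h0⟩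
    · exact ha j hj h0
    · exact h j hj x ⟨hxa, hx.2⟩ h0
  by_cases hne : (S ∩ Icc Y a).Nonempty
  · have hcomp : IsCompact (S ∩ Icc Y a) := isCompact_Icc.inter_left (isClosed_precritical c n)
    have hy := hcomp.sSup_mem hne
    refine ⟨_, hy.2, hnz _ fun x hx hxS => ?_, Or.inr hy.1⟩
    exact absurd (le_csSup hcomp.bddAbove ⟨hxS, hy.2.1.trans hx.1.le, hx.2.le⟩) (not_le.2 hx.1)
  · exact ⟨Y, ⟨le_rfl, hYa⟩, hnz _ fun x hx hxS => hne ⟨x, hxS, hx.1.le, hx.2.le⟩, Or.inl rfl⟩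

/-- The affine coordinate on the line in which the interval `f^k V` of the cycle is `[0, 1]`,
the critical end `f^k 0` being `0`. -/
def cycleCoord (c u : ℝ) (k : ℕ) (x : ℝ) : ℝ :=
  (x - (quad c)^[k] 0) / ((quad c)^[k] u - (quad c)^[k] 0)

namespace IsRepellingInterval

variable {c u ε : ℝ} {s : ℕ}

theorem u_le_abs (h : IsRepellingInterval c u ε s) {k : ℕ} (hk : 0 < k) (hks : k < s) {x : ℝ}
    (hx : x ∈ Icc 0 u) : u ≤ |(quad c)^[k] x| := h.interval.le_abs hk hks hx

theorem zero_mem (h : IsRepellingInterval c u ε s) : (0:ℝ) ∈ Icc 0 u := ⟨le_rfl, h.pos.le⟩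

theorem u_mem (h : IsRepellingInterval c u ε s) : u ∈ Icc 0 u := ⟨h.pos.le, le_rfl⟩

theorem iterate_u_ne (h : IsRepellingInterval c u ε s) {k : ℕ} (hk : k ≤ s) :
    (quad c)^[k] u - (quad c)^[k] 0 ≠ 0 := by
  rcases h.interval.strictMonoOn_or hk with m | m
  · have := m h.zero_mem h.u_mem h.pos; intro h0; linarith
  · have := m h.zero_mem h.u_mem h.pos; intro h0; linarith

theorem iterate_ne_zero (h : IsRepellingInterval c u ε s) {k : ℕ} (hk : 0 < k) (hks : k < s)
    {x : ℝ} (hx : x ∈ Icc 0 u) : (quad c)^[k] x ≠ 0 := by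
  intro h0
  have := h.u_le_abs hk hks hx
  rw [h0, abs_zero] at this; linarith [h.pos]

/-- A monotone branch of `f^k` over an interval of the cycle cannot go past `V`, where the critical
point is interior. -/
theorem add_le_of_noZero (h : IsRepellingInterval c u ε s) {k i : ℕ} (hi : 0 < i) (his : i < s)
    {R : ℝ} (h0 : |(quad c)^[i] 0| ≤ R) (h1 : |(quad c)^[i] u| ≤ R) (hnz : NoZero c k 0 R) :
    k + i ≤ s := by
  by_contra hlt
  obtain ⟨x, hx, hx0⟩ : ∃ x ∈ Icc 0 u, ε * (quad c)^[s] x = 0 := by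
    refine intermediate_value_Icc h.pos.le
      (differentiable_signed_iterate c ε s).continuous.continuousOn ⟨h.return_zero_neg.le, ?_⟩
    rw [h.signed_endpoint]; exact h.pos.le
  have hε : ε ≠ 0 := by rcases h.sign with h | h <;> rw [h] <;> norm_num
  have hx0' : (quad c)^[s] x = 0 := (mul_eq_zero.1 hx0).resolve_left hε
  have hxl : 0 < x := lt_of_le_of_ne hx.1 (by
    rintro rfl; have := h.return_zero_neg; linarith)
  have hxu : x < u := lt_of_le_of_ne hx.2 (by
    rintro rfl; have := h.signed_endpoint; linarith [h.pos])
  have hlow := h.u_le_abs hi his hx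
  have habs : |(quad c)^[i] x| < R := by
    have b0 := abs_le.1 h0
    have b1 := abs_le.1 h1
    rw [abs_lt]
    rcases h.interval.strictMonoOn_or his.le with m | m
    · exact ⟨by linarith [m h.zero_mem hx hxl], by linarith [m hx h.u_mem hxu]⟩
    · exact ⟨by linarith [m hx h.u_mem hxu], by linarith [m h.zero_mem hx hxl]⟩
  refine hnz (s - i) (by omega) _ ⟨by linarith [h.pos], habs⟩ ?_
  rw [quad_iterate_abs c (by omega), ← Function.iterate_add_apply, Nat.sub_add_cancel his.le, hx0']

/-- The length of each interval of the cycle, measured in the coordinate of a shortest one, is at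
least `1`. -/
theorem one_le_coord (h : IsRepellingInterval c u ε s) {k : ℕ} (hks : k ≤ s)
    (hmin : ∀ n, 0 < n → n ≤ s → |(quad c)^[k] u - (quad c)^[k] 0| ≤
      |(quad c)^[n] u - (quad c)^[n] 0|) {n : ℕ} (hn : 0 < n) (hns : n ≤ s) :
    1 ≤ |cycleCoord c u k ((quad c)^[n] u) - cycleCoord c u k ((quad c)^[n] 0)| := by
  unfold cycleCoord
  rw [div_sub_div_same, sub_sub_sub_cancel_right, abs_div,
    one_le_div (abs_pos.2 (h.iterate_u_ne hks))]
  exact hmin n hn hns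

/-- The image under a monotone branch of `f^n` of the modulus of an interval of the cycle is again
an interval of the cycle, so it is not shorter than `f^k V`. -/
theorem one_le_coord_image (h : IsRepellingInterval c u ε s) {k : ℕ} (hks : k ≤ s)
    (hmin : ∀ n, 0 < n → n ≤ s → |(quad c)^[k] u - (quad c)^[k] 0| ≤
      |(quad c)^[n] u - (quad c)^[n] 0|) {n i : ℕ} (hn : 0 < n) (hi : 0 < i) (his : i < s)
    {R : ℝ} (h0 : |(quad c)^[i] 0| ≤ R) (h1 : |(quad c)^[i] u| ≤ R) (hnz : NoZero c n 0 R) :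
    1 ≤ |cycleCoord c u k ((quad c)^[n] |(quad c)^[i] u|) -
      cycleCoord c u k ((quad c)^[n] |(quad c)^[i] 0|)| := by
  rw [quad_iterate_abs c hn.ne', quad_iterate_abs c hn.ne', ← Function.iterate_add_apply,
    ← Function.iterate_add_apply]
  exact h.one_le_coord hks hmin (by omega) (h.add_le_of_noZero hi his h0 h1 hnz)

theorem coord_zero (c u : ℝ) (k : ℕ) : cycleCoord c u k ((quad c)^[k] 0) = 0 := by
  simp [cycleCoord]

theorem coord_u (h : IsRepellingInterval c u ε s) {k : ℕ} (hks : k ≤ s) :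
    cycleCoord c u k ((quad c)^[k] u) = 1 := div_self (h.iterate_u_ne hks)

theorem strictMonoOn_coord (h : IsRepellingInterval c u ε s) {k : ℕ} {y : ℝ} (hy : u ≤ y)
    (hnz : NoZero c k 0 y) :
    StrictMonoOn (fun x => cycleCoord c u k ((quad c)^[k] x)) (Icc 0 y) :=
  strictMonoOn_quotient (hnz.strictMonoOn_or_strictAntiOn (h.pos.trans_le hy))
    ⟨le_rfl, h.pos.le.trans hy⟩ ⟨h.pos.le, hy⟩ h.pos

/-- What a critical point of `f^k` at the end of the monotone branch on the side of the endpoint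
implies. -/
theorem right_zero (h : IsRepellingInterval c u ε s) {k j : ℕ} (hjk : j < k)
    {y : ℝ} (hy : u < y) (hnz : NoZero c k 0 y) (h0 : (quad c)^[j] y = 0) :
    |(quad c)^[j] u| < |(quad c)^[j] 0| ∧ NoZero c (k - j) 0 |(quad c)^[j] 0| ∧
      StrictAntiOn (fun x => cycleCoord c u k ((quad c)^[k - j] x)) (Icc 0 |(quad c)^[j] 0|) := by
  have hy0 : 0 < y := h.pos.trans hy
  have m0 : (0:ℝ) ∈ Icc 0 y := ⟨le_rfl, hy0.le⟩
  have mu : u ∈ Icc 0 y := ⟨h.pos.le, hy.le⟩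
  have my : y ∈ Icc 0 y := ⟨hy0.le, le_rfl⟩
  have hlt : |(quad c)^[j] u| < |(quad c)^[j] 0| := by
    rcases (hnz.mono hjk.le le_rfl le_rfl).strictMonoOn_or_strictAntiOn hy0 with m | m
    · have l1 := m m0 mu h.pos
      have l2 := m mu my hy
      rw [h0] at l2
      rw [abs_of_neg l2, abs_of_neg (by linarith)]; linarith
    · have l1 := m m0 mu h.pos
      have l2 := m mu my hy
      rw [h0] at l2
      rw [abs_of_pos l2, abs_of_pos (by linarith)]; linarith
  have hnz' : NoZero c (k - j) 0 |(quad c)^[j] 0| := by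
    have hk : NoZero c (k - j + j) 0 y := by rwa [Nat.sub_add_cancel hjk.le]
    refine noZero_abs ?_ ?_
    · have := hk.comp hy0 my m0; rwa [h0] at this
    · have := hk.comp hy0 m0 my; rwa [h0] at this
  refine ⟨hlt, hnz', ?_⟩
  have hkj : k - j ≠ 0 := by omega
  have := strictAntiOn_quotient
    (hnz'.strictMonoOn_or_strictAntiOn ((abs_nonneg _).trans_lt hlt))
    (right_mem_Icc.2 (abs_nonneg _)) ⟨abs_nonneg _, hlt.le⟩ hlt
  simp only [quad_iterate_abs c hkj, ← Function.iterate_add_apply,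
    Nat.sub_add_cancel hjk.le] at this
  exact this

/-- What a critical point of `f^(k-1)` at the end of the monotone branch on the side of the
critical value implies. -/
theorem left_zero (h : IsRepellingInterval c u ε s) {k x : ℕ} (hx : 0 < x) (hxk : x < k)
    {P : ℝ} (hP : P < quad c 0) (hnz : NoZero c (k - 1) P (quad c u))
    (h0 : (quad c)^[x - 1] P = 0) :
    |(quad c)^[x] 0| < |(quad c)^[x] u| ∧ NoZero c (k - x) 0 |(quad c)^[x] u| ∧
      StrictMonoOn (fun z => cycleCoord c u k ((quad c)^[k - x] z)) (Icc 0 |(quad c)^[x] u|) := by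
  obtain ⟨x, rfl⟩ := Nat.exists_eq_succ_of_ne_zero hx.ne'
  simp only [Nat.succ_eq_add_one, Nat.add_sub_cancel] at h0
  have hc : quad c 0 < quad c u := quad_strictMonoOn c (mem_Ici.2 le_rfl) h.pos.le h.pos
  have hPu := hP.trans hc
  have mP : P ∈ Icc P (quad c u) := ⟨le_rfl, hPu.le⟩
  have m0 : quad c 0 ∈ Icc P (quad c u) := ⟨hP.le, hc.le⟩
  have mu : quad c u ∈ Icc P (quad c u) := ⟨hPu.le, le_rfl⟩
  have hlt : |(quad c)^[x + 1] 0| < |(quad c)^[x + 1] u| := by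
    rw [Function.iterate_succ_apply, Function.iterate_succ_apply]
    rcases (hnz.mono (m := x) (by omega) le_rfl le_rfl).strictMonoOn_or_strictAntiOn hPu with m | m
    · have l1 := m mP m0 hP
      have l2 := m m0 mu hc
      rw [h0] at l1
      rw [abs_of_pos l1, abs_of_pos (by linarith)]; linarith
    · have l1 := m mP m0 hP
      have l2 := m m0 mu hc
      rw [h0] at l1
      rw [abs_of_neg l1, abs_of_neg (by linarith)]; linarith
  have hnz' : NoZero c (k - (x + 1)) 0 |(quad c)^[x + 1] u| := by
    have hk : NoZero c (k - (x + 1) + x) P (quad c u) := by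
      rwa [show k - (x + 1) + x = k - 1 by omega]
    rw [Function.iterate_succ_apply]
    refine noZero_abs ?_ ?_
    · have := hk.comp hPu mP mu; rwa [h0] at this
    · have := hk.comp hPu mu mP; rwa [h0] at this
  refine ⟨hlt, hnz', ?_⟩
  have hkj : k - (x + 1) ≠ 0 := by omega
  have := strictMonoOn_quotient
    (hnz'.strictMonoOn_or_strictAntiOn ((abs_nonneg _).trans_lt hlt))
    ⟨abs_nonneg _, hlt.le⟩ (right_mem_Icc.2 (abs_nonneg _)) hlt
  simp only [quad_iterate_abs c hkj, ← Function.iterate_add_apply,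
    Nat.sub_add_cancel (show x + 1 ≤ k by omega)] at this
  exact this

/-- The branch of `f^(k+1)` on `[0, y]` and the branch of `f^k` to the left of `f u` together form a
monotone branch of `f^k` around `f V`. -/
theorem noZero_join {c u P y : ℝ} {k : ℕ} (hu : 0 < u) (huy : u < y)
    (hnzP : NoZero c k P (quad c u)) (hnzy : NoZero c (k + 1) 0 y) :
    NoZero c k P (quad c y) := by
  intro j hj x hx h0
  rcases lt_or_ge x (quad c u) with hxu | hxu
  · exact hnzP j hj x ⟨hx.1, hxu⟩ h0
  · have hw : 0 < x - c := by
      have : 0 < u ^ 2 := by positivity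
      unfold quad at hxu
      linarith
    refine hnzy (j + 1) (by omega) (√(x - c)) ⟨Real.sqrt_pos.2 hw, ?_⟩ ?_
    · rw [Real.sqrt_lt hw.le (hu.trans huy).le]
      have := hx.2
      unfold quad at this
      linarith
    · rw [Function.iterate_succ_apply]
      have : quad c √(x - c) = x := by unfold quad; rw [Real.sq_sqrt hw.le]; ring
      rw [this, h0]

/-- The Koebe principle: if a monotone branch of `f^(k-1)` around `f V` covers spaces `σ` and `τ`
beside `f^k V`, measured in the length of `f^k V`, then the branch has definite space beside
`f V`. -/
theorem koebe (h : IsRepellingInterval c u ε s) {k : ℕ} (hk : 0 < k) (hks : k ≤ s) {P y : ℝ}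
    (hP : P < quad c 0) (hy : u < y) (hnzP : NoZero c (k - 1) P (quad c u))
    (hnzy : NoZero c k 0 y) :
    u ^ 2 * (-cycleCoord c u k ((quad c)^[k - 1] P)) * (cycleCoord c u k ((quad c)^[k] y) - 1) <
      (y ^ 2 - u ^ 2) *
        (cycleCoord c u k ((quad c)^[k] y) - cycleCoord c u k ((quad c)^[k - 1] P)) := by
  obtain ⟨k, rfl⟩ := Nat.exists_eq_succ_of_ne_zero hk.ne'
  simp only [Nat.succ_eq_add_one, Nat.add_sub_cancel] at *
  have hu := h.pos
  have hc : quad c 0 < quad c u := quad_strictMonoOn c (mem_Ici.2 le_rfl) hu.le hu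
  have hcy : quad c u < quad c y := quad_strictMonoOn c (mem_Ici.2 hu.le) (hu.trans hy).le hy
  have hnz : NoZero c k P (quad c y) := noZero_join hu hy hnzP hnzy
  have hcr := hnz.crossRatio_le hP hc hcy
  have hne := h.iterate_u_ne hks
  rw [← crossRatio_affine ((quad c)^[k] P) _ _ _ ((quad c)^[k + 1] 0) _ hne] at hcr
  change _ ≤ crossRatio (cycleCoord c u (k + 1) ((quad c)^[k] P))
    (cycleCoord c u (k + 1) ((quad c)^[k] (quad c 0)))
    (cycleCoord c u (k + 1) ((quad c)^[k] (quad c u)))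
    (cycleCoord c u (k + 1) ((quad c)^[k] (quad c y))) at hcr
  simp only [← Function.iterate_succ_apply, Nat.succ_eq_add_one] at hcr
  rw [coord_zero, h.coord_u hks] at hcr
  have hT : 1 < cycleCoord c u (k + 1) ((quad c)^[k + 1] y) := by
    rw [← h.coord_u hks]
    exact h.strictMonoOn_coord hy.le hnzy ⟨hu.le, hy.le⟩ ⟨(hu.trans hy).le, le_rfl⟩ hy
  have hS : cycleCoord c u (k + 1) ((quad c)^[k] P) < 0 := by
    have hm := strictMonoOn_quotient
      (hnzP.strictMonoOn_or_strictAntiOn (hP.trans hc)) ⟨hP.le, hc.le⟩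
      ⟨(hP.trans hc).le, le_rfl⟩ hc
    have := hm ⟨le_rfl, (hP.trans hc).le⟩ ⟨hP.le, hc.le⟩ hP
    simpa [cycleCoord, Function.iterate_succ_apply] using this
  set T := cycleCoord c u (k + 1) ((quad c)^[k + 1] y)
  set S := cycleCoord c u (k + 1) ((quad c)^[k] P)
  unfold crossRatio at hcr
  have e1 : quad c y - quad c u = y ^ 2 - u ^ 2 := by unfold quad; ring
  have e2 : quad c u - quad c 0 = u ^ 2 := by unfold quad; ring
  have hyu : 0 < y ^ 2 - u ^ 2 := by linarith
  have hST : 0 < (0 - S) * (T - 1) := mul_pos (by linarith) (by linarith)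
  have hd : 0 < quad c 0 - P := by linarith
  rw [e1, e2, div_le_div_iff₀ (mul_pos hd hyu) hST] at hcr
  have hlt : u ^ 2 * (-S) * (T - 1) * (quad c 0 - P) <
      (y ^ 2 - u ^ 2) * (T - S) * (quad c 0 - P) := by
    refine lt_of_lt_of_le ?_ (hcr.trans_eq (by ring))
    have h3 : 0 < u ^ 2 * ((0 - S) * (T - 1)) := mul_pos (by positivity) hST
    have h4 : 0 < quad c y - quad c 0 := by linarith
    nlinarith
  exact lt_of_mul_lt_mul_right hlt hd.le

/-- Extension of the monotone branch on the side of the endpoint, up to the modulus of the nearest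
`f^κ 0` that is the far end of its interval. The space covered is at least the length of `f^k V`,
and at least twice this length unless the branch reaches `|f^κ 0|` or ends at a zero of `f^κ`. -/
theorem right_space (h : IsRepellingInterval c u ε s) {k κ : ℕ} (hk : 0 < k) (hks : k ≤ s)
    (hmin : ∀ n, 0 < n → n ≤ s → |(quad c)^[k] u - (quad c)^[k] 0| ≤
      |(quad c)^[n] u - (quad c)^[n] 0|)
    (hκ : 0 < κ) (hκs : κ < s) (hfar : |(quad c)^[κ] u| < |(quad c)^[κ] 0|)
    (hκmin : ∀ j, 0 < j → j < s → |(quad c)^[j] u| < |(quad c)^[j] 0| →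
      |(quad c)^[κ] 0| ≤ |(quad c)^[j] 0|) :
    ∃ y, u < y ∧ y ≤ |(quad c)^[κ] 0| ∧ NoZero c k 0 y ∧
      2 ≤ cycleCoord c u k ((quad c)^[k] y) ∧
      (3 ≤ cycleCoord c u k ((quad c)^[k] y) ∨ y = |(quad c)^[κ] 0| ∨
        (κ < k ∧ (quad c)^[κ] y = 0)) := by
  have hu := h.pos
  have hκu : u ≤ |(quad c)^[κ] u| := h.u_le_abs hκ hκs h.u_mem
  have hne : ∀ j < k, (quad c)^[j] u ≠ 0 := by
    intro j hj
    rcases Nat.eq_zero_or_pos j with rfl | hj0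
    · exact hu.ne'
    · exact h.iterate_ne_zero hj0 (by omega) h.u_mem
  obtain ⟨y, hy, hnz, hend⟩ := (h.interval.noZero.mono hks le_rfl le_rfl).exists_right
    (hκu.trans hfar.le) hne
  have huy : u < y := lt_of_le_of_ne hy.1 (by
    rintro rfl
    rcases hend with h1 | ⟨j, hj, h0⟩
    · linarith
    · exact hne j hj h0)
  have hmono := h.strictMonoOn_coord huy.le hnz
  have my : y ∈ Icc 0 y := ⟨by linarith, le_rfl⟩
  have hu1 := h.coord_u hks
  refine ⟨y, huy, hy.2, hnz, ?_⟩
  rcases hend with hend | ⟨j, hj, h0⟩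
  · refine ⟨?_, Or.inr (Or.inl hend)⟩
    have h1 := h.one_le_coord_image hks hmin hk hκ hκs (R := y) hend.ge (hfar.le.trans hend.ge) hnz
    have m1 : |(quad c)^[κ] u| ∈ Icc 0 y := ⟨abs_nonneg _, hfar.le.trans hend.ge⟩
    have l1 := hmono.monotoneOn ⟨hu.le, huy.le⟩ m1 hκu
    have l2 := hmono m1 my (hfar.trans_eq hend.symm)
    simp only at l1 l2
    rw [hu1] at l1
    rw [← hend, abs_of_neg (by linarith)] at h1
    linarith
  · have hj0 : 0 < j := Nat.pos_of_ne_zero (by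
      rintro rfl; simp only [Function.iterate_zero, id] at h0; linarith)
    obtain ⟨hjfar, hnz', hanti⟩ := h.right_zero hj huy hnz h0
    have hju : u ≤ |(quad c)^[j] u| := h.u_le_abs hj0 (by omega) h.u_mem
    have hT : (quad c)^[k - j] 0 = (quad c)^[k] y := by
      rw [← h0, ← Function.iterate_add_apply, Nat.sub_add_cancel hj.le]
    have hkj : k - j ≠ 0 := by omega
    have hβ : cycleCoord c u k ((quad c)^[k - j] |(quad c)^[j] u|) = 1 := by
      rw [quad_iterate_abs c hkj, ← Function.iterate_add_apply, Nat.sub_add_cancel hj.le, hu1]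
    have mβ : |(quad c)^[j] u| ∈ Icc 0 |(quad c)^[j] 0| := ⟨abs_nonneg _, hjfar.le⟩
    have mu : u ∈ Icc 0 |(quad c)^[j] 0| := ⟨hu.le, hju.trans hjfar.le⟩
    have m0 : (0:ℝ) ∈ Icc 0 |(quad c)^[j] 0| := ⟨le_rfl, abs_nonneg _⟩
    have l0 := hanti m0 mu hu
    have d0 := h.one_le_coord hks hmin (n := k - j) (by omega) (by omega)
    simp only at l0
    rw [hT] at l0 d0
    rw [abs_of_neg (by linarith)] at d0
    have l1 := hanti.antitoneOn mu mβ hju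
    simp only [hβ] at l1
    refine ⟨by linarith, ?_⟩
    by_cases hjκ : j = κ
    · subst hjκ
      exact Or.inr (Or.inr ⟨hj, h0⟩)
    left
    have hle := hκmin j hj0 (by omega) hjfar
    have hd := h.one_le_coord_image hks hmin (n := k - j) (by omega) hκ hκs hle
      (hfar.le.trans hle) hnz'
    rcases h.interval.separated_abs hjκ (by omega) hκs with hs | hs
    · have := hs 0 h.zero_mem u h.u_mem
      linarith
    · have hs := hs u h.u_mem 0 h.zero_mem
      have mκ0 : |(quad c)^[κ] 0| ∈ Icc 0 |(quad c)^[j] 0| := ⟨abs_nonneg _, hle⟩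
      have mκu : |(quad c)^[κ] u| ∈ Icc 0 |(quad c)^[j] 0| := ⟨abs_nonneg _, hfar.le.trans hle⟩
      have l2 := hanti.antitoneOn mκ0 mβ hs
      have l3 := hanti mκu mκ0 hfar
      have l4 := hanti.antitoneOn mu mκu hκu
      simp only [hβ] at l2 l3 l4
      rw [abs_of_pos (by linarith)] at hd
      linarith

/-- Extension of the monotone branch on the side of the critical value. The space is at least twice
the length of `f^k V`, unless some interval `f^x V` with `x < k` has its far end at `f^x u`, nearer
to `0` than `f^κ 0`. -/
theorem left_space (h : IsRepellingInterval c u ε s) {k κ : ℕ} (hk : 0 < k) (hks : k ≤ s)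
    (hmin : ∀ n, 0 < n → n ≤ s → |(quad c)^[k] u - (quad c)^[k] 0| ≤
      |(quad c)^[n] u - (quad c)^[n] 0|)
    (hκ : 0 < κ) (hκs : κ < s) (hfar : |(quad c)^[κ] u| < |(quad c)^[κ] 0|) :
    ∃ P < quad c 0, NoZero c (k - 1) P (quad c u) ∧
      cycleCoord c u k ((quad c)^[k - 1] P) ≤ -1 ∧
      (cycleCoord c u k ((quad c)^[k - 1] P) ≤ -2 ∨ ∃ x, 0 < x ∧ x < k ∧
        |(quad c)^[x] 0| < |(quad c)^[x] u| ∧ |(quad c)^[x] u| < |(quad c)^[κ] 0|) := by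
  have hu := h.pos
  have hc : quad c 0 < quad c u := quad_strictMonoOn c (mem_Ici.2 le_rfl) hu.le hu
  have hκu : u ≤ |(quad c)^[κ] u| := h.u_le_abs hκ hκs h.u_mem
  set D := |(quad c)^[k] u - (quad c)^[k] 0| with hD
  have hDpos : 0 < D := abs_pos.2 (h.iterate_u_ne hks)
  set R := 1 + |c| + 2 * D + |(quad c)^[k] 0| with hR
  have hRc : 1 + |c| ≤ R := by have := abs_nonneg ((quad c)^[k] 0); linarith
  have hq0 : quad c 0 = c := by simp [quad]
  have hRq : -R < quad c 0 := by rw [hq0]; linarith [neg_abs_le c]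
  have hnz0 : NoZero c (k - 1) (quad c 0) (quad c u) := by
    have h1 := h.interval.noZero.mono hks le_rfl le_rfl
    have h2 : NoZero c (k - 1 + 1) 0 u := by rwa [Nat.sub_add_cancel hk]
    exact h2.comp hu h.zero_mem h.u_mem
  have hne : ∀ j < k - 1, (quad c)^[j] (quad c 0) ≠ 0 := fun j hj => by
    rw [← Function.iterate_succ_apply]
    exact h.iterate_ne_zero j.succ_pos (by omega) h.zero_mem
  obtain ⟨P, hP, hnz, hend⟩ := hnz0.exists_left hRq.le hne
  have hPq : P < quad c 0 := lt_of_le_of_ne hP.2 (by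
    intro heq
    rcases hend with h1 | ⟨j, hj, h0⟩
    · linarith
    · rw [heq] at h0; exact hne j hj h0)
  have hcoord := strictMonoOn_quotient (hnz.strictMonoOn_or_strictAntiOn (hPq.trans hc))
    ⟨hPq.le, hc.le⟩ ⟨(hPq.trans hc).le, le_rfl⟩ hc
  simp only [← Function.iterate_succ_apply, Nat.succ_eq_add_one, Nat.sub_add_cancel hk] at hcoord
  have hneg : cycleCoord c u k ((quad c)^[k - 1] P) < 0 := by
    have := hcoord ⟨le_rfl, (hPq.trans hc).le⟩ ⟨hPq.le, hc.le⟩ hPq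
    simp only [← Function.iterate_succ_apply (quad c) (k - 1) 0, Nat.succ_eq_add_one,
      Nat.sub_add_cancel hk, sub_self, zero_div] at this
    exact this
  refine ⟨P, hPq, hnz, ?_⟩
  rcases hend with hend | ⟨j, hj, h0⟩
  · have hbig : R ≤ |(quad c)^[k - 1] P| := by
      have h1 := le_quad_iterate (c := c) hRc (k - 1)
      have hRpos : 0 ≤ R := by have := abs_nonneg c; linarith
      rcases Nat.eq_zero_or_pos (k - 1) with h2 | h2
      · rw [h2, hend]; simp [abs_of_nonneg hRpos]
      · rw [hend, quad_iterate_neg c h2.ne']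
        exact h1.trans (le_abs_self _)
    have h2 : cycleCoord c u k ((quad c)^[k - 1] P) ≤ -2 := by
      have h3 : 2 ≤ |cycleCoord c u k ((quad c)^[k - 1] P)| := by
        unfold cycleCoord
        rw [abs_div, le_div_iff₀ hDpos]
        have h4 := abs_sub_abs_le_abs_sub ((quad c)^[k - 1] P) ((quad c)^[k] 0)
        linarith [abs_nonneg c]
      rw [abs_of_neg hneg] at h3
      linarith
    exact ⟨by linarith, Or.inl h2⟩
  · obtain ⟨hlt, hnz', hmono⟩ := h.left_zero (x := j + 1) j.succ_pos (by omega) hPq hnz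
      (by simpa using h0)
    set x := j + 1 with hx
    have hx0 : 0 < x := j.succ_pos
    have hxk : x < k := by omega
    have hkx : k - x ≠ 0 := by omega
    have hS : (quad c)^[k - x] 0 = (quad c)^[k - 1] P := by
      rw [← h0, ← Function.iterate_add_apply]; congr 2; omega
    have hα : cycleCoord c u k ((quad c)^[k - x] |(quad c)^[x] 0|) = 0 := by
      rw [quad_iterate_abs c hkx, ← Function.iterate_add_apply, Nat.sub_add_cancel hxk.le,
        coord_zero]
    have hxu : u ≤ |(quad c)^[x] 0| := h.u_le_abs hx0 (by omega) h.zero_mem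
    have mu : u ∈ Icc 0 |(quad c)^[x] u| := ⟨hu.le, hxu.trans hlt.le⟩
    have m0 : (0:ℝ) ∈ Icc 0 |(quad c)^[x] u| := ⟨le_rfl, abs_nonneg _⟩
    have mα : |(quad c)^[x] 0| ∈ Icc 0 |(quad c)^[x] u| := ⟨abs_nonneg _, hlt.le⟩
    have d0 := h.one_le_coord hks hmin (n := k - x) (by omega) (by omega)
    have l0 := hmono m0 mu hu
    have l1 := hmono.monotoneOn mu mα hxu
    simp only [hα] at l0 l1
    rw [hS] at l0 d0
    rw [abs_of_pos (by linarith)] at d0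
    refine ⟨by linarith, ?_⟩
    rcases lt_or_ge |(quad c)^[x] u| |(quad c)^[κ] 0| with hb | hb
    · exact Or.inr ⟨x, hx0, hxk, hlt, hb⟩
    left
    have hxκ : x ≠ κ := by rintro heq; rw [heq] at hlt; linarith
    have hd := h.one_le_coord_image hks hmin (n := k - x) (by omega) hκ hκs hb
      (hfar.le.trans hb) hnz'
    rcases h.interval.separated_abs hxκ (by omega) hκs with hs | hs
    · have := hs u h.u_mem u h.u_mem
      linarith
    · have hs := hs 0 h.zero_mem 0 h.zero_mem
      have mκ0 : |(quad c)^[κ] 0| ∈ Icc 0 |(quad c)^[x] u| := ⟨abs_nonneg _, hb⟩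
      have mκu : |(quad c)^[κ] u| ∈ Icc 0 |(quad c)^[x] u| := ⟨abs_nonneg _, hfar.le.trans hb⟩
      have l2 := hmono.monotoneOn mκ0 mα hs
      have l3 := hmono mκu mκ0 hfar
      have l4 := hmono.monotoneOn mu mκu hκu
      simp only [hα] at l2 l3 l4
      rw [abs_of_neg (by linarith)] at hd
      linarith

/-- The inequality of the Koebe principle for the squares `U = u ^ 2` and `W = y ^ 2 - u ^ 2`, when
one of the two spaces is at least twice the length of the interval. -/
theorem half_le_of_koebe {U W σ τ : ℝ} (hU : 0 < U) (hσ : 1 ≤ σ) (hτ : 1 ≤ τ)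
    (hor : 2 ≤ σ ∨ 2 ≤ τ) (hk : U * σ * τ < W * (1 + σ + τ)) : U / 2 < W := by
  by_contra! hcon
  have h1 : W * (1 + σ + τ) ≤ U / 2 * (1 + σ + τ) :=
    mul_le_mul_of_nonneg_right hcon (by linarith)
  have h2 : 1 + σ + τ ≤ 2 * (σ * τ) := by rcases hor with h | h <;> nlinarith
  nlinarith

theorem third_le_of_koebe {U W σ τ : ℝ} (hU : 0 < U) (hσ : 1 ≤ σ) (hτ : 1 ≤ τ)
    (hk : U * σ * τ < W * (1 + σ + τ)) : U / 3 < W := by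
  by_contra! hcon
  have h1 : W * (1 + σ + τ) ≤ U / 3 * (1 + σ + τ) :=
    mul_le_mul_of_nonneg_right hcon (by linarith)
  have h2 : 1 + σ + τ ≤ 3 * (σ * τ) := by nlinarith
  nlinarith

/-- The cross-ratio of `0 < U < b < Y` is at least `3` when these points are close to one another.
-/
theorem three_mul_le_of_near {U b Y : ℝ} (hU : 0 ≤ U) (h1 : 4 / 3 * U ≤ b) (h2 : Y ≤ 3 / 2 * U)
    (h3 : b ≤ Y) : 3 * (U * (Y - b)) ≤ Y * (b - U) := by
  nlinarith [mul_nonneg hU (sub_nonneg.2 h1), mul_nonneg hU (sub_nonneg.2 h2),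
    mul_nonneg (sub_nonneg.2 h1) (sub_nonneg.2 (h1.trans h3))]

/-- If `f^κ 0` is the end of its interval farther from the critical point, then it lies outside
a definite neighbourhood of `V`. -/
theorem real_bound (h : IsRepellingInterval c u ε s) {κ : ℕ} (hκ : 0 < κ) (hκs : κ < s)
    (hfar : |(quad c)^[κ] u| < |(quad c)^[κ] 0|) :
    3 / 2 * u ^ 2 ≤ |(quad c)^[κ] 0| ^ 2 := by
  -- it suffices to treat the nearest such point, and to look at a shortest interval `f^k V`
  obtain ⟨κ', hκ', hle⟩ : ∃ κ', (0 < κ' ∧ κ' < s ∧ |(quad c)^[κ'] u| < |(quad c)^[κ'] 0|) ∧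
      ∀ j, 0 < j ∧ j < s ∧ |(quad c)^[j] u| < |(quad c)^[j] 0| →
        |(quad c)^[κ'] 0| ≤ |(quad c)^[j] 0| := by
    have hfin : {j | 0 < j ∧ j < s ∧ |(quad c)^[j] u| < |(quad c)^[j] 0|}.Finite :=
      (finite_Iio s).subset fun j hj => hj.2.1
    obtain ⟨a, ha, ha'⟩ := exists_min_image _ (fun j => |(quad c)^[j] 0|) hfin ⟨κ, hκ, hκs, hfar⟩
    exact ⟨a, ha, ha'⟩
  refine le_trans ?_ (pow_le_pow_left₀ (abs_nonneg _) (hle κ ⟨hκ, hκs, hfar⟩) 2)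
  clear hfar hκs hκ κ
  obtain ⟨hκ, hκs, hfar⟩ := hκ'
  have hκmin : ∀ j, 0 < j → j < s → |(quad c)^[j] u| < |(quad c)^[j] 0| →
      |(quad c)^[κ'] 0| ≤ |(quad c)^[j] 0| := fun j h1 h2 h3 => hle j ⟨h1, h2, h3⟩
  clear hle
  generalize κ' = κ at *
  obtain ⟨k, ⟨hk, hks⟩, hmin'⟩ : ∃ k, (0 < k ∧ k ≤ s) ∧ ∀ n, 0 < n ∧ n ≤ s →
      |(quad c)^[k] u - (quad c)^[k] 0| ≤ |(quad c)^[n] u - (quad c)^[n] 0| := by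
    have hfin : {n | 0 < n ∧ n ≤ s}.Finite := (finite_Iic s).subset fun j hj => hj.2
    obtain ⟨a, ha, ha'⟩ := exists_min_image _ (fun n => |(quad c)^[n] u - (quad c)^[n] 0|) hfin
      ⟨s, h.period_pos, le_rfl⟩
    exact ⟨a, ha, ha'⟩
  have hmin : ∀ n, 0 < n → n ≤ s → |(quad c)^[k] u - (quad c)^[k] 0| ≤
      |(quad c)^[n] u - (quad c)^[n] 0| := fun n h1 h2 => hmin' n ⟨h1, h2⟩
  clear hmin'
  have hu := h.pos
  obtain ⟨y, huy, hyκ, hnzy, hT2, hT⟩ := h.right_space hk hks hmin hκ hκs hfar hκmin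
  obtain ⟨P, hP, hnzP, hS1, hS⟩ := h.left_space hk hks hmin hκ hκs hfar
  have hkoebe := h.koebe hk hks hP huy hnzP hnzy
  set T := cycleCoord c u k ((quad c)^[k] y) with hTdef
  set S := cycleCoord c u k ((quad c)^[k - 1] P) with hSdef
  have hU : 0 < u ^ 2 := by positivity
  have hkoebe' : u ^ 2 * (-S) * (T - 1) < (y ^ 2 - u ^ 2) * (1 + (-S) + (T - 1)) := by
    refine hkoebe.trans_eq ?_; ring
  by_contra! hcon
  have hyy : y ^ 2 ≤ |(quad c)^[κ] 0| ^ 2 := pow_le_pow_left₀ (by linarith) hyκ 2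
  have hno : ¬ (2 ≤ -S ∨ 2 ≤ T - 1) := fun hor => by
    have := half_le_of_koebe hU (by linarith) (by linarith) hor hkoebe'
    linarith
  -- the bound holds if one of the two spaces beside `f^k V` is at least twice its length
  refine hno ?_
  rcases hS with hS | ⟨x, hx0, hxk, hxlt, hxκ⟩
  · left; linarith
  right
  rcases hT with hT | hT | ⟨hκk, hy0⟩
  · linarith
  all_goals
    have hne : x ≠ κ := by rintro rfl; linarith
    have hsep : |(quad c)^[x] u| ≤ |(quad c)^[κ] u| := by
      rcases h.interval.separated_abs hne (by omega) hκs with hs | hs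
      · exact hs u h.u_mem u h.u_mem
      · have := hs 0 h.zero_mem 0 h.zero_mem
        linarith
    have hxu : u ≤ |(quad c)^[x] 0| := h.u_le_abs hx0 (by omega) h.zero_mem
    have hmono := h.strictMonoOn_coord huy.le hnzy
    have hu1 := h.coord_u hks
    have mu : u ∈ Icc 0 y := ⟨hu.le, huy.le⟩
  · -- the images of the moduli of `f^x V` and `f^κ V` fit into the space
    have my : y ∈ Icc 0 y := ⟨by linarith, le_rfl⟩
    have mκ : |(quad c)^[κ] u| ∈ Icc 0 y := ⟨abs_nonneg _, by linarith⟩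
    have mxu : |(quad c)^[x] u| ∈ Icc 0 y := ⟨abs_nonneg _, by linarith⟩
    have mx0 : |(quad c)^[x] 0| ∈ Icc 0 y := ⟨abs_nonneg _, by linarith⟩
    have d1 := h.one_le_coord_image hks hmin hk hκ hκs hT.ge (hfar.le.trans hT.ge) hnzy
    have d2 := h.one_le_coord_image hks hmin hk hx0 (by omega) mx0.2 mxu.2 hnzy
    have l1 := hmono.monotoneOn mu mx0 hxu
    have l2 := hmono mx0 mxu hxlt
    have l3 := hmono.monotoneOn mxu mκ hsep
    have l4 := hmono mκ my (by linarith)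
    simp only [hu1] at l1 l2 l3 l4
    rw [← hT, abs_of_neg (by linarith)] at d1
    rw [abs_of_pos (by linarith)] at d2
    linarith
  · obtain ⟨-, hnzn, hanti⟩ := h.right_zero hκk huy hnzy hy0
    set n := k - κ with hn
    have hn0 : 0 < n := by omega
    have hnT : (quad c)^[n] 0 = (quad c)^[k] y := by
      rw [← hy0, ← Function.iterate_add_apply, Nat.sub_add_cancel hκk.le]
    have hκu : u ≤ |(quad c)^[κ] u| := h.u_le_abs hκ hκs h.u_mem
    have m0' : (0:ℝ) ∈ Icc 0 |(quad c)^[κ] 0| := ⟨le_rfl, abs_nonneg _⟩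
    have mu' : u ∈ Icc 0 |(quad c)^[κ] 0| := ⟨hu.le, by linarith⟩
    have d0 := h.one_le_coord hks hmin hn0 (by omega)
    have l0 := hanti m0' mu' hu
    simp only at l0
    rw [hnT] at l0 d0
    rw [abs_of_neg (by linarith)] at d0
    rcases le_or_gt |(quad c)^[x] u| y with hxy | hxy
    · -- two different intervals of the cycle fit into the space
      have mxu : |(quad c)^[x] u| ∈ Icc 0 y := ⟨abs_nonneg _, hxy⟩
      have mx0 : |(quad c)^[x] 0| ∈ Icc 0 y := ⟨abs_nonneg _, by linarith⟩
      have my : y ∈ Icc 0 y := ⟨by linarith, le_rfl⟩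
      have hkx := h.add_le_of_noZero hx0 (by omega) mx0.2 mxu.2 hnzy
      have d2 := h.one_le_coord_image hks hmin hk hx0 (by omega) mx0.2 mxu.2 hnzy
      have l1 := hmono.monotoneOn mu mx0 hxu
      have l2 := hmono mx0 mxu hxlt
      have l3 := hmono.monotoneOn mxu my hxy
      simp only [hu1] at l1 l2 l3
      rw [abs_of_pos (by linarith)] at d2
      rw [quad_iterate_abs c hk.ne', ← Function.iterate_add_apply] at l1 l2 l3 d2
      rw [quad_iterate_abs c hk.ne', ← Function.iterate_add_apply] at l2 d2
      have hsepX : cycleCoord c u k ((quad c)^[n] 0) ≤ cycleCoord c u k ((quad c)^[k + x] 0) ∨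
          cycleCoord c u k ((quad c)^[k + x] u) ≤ cycleCoord c u k ((quad c)^[n] u) := by
        unfold cycleCoord
        rcases lt_or_gt_of_ne (h.iterate_u_ne hks) with hneg | hpos
        · rcases h.interval.separated (i := n) (j := k + x) (by omega) hn0 hkx with hs | hs
          · right
            exact (div_le_div_right_of_neg hneg).2 (by
              linarith [hs u h.u_mem u h.u_mem])
          · left
            exact (div_le_div_right_of_neg hneg).2 (by
              linarith [hs 0 h.zero_mem 0 h.zero_mem])
        · rcases h.interval.separated (i := n) (j := k + x) (by omega) hn0 hkx with hs | hs
          · left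
            exact div_le_div_of_nonneg_right (by
              linarith [hs 0 h.zero_mem 0 h.zero_mem]) hpos.le
          · right
            exact div_le_div_of_nonneg_right (by
              linarith [hs u h.u_mem u h.u_mem]) hpos.le
      rw [hnT] at hsepX
      rcases hsepX with hs | hs <;> linarith
    · -- the expansion of cross-ratios on `0 < u < |f^κ u| < |f^κ 0|`
      have hb : y < |(quad c)^[κ] u| := hxy.trans_le hsep
      set b := |(quad c)^[κ] u| with hbdef
      set Y := |(quad c)^[κ] 0| with hYdef
      have hub : u < b := huy.trans hb
      have hq1 : quad c 0 < quad c u := quad_strictMonoOn c (mem_Ici.2 le_rfl) hu.le hu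
      have hq2 : quad c u < quad c b :=
        quad_strictMonoOn c (mem_Ici.2 hu.le) (mem_Ici.2 (abs_nonneg _)) hub
      have hq3 : quad c b < quad c Y :=
        quad_strictMonoOn c (mem_Ici.2 (abs_nonneg _)) (mem_Ici.2 (abs_nonneg _)) hfar
      have hnz1 : NoZero c (n - 1) (quad c 0) (quad c Y) := by
        have h2 : NoZero c (n - 1 + 1) 0 Y := by rwa [Nat.sub_add_cancel hn0]
        exact h2.comp (hu.trans (hub.trans hfar)) m0' ⟨abs_nonneg _, le_rfl⟩
      have hcr := hnz1.crossRatio_le hq1 hq2 hq3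
      simp only [← Function.iterate_succ_apply, Nat.succ_eq_add_one, Nat.sub_add_cancel hn0] at hcr
      rw [← crossRatio_affine ((quad c)^[n] 0) _ _ _ ((quad c)^[k] 0) _ (h.iterate_u_ne hks)] at hcr
      change _ ≤ crossRatio (cycleCoord c u k ((quad c)^[n] 0))
        (cycleCoord c u k ((quad c)^[n] u)) (cycleCoord c u k ((quad c)^[n] b))
        (cycleCoord c u k ((quad c)^[n] Y)) at hcr
      have e1 : cycleCoord c u k ((quad c)^[n] b) = 1 := by
        rw [hbdef, quad_iterate_abs c hn0.ne', ← Function.iterate_add_apply,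
          Nat.sub_add_cancel hκk.le, hu1]
      have e2 : cycleCoord c u k ((quad c)^[n] Y) = 0 := by
        rw [hYdef, quad_iterate_abs c hn0.ne', ← Function.iterate_add_apply,
          Nat.sub_add_cancel hκk.le, coord_zero]
      have l1 : cycleCoord c u k ((quad c)^[n] b) ≤ cycleCoord c u k ((quad c)^[n] u) :=
        hanti.antitoneOn mu' ⟨abs_nonneg _, hfar.le⟩ hub.le
      rw [e1] at l1
      rw [e1, e2, hnT, ← hTdef] at hcr
      rw [← hTdef] at d0 l0
      set A := cycleCoord c u k ((quad c)^[n] u) with hA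
      unfold crossRatio at hcr
      have f1 : quad c Y - quad c 0 = Y ^ 2 := by unfold quad; ring
      have f2 : quad c b - quad c u = b ^ 2 - u ^ 2 := by unfold quad; ring
      have f3 : quad c u - quad c 0 = u ^ 2 := by unfold quad; ring
      have f4 : quad c Y - quad c b = Y ^ 2 - b ^ 2 := by unfold quad; ring
      rw [f1, f2, f3, f4, show (0 - T) * (1 - A) = T * (A - 1) by ring,
        show (A - T) * (0 - 1) = T - A by ring,
        div_le_div_iff₀ (mul_pos hU (by rw [← f4]; linarith)) (by linarith)] at hcr
      have hy43 := third_le_of_koebe hU (by linarith) (by linarith) hkoebe'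
      have hby : y ^ 2 < b ^ 2 := pow_lt_pow_left₀ hb (by linarith) two_ne_zero
      have hYb : b ^ 2 < Y ^ 2 := pow_lt_pow_left₀ hfar (abs_nonneg _) two_ne_zero
      clear hno hkoebe hkoebe'
      -- the cross-ratio of the four points is larger than `3`
      have g1 : 3 * (u ^ 2 * (Y ^ 2 - b ^ 2)) ≤ Y ^ 2 * (b ^ 2 - u ^ 2) :=
        three_mul_le_of_near hU.le (by linarith) hcon.le hYb.le
      have g4 : 0 < u ^ 2 * (Y ^ 2 - b ^ 2) := mul_pos hU (by linarith)
      have g2 : 3 * (T - A) ≤ T * (A - 1) := by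
        have g3 : 3 * (u ^ 2 * (Y ^ 2 - b ^ 2)) * (T - A) ≤
            T * (A - 1) * (u ^ 2 * (Y ^ 2 - b ^ 2)) :=
          (mul_le_mul_of_nonneg_right g1 (by linarith)).trans hcr
        refine le_of_mul_le_mul_right ?_ g4
        linarith
      by_contra! hT3
      have g5 : 0 ≤ (3 - T) * (A - 1) := mul_nonneg (by linarith) (by linarith)
      have g6 : T * (A - 1) = 3 * (A - 1) - (3 - T) * (A - 1) := by ring
      linarith

/-! ### The monotone branch around the critical value -/

/-- The real bound with a rational constant, from `(11 / 9) ^ 2 < 3 / 2`. -/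
theorem eleven_ninths_le (h : IsRepellingInterval c u ε s) {n : ℕ} (hn : 0 < n) (hns : n < s)
    (hfar : |(quad c)^[n] u| < |(quad c)^[n] 0|) : 11 / 9 * u ≤ |(quad c)^[n] 0| := by
  have h1 := h.real_bound hn hns hfar
  have h2 := h.pos
  refine le_of_sq_le_sq ?_ (abs_nonneg _)
  nlinarith

theorem cycleCoord_period (h : IsRepellingInterval c u ε s) (x : ℝ) :
    cycleCoord c u s x = (ε * x - ε * (quad c)^[s] 0) / (u - ε * (quad c)^[s] 0) := by
  unfold cycleCoord
  have h1 := h.signed_endpoint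
  rw [show u - ε * (quad c)^[s] 0 = ε * ((quad c)^[s] u - (quad c)^[s] 0) by rw [mul_sub, h1],
    ← mul_sub, mul_div_mul_left]
  rcases h.sign with h | h <;> rw [h] <;> norm_num

theorem cycleCoord_lt_iff (h : IsRepellingInterval c u ε s) {x y : ℝ} :
    cycleCoord c u s x < cycleCoord c u s y ↔ ε * x < ε * y := by
  rw [h.cycleCoord_period, h.cycleCoord_period, div_lt_div_iff_of_pos_right]
  · constructor <;> intro <;> linarith
  · linarith [h.return_zero_neg, h.pos]

theorem cycleCoord_le_iff (h : IsRepellingInterval c u ε s) {x y : ℝ} :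
    cycleCoord c u s x ≤ cycleCoord c u s y ↔ ε * x ≤ ε * y := by
  rw [← not_lt, ← not_lt, h.cycleCoord_lt_iff]

theorem abs_eq_sign_mul (h : IsRepellingInterval c u ε s) (x : ℝ) : |x| = |ε * x| := by
  rw [abs_mul, h.abs_sign, one_mul]

/-- The monotone branch of `f^(s-1)` around `f V` covers a definite neighbourhood of `V`. If it ends
before covering it, the end is a critical point, whose image is the far end of an interval of the
cycle and is controlled by the real bound. -/
theorem exists_extension (h : IsRepellingInterval c u ε s) :
    ∃ a b, a < quad c 0 ∧ quad c u < b ∧ NoZero c (s - 1) a b ∧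
      ε * (quad c)^[s - 1] a ≤ -(11 / 9 * u) ∧ 11 / 9 * u ≤ ε * (quad c)^[s - 1] b := by
  have hu := h.pos
  have hs := h.period_pos
  have hs1 : s - 1 + 1 = s := Nat.sub_add_cancel hs
  have hc : quad c 0 < quad c u := quad_strictMonoOn c (mem_Ici.2 le_rfl) hu.le hu
  have hneg := h.return_zero_neg
  obtain ⟨y, huy, hnzy, hy⟩ : ∃ y, u < y ∧ NoZero c s 0 y ∧ 11 / 9 * u ≤ ε * (quad c)^[s] y := by
    have hne : ∀ j < s, (quad c)^[j] u ≠ 0 := by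
      intro j hj
      rcases Nat.eq_zero_or_pos j with rfl | hj0
      · exact hu.ne'
      · exact h.iterate_ne_zero hj0 hj h.u_mem
    obtain ⟨y, hy, hnz, hend⟩ := h.interval.noZero.exists_right (Y := 11 / 9 * u)
      (by linarith) hne
    have huy : u < y := lt_of_le_of_ne hy.1 (by
      rintro rfl
      rcases hend with h1 | ⟨j, hj, h0⟩
      · linarith
      · exact hne j hj h0)
    refine ⟨y, huy, hnz, ?_⟩
    rcases hend with hend | ⟨j, hj, h0⟩
    · rw [← hend]; exact (h.lt_return huy hnz).le
    have hj0 : 0 < j := Nat.pos_of_ne_zero (by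
      rintro rfl; simp only [Function.iterate_zero, id] at h0; linarith)
    obtain ⟨hjfar, hnz', hanti⟩ := h.right_zero hj huy hnz h0
    have hT : (quad c)^[s - j] 0 = (quad c)^[s] y := by
      rw [← h0, ← Function.iterate_add_apply, Nat.sub_add_cancel hj.le]
    have hju : u ≤ |(quad c)^[j] u| := h.u_le_abs hj0 hj h.u_mem
    have mu : u ∈ Icc 0 |(quad c)^[j] 0| := ⟨hu.le, hju.trans hjfar.le⟩
    have l1 := h.cycleCoord_lt_iff.1 (hanti ⟨le_rfl, abs_nonneg _⟩ mu hu)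
    have l2 := h.cycleCoord_le_iff.1 (hanti.antitoneOn mu ⟨abs_nonneg _, hjfar.le⟩ hju)
    rw [quad_iterate_abs c (by omega : s - j ≠ 0), ← Function.iterate_add_apply,
      Nat.sub_add_cancel hj.le, h.signed_endpoint] at l2
    have := h.eleven_ninths_le (n := s - j) (by omega) (by omega) (by
      rw [h.abs_eq_sign_mul, h.abs_eq_sign_mul ((quad c)^[s - j] 0), abs_of_pos (by linarith),
        abs_of_pos (by linarith)]
      exact l1)
    rw [h.abs_eq_sign_mul, abs_of_pos (by linarith), hT] at this
    exact this
  obtain ⟨P, hP, hnzP, hPv⟩ : ∃ P < quad c 0, NoZero c (s - 1) P (quad c u) ∧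
      ε * (quad c)^[s - 1] P ≤ -(11 / 9 * u) := by
    set R := 1 + |c| + 2 * u with hR
    have hq0 : quad c 0 = c := by simp [quad]
    have hRq : -R < quad c 0 := by rw [hq0]; linarith [neg_abs_le c]
    have hnz0 : NoZero c (s - 1) (quad c 0) (quad c u) := by
      have h2 : NoZero c (s - 1 + 1) 0 u := by rw [hs1]; exact h.interval.noZero
      exact h2.comp hu h.zero_mem h.u_mem
    have hne : ∀ j < s - 1, (quad c)^[j] (quad c 0) ≠ 0 := fun j hj => by
      rw [← Function.iterate_succ_apply]
      exact h.iterate_ne_zero j.succ_pos (by omega) h.zero_mem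
    obtain ⟨P, hP, hnz, hend⟩ := hnz0.exists_left hRq.le hne
    have hPq : P < quad c 0 := lt_of_le_of_ne hP.2 (by
      intro heq
      rcases hend with h1 | ⟨j, hj, h0⟩
      · linarith
      · rw [heq] at h0; exact hne j hj h0)
    refine ⟨P, hPq, hnz, ?_⟩
    rcases hend with hend | ⟨j, hj, h0⟩
    · have hbig : R ≤ |(quad c)^[s - 1] P| := by
        have h1 := le_quad_iterate (c := c) (x := R) (by linarith) (s - 1)
        rw [hend, quad_iterate_neg c (by have := h.interval.two_le; omega)]
        exact h1.trans (le_abs_self _)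
      have hcoord := strictMonoOn_quotient (hnz.strictMonoOn_or_strictAntiOn (hPq.trans hc))
        ⟨hPq.le, hc.le⟩ ⟨(hPq.trans hc).le, le_rfl⟩ hc
      simp only [← Function.iterate_succ_apply, Nat.succ_eq_add_one, hs1] at hcoord
      have hlt := hcoord ⟨le_rfl, (hPq.trans hc).le⟩ ⟨hPq.le, hc.le⟩ hPq
      simp only [← Function.iterate_succ_apply (quad c) (s - 1) 0, Nat.succ_eq_add_one, hs1] at hlt
      have hlt' := h.cycleCoord_lt_iff.1 hlt
      rw [h.abs_eq_sign_mul, abs_of_neg (by linarith)] at hbig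
      linarith [abs_nonneg c]
    · obtain ⟨hlt, hnz', hmono⟩ := h.left_zero (x := j + 1) j.succ_pos (by omega) hPq hnz
        (by simpa using h0)
      set x := j + 1 with hx
      have hx0 : 0 < x := j.succ_pos
      have hxk : x < s := by omega
      have hS : (quad c)^[s - x] 0 = (quad c)^[s - 1] P := by
        rw [← h0, ← Function.iterate_add_apply]; congr 2; omega
      have hxu : u ≤ |(quad c)^[x] 0| := h.u_le_abs hx0 (by omega) h.zero_mem
      have mu : u ∈ Icc 0 |(quad c)^[x] u| := ⟨hu.le, hxu.trans hlt.le⟩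
      have l1 := h.cycleCoord_lt_iff.1 (hmono ⟨le_rfl, abs_nonneg _⟩ mu hu)
      have l2 := h.cycleCoord_le_iff.1 (hmono.monotoneOn mu ⟨abs_nonneg _, hlt.le⟩ hxu)
      rw [quad_iterate_abs c (by omega : s - x ≠ 0), ← Function.iterate_add_apply,
        Nat.sub_add_cancel hxk.le] at l2
      have := h.eleven_ninths_le (n := s - x) (by omega) (by omega) (by
        rw [h.abs_eq_sign_mul, h.abs_eq_sign_mul ((quad c)^[s - x] 0), abs_of_neg (by linarith),
          abs_of_neg (by linarith)]
        linarith)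
      rw [h.abs_eq_sign_mul, abs_of_neg (by linarith), hS] at this
      linarith
  refine ⟨P, quad c y, hP, quad_strictMonoOn c (mem_Ici.2 hu.le)
    (mem_Ici.2 (by linarith)) huy, ?_, hPv, ?_⟩
  · exact noZero_join hu huy hnzP (by rwa [hs1])
  · rwa [← Function.iterate_succ_apply, Nat.succ_eq_add_one, hs1]

end IsRepellingInterval

/-! ### Inverse branches on slit planes -/

/-- The branch of the square root with positive real part, on the plane slit along the negative
axis. -/
def csqrt (w : ℂ) : ℂ := Complex.exp (Complex.log w / 2)

theorem csqrt_sq {w : ℂ} (hw : w ∈ Complex.slitPlane) : csqrt w ^ 2 = w := by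
  unfold csqrt
  rw [← Complex.exp_nat_mul]
  push_cast
  rw [mul_div_cancel₀ _ (two_ne_zero), Complex.exp_log (Complex.slitPlane_ne_zero hw)]

theorem csqrt_re_pos {w : ℂ} (hw : w ∈ Complex.slitPlane) : 0 < (csqrt w).re := by
  unfold csqrt
  rw [Complex.exp_re]
  refine mul_pos (Real.exp_pos _) (Real.cos_pos_of_mem_Ioo ?_)
  have h1 := Complex.mem_slitPlane_iff_arg.1 hw
  have h2 := Complex.arg_le_pi w
  have h3 := Complex.neg_pi_lt_arg w
  have h4 : w.arg < Real.pi := lt_of_le_of_ne h2 h1.1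
  have h5 : (Complex.log w / 2).im = w.arg / 2 := by
    rw [show (2:ℂ) = ((2:ℝ):ℂ) by norm_num, Complex.div_ofReal_im, Complex.log_im]
  rw [h5]
  constructor <;> linarith

theorem csqrt_eq {w ζ : ℂ} (hw : w ∈ Complex.slitPlane) (h : ζ ^ 2 = w) (hζ : 0 < ζ.re) :
    csqrt w = ζ := by
  rcases sq_eq_sq_iff_eq_or_eq_neg.1 ((csqrt_sq hw).trans h.symm) with h1 | h1
  · exact h1
  · have := csqrt_re_pos hw
    rw [h1, Complex.neg_re] at this
    linarith

theorem differentiableAt_csqrt {w : ℂ} (hw : w ∈ Complex.slitPlane) :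
    DifferentiableAt ℂ csqrt w :=
  ((differentiableAt_id.clog hw).div_const 2).cexp

/-- For real `p`, `q` and `C ≥ 0`, the closed Poincaré neighbourhood of the interval with the ends
`p`, `q` (in either order) whose bounding discs have centres of height `C |q - p| / 2`. -/
def closedNhd (C p q : ℝ) : Set ℂ :=
  {z | (z.re - p) * (z.re - q) + z.im ^ 2 ≤ C * |q - p| * |z.im|}

theorem mem_closedNhd {C p q : ℝ} {z : ℂ} : z ∈ closedNhd C p q ↔
    (z.re - p) * (z.re - q) + z.im ^ 2 ≤ C * |q - p| * |z.im| := Iff.rfl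

theorem affine_mem_closedNhd {C p q : ℝ} {z : ℂ} (h : z ∈ closedNhd C p q) (e d : ℝ) :
    (e + d * z : ℂ) ∈ closedNhd C (e + d * p) (e + d * q) := by
  rw [mem_closedNhd] at *
  have hre : (e + d * z : ℂ).re = e + d * z.re := by simp
  have him : (e + d * z : ℂ).im = d * z.im := by simp
  rw [hre, him, show e + d * q - (e + d * p) = d * (q - p) by ring, abs_mul, abs_mul]
  have h1 := mul_le_mul_of_nonneg_left h (sq_nonneg d)
  have h2 : |d| * |d| = d ^ 2 := by rw [abs_mul_abs_self, sq]
  calc _ = d ^ 2 * ((z.re - p) * (z.re - q) + z.im ^ 2) := by ring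
    _ ≤ _ := h1
    _ = _ := by rw [← h2]; ring

/-- The Schwarz lemma for the square root: Poincaré neighbourhoods are mapped into Poincaré
neighbourhoods with the same angle. -/
theorem sqrt_mem_closedNhd {C p q : ℝ} (hp : 0 < p) (hq : 0 < q) {ζ : ℂ}
    (hζ : 0 < ζ.re) (h : ζ ^ 2 ∈ closedNhd C (p ^ 2) (q ^ 2)) : ζ ∈ closedNhd C p q := by
  rw [mem_closedNhd] at *
  have hre : (ζ ^ 2).re = ζ.re ^ 2 - ζ.im ^ 2 := by simp [sq]
  have him : (ζ ^ 2).im = 2 * ζ.re * ζ.im := by simp [sq]; ring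
  rw [hre, him, abs_mul, abs_mul, abs_two, abs_of_pos hζ,
    show q ^ 2 - p ^ 2 = (p + q) * (q - p) by ring, abs_mul,
    abs_of_pos (add_pos hp hq)] at h
  set a := ζ.re
  set b := ζ.im
  have key : (a ^ 2 - b ^ 2 - p ^ 2) * (a ^ 2 - b ^ 2 - q ^ 2) + (2 * a * b) ^ 2 =
      2 * a * (p + q) * ((a - p) * (a - q) + b ^ 2) +
        ((a - p) ^ 2 + b ^ 2) * ((a - q) ^ 2 + b ^ 2) := by ring
  rw [key] at h
  have h1 : 0 ≤ ((a - p) ^ 2 + b ^ 2) * ((a - q) ^ 2 + b ^ 2) := by positivity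
  have h2 : 0 < 2 * a * (p + q) := by positivity
  refine le_of_mul_le_mul_left ?_ h2
  linarith

/-- The plane slit along the complement of `f^n (a, b)` in the real axis. -/
def branchDomain (c : ℝ) (n : ℕ) (a b : ℝ) : Set ℂ :=
  {z | z.im ≠ 0 ∨ ∃ x ∈ Ioo a b, z = ((quad c)^[n] x : ℝ)}

/-- The inverse of a monotone branch of `f^n` extends to the slit plane as a composition of square
roots. It respects the half-planes, up to the orientation `κ` of the branch, and does not increase
the angles of Poincaré neighbourhoods. -/
theorem exists_complex_branch {c : ℝ} {n : ℕ} {a b : ℝ} (hab : a < b) (h : NoZero c n a b) :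
    ∃ (G : ℂ → ℂ) (κ : ℝ), DifferentiableOn ℂ G (branchDomain c n a b) ∧
      (∀ z ∈ branchDomain c n a b, (quadC c)^[n] (G z) = z) ∧
      (∀ x ∈ Ioo a b, G ((quad c)^[n] x : ℝ) = x) ∧
      StrictMonoOn (fun x => κ * (quad c)^[n] x) (Ioo a b) ∧
      (∀ z ∈ branchDomain c n a b, z.im ≠ 0 → 0 < κ * ((G z).im * z.im)) ∧
      ∀ C ≥ 0, ∀ x ∈ Ioo a b, ∀ y ∈ Ioo a b, ∀ z ∈ branchDomain c n a b,
        z ∈ closedNhd C ((quad c)^[n] x) ((quad c)^[n] y) → G z ∈ closedNhd C x y := by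
  induction n with
  | zero =>
    refine ⟨id, 1, differentiableOn_id, fun z _ => rfl, fun x _ => rfl,
      fun x _ y _ hxy => by simpa using hxy, fun z _ hz => ?_, fun C _ x _ y _ z _ hz => hz⟩
    simpa using hz
  | succ n ih =>
    obtain ⟨G, κ, hG1, hG2, hG3, hGm, hG4, hG5⟩ := ih (h.mono n.le_succ le_rfl le_rfl)
    -- the sign of `f^n` on `(a, b)`
    obtain ⟨σ, hσ, hpos⟩ : ∃ σ : ℝ, (σ = 1 ∨ σ = -1) ∧ ∀ x ∈ Ioo a b, 0 < σ * (quad c)^[n] x := by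
      have hne := h n n.lt_succ_self
      rcases h.nonneg_or_nonpos hab n.lt_succ_self with k | k
      · exact ⟨1, Or.inl rfl, fun x hx => by
          rw [one_mul]; exact lt_of_le_of_ne (k x (Ioo_subset_Icc_self hx)) (hne x hx).symm⟩
      · exact ⟨-1, Or.inr rfl, fun x hx => by
          have := lt_of_le_of_ne (k x (Ioo_subset_Icc_self hx)) (hne x hx); linarith⟩
    have hσσ : σ * σ = 1 := by rcases hσ with h | h <;> rw [h] <;> norm_num
    have hσc : (σ : ℂ) * σ = 1 := by exact_mod_cast hσσ
    have hslit : ∀ z ∈ branchDomain c (n + 1) a b, z - c ∈ Complex.slitPlane := by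
      rintro z (hz | ⟨x, hx, rfl⟩)
      · exact Or.inr (by simpa using hz)
      · left
        rw [Function.iterate_succ_apply', quad]
        have : (quad c)^[n] x ≠ 0 := h n n.lt_succ_self x hx
        have : 0 < (quad c)^[n] x ^ 2 := by positivity
        rw [← Complex.ofReal_sub, Complex.ofReal_re]
        linarith
    have hS2 : ∀ z ∈ branchDomain c (n + 1) a b, ((σ : ℂ) * csqrt (z - c)) ^ 2 = z - c := by
      intro z hz
      rw [mul_pow, csqrt_sq (hslit z hz), sq, hσc, one_mul]
    have hSreal : ∀ x ∈ Ioo a b, (σ : ℂ) * csqrt (((quad c)^[n + 1] x : ℝ) - c) =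
        ((quad c)^[n] x : ℝ) := by
      intro x hx
      have hmem := hslit _ (Or.inr ⟨x, hx, rfl⟩)
      have := csqrt_eq (ζ := ((σ * (quad c)^[n] x : ℝ) : ℂ)) hmem (by
        rw [Function.iterate_succ_apply', quad]
        push_cast
        rw [mul_pow, sq (σ : ℂ), hσc]; ring) (by simpa using hpos x hx)
      rw [this]
      push_cast
      rw [← mul_assoc, hσc, one_mul]
    have hSim : ∀ z ∈ branchDomain c (n + 1) a b, z.im ≠ 0 →
        0 < σ * (((σ : ℂ) * csqrt (z - c)).im * z.im) := by
      intro z hz him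
      have h1 := csqrt_re_pos (hslit z hz)
      have h2 : z.im = 2 * (csqrt (z - c)).re * (csqrt (z - c)).im := by
        have h3 := congrArg Complex.im (csqrt_sq (hslit z hz))
        rw [Complex.sub_im, Complex.ofReal_im, sub_zero] at h3
        rw [← h3]; simp [sq]; ring
      have h4 : (csqrt (z - c)).im ≠ 0 := by
        intro h0; rw [h0, mul_zero] at h2; exact him h2
      rw [Complex.im_ofReal_mul, h2,
        show σ * (σ * (csqrt (z - c)).im * (2 * (csqrt (z - c)).re * (csqrt (z - c)).im)) =
          σ * σ * (2 * (csqrt (z - c)).re * (csqrt (z - c)).im ^ 2) by ring, hσσ, one_mul]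
      positivity
    have hSdom : ∀ z ∈ branchDomain c (n + 1) a b,
        (σ : ℂ) * csqrt (z - c) ∈ branchDomain c n a b := by
      intro z hz
      by_cases him : z.im = 0
      · rcases hz with hz | ⟨x, hx, rfl⟩
        · exact absurd him hz
        · exact Or.inr ⟨x, hx, hSreal x hx⟩
      · left
        intro h0
        have := hSim z hz him
        rw [h0] at this; simp at this
    refine ⟨fun z => G (σ * csqrt (z - c)), σ * κ, ?_, ?_, ?_, ?_, ?_, ?_⟩
    · refine hG1.comp (fun z hz => ?_) hSdom
      exact (((differentiableAt_csqrt (hslit z hz)).comp z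
        (differentiableAt_id.sub_const _)).const_mul _).differentiableWithinAt
    · intro z hz
      rw [Function.iterate_succ_apply', hG2 _ (hSdom z hz), quadC, hS2 z hz]; ring
    · intro x hx
      simp only [hSreal x hx]
      exact hG3 x hx
    · intro x hx y hy hxy
      have h1 := mul_pos (sub_pos.2 (hGm hx hy hxy)) (add_pos (hpos x hx) (hpos y hy))
      simp only [Function.iterate_succ_apply', quad]
      linarith
    · intro z hz him
      have h1 := hSim z hz him
      have h2 : ((σ : ℂ) * csqrt (z - c)).im ≠ 0 := by
        intro h0; rw [h0] at h1; simp at h1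
      have h3 := hG4 _ (hSdom z hz) h2
      have h4 := mul_pos h1 h3
      set w := (σ : ℂ) * csqrt (z - c)
      have h5 : 0 < w.im ^ 2 := by positivity
      refine (mul_pos_iff_of_pos_left h5).1 (h4.trans_eq ?_)
      ring
    · intro C hC x hx y hy z hz hmem
      refine hG5 C hC x hx y hy _ (hSdom z hz) ?_
      have key : csqrt (z - c) ∈ closedNhd C (σ * (quad c)^[n] x) (σ * (quad c)^[n] y) := by
        refine sqrt_mem_closedNhd (hpos x hx) (hpos y hy) (csqrt_re_pos (hslit z hz)) ?_
        rw [csqrt_sq (hslit z hz)]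
        have h1 := affine_mem_closedNhd hmem (-c) 1
        have e : ∀ t : ℝ, -c + 1 * (quad c)^[n + 1] t = (σ * (quad c)^[n] t) ^ 2 := by
          intro t
          rw [Function.iterate_succ_apply', quad, mul_pow, sq σ, hσσ]; ring
        rw [e, e] at h1
        convert h1 using 1
        push_cast; ring
      have h2 := affine_mem_closedNhd key 0 σ
      simp only [← mul_assoc, hσσ, one_mul, zero_add, Complex.ofReal_zero] at h2
      exact h2

/-! ### The normalized inverse branch -/

/-- The inverse branch of `f^(s-1)` in the coordinate in which `V = [-1, 1]`, the fixed endpoint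
is `1`, the critical value of the return map is `-m`, and the critical value `c` of `f` is `0`:
the properties on which the inclusion of the preimage of `Ω` rests. The function `φ` is the
restriction of `ψ` to the real axis. -/
structure NormalizedBranch (m : ℝ) (ψ : ℂ → ℂ) (φ : ℝ → ℝ) : Prop where
  m_pos : 0 < m
  m_le : m ≤ 1
  differentiableOn : DifferentiableOn ℂ ψ (slitPlaneOf (11 / 9))
  ofReal : ∀ x ∈ Ioo (-(11 / 9) : ℝ) (11 / 9), ψ x = φ x
  im_pos : ∀ z : ℂ, 0 < z.im → 0 < (ψ z).im
  im_neg : ∀ z : ℂ, z.im < 0 → (ψ z).im < 0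
  strictMonoOn : StrictMonoOn φ (Ioo (-(11 / 9)) (11 / 9))
  closedNhd : ∀ C ≥ 0, ∀ p ∈ Ioo (-(11 / 9) : ℝ) (11 / 9), ∀ q ∈ Ioo (-(11 / 9) : ℝ) (11 / 9),
    ∀ z ∈ slitPlaneOf (11 / 9), z ∈ closedNhd C p q → ψ z ∈ closedNhd C (φ p) (φ q)
  one : φ 1 = 1
  neg_m : φ (-m) = 0
  zero_lt : φ 0 < m ^ 2
  lt_sq : ∀ q ∈ Ioo (1 : ℝ) (11 / 9), φ q < q ^ 2
  left : -22 ≤ φ (-(6 / 5))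

theorem crossRatio_mul_left (a p q b : ℝ) {d : ℝ} (hd : d ≠ 0) :
    crossRatio (d * a) (d * p) (d * q) (d * b) = crossRatio a p q b := by
  have h := crossRatio_affine a p q b 0 (1 / d) (one_div_ne_zero hd)
  simp only [sub_zero, one_div, div_inv_eq_mul] at h
  simp only [mul_comm d]
  exact h

/-- An upper bound for `A = -φ (-6 / 5)` from the expansion of the cross-ratio of `-61 / 50`, `-6 /
5`, `-m` and `0`, whose images are `-B`, `-A`, `0` and `e`. -/
theorem le_of_crossRatio {m A B e : ℝ} (hm : 0 < m) (hm1 : m ≤ 1) (he : 0 < e) (hem : e < m ^ 2)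
    (hA : 0 < A) (hAB : A < B)
    (h : crossRatio (-B) (-A) 0 e ≤ crossRatio (-(61 / 50)) (-(6 / 5)) (-m) 0) : A ≤ 22 := by
  unfold crossRatio at h
  have h1 : A / e ≤ (e - -B) * (0 - -A) / ((-A - -B) * (e - 0)) := by
    rw [div_le_div_iff₀ he (mul_pos (by linarith) (by linarith))]
    nlinarith [mul_pos hA he, mul_pos (mul_pos hA he) (add_pos he hA)]
  have h2 : (0 - -(61 / 50)) * (-m - -(6 / 5)) / ((-(6 / 5) - -(61 / 50)) * (0 - -m)) =
      61 * (6 / 5 - m) / m := by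
    have hm' : (-(6 / 5) - -(61 / 50)) * (0 - -m) ≠ 0 := by
      exact mul_ne_zero (by norm_num) (by simpa using hm.ne')
    rw [div_eq_div_iff hm' hm.ne']; ring
  rw [h2] at h
  have h3 := h1.trans h
  rw [div_le_div_iff₀ he hm] at h3
  by_contra! hcon
  have h4 : A * m ≤ 61 * (6 / 5 - m) * m ^ 2 :=
    h3.trans (mul_le_mul_of_nonneg_left hem.le (by linarith))
  have h5 : A ≤ 61 * (6 / 5 - m) * m := by
    refine le_of_mul_le_mul_right ?_ hm
    linarith
  nlinarith [sq_nonneg (m - 3 / 5)]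

namespace IsRepellingInterval

variable {c u ε : ℝ} {s : ℕ}

/-- The inverse of the monotone branch around `f V`, rescaled so that `V` becomes `[-1, 1]` and the
critical value `c` becomes `0`. -/
theorem exists_normalizedBranch (h : IsRepellingInterval c u ε s) :
    ∃ (m : ℝ) (ψ : ℂ → ℂ) (φ : ℝ → ℝ), NormalizedBranch m ψ φ ∧ ε * (quad c)^[s] 0 = -(m * u) ∧
      ∀ w ∈ slitPlaneOf (11 / 9), (quadC c)^[s - 1] (c + u ^ 2 * ψ w) = ε * u * w := by
  have hu := h.pos
  have hs := h.period_pos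
  have hs1 : s - 1 + 1 = s := Nat.sub_add_cancel hs
  have hεε := h.sign_mul_self
  obtain ⟨a, b, ha, hb, hnz, hga, hgb⟩ := h.exists_extension
  have hc0 : quad c 0 = c := by simp [quad]
  have hcu : quad c 0 < quad c u := quad_strictMonoOn c (mem_Ici.2 le_rfl) hu.le hu
  have hab : a < b := by linarith
  have hit : ∀ x, (quad c)^[s - 1] (quad c x) = (quad c)^[s] x := fun x => by
    rw [← Function.iterate_succ_apply, Nat.succ_eq_add_one, hs1]
  obtain ⟨G, κ, hG1, hG2, hG3, hGm, hG4, hG5⟩ := exists_complex_branch hab hnz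
  have m0 : quad c 0 ∈ Ioo a b := ⟨ha, by linarith⟩
  have mu : quad c u ∈ Ioo a b := ⟨by linarith, hb⟩
  have hεmono : StrictMonoOn (fun x => ε * (quad c)^[s - 1] x) (Icc a b) := by
    have h0 := h.return_zero_neg
    have h1 := h.signed_endpoint
    have m0' := Ioo_subset_Icc_self m0
    have mu' := Ioo_subset_Icc_self mu
    rcases hnz.strictMonoOn_or_strictAntiOn hab with mm | mm <;> rcases h.sign with rfl | rfl
    · exact fun x hx y hy hxy => by simpa using mm hx hy hxy
    · have := mm m0' mu' hcu; rw [hit, hit] at this; linarith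
    · have := mm m0' mu' hcu; rw [hit, hit] at this; linarith
    · exact fun x hx y hy hxy => by simpa using mm hx hy hxy
  have hκε : 0 < κ * ε := by
    have h1 := hGm m0 mu hcu
    have h2 := hεmono (Ioo_subset_Icc_self m0) (Ioo_subset_Icc_self mu) hcu
    simp only at h1 h2
    have h3 := mul_pos (sub_pos.2 h1) (sub_pos.2 h2)
    have h4 : (κ * (quad c)^[s - 1] (quad c u) - κ * (quad c)^[s - 1] (quad c 0)) *
        (ε * (quad c)^[s - 1] (quad c u) - ε * (quad c)^[s - 1] (quad c 0)) =
        κ * ε * ((quad c)^[s - 1] (quad c u) - (quad c)^[s - 1] (quad c 0)) ^ 2 := by ring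
    rw [h4] at h3
    exact pos_of_mul_pos_left h3 (sq_nonneg _)
  -- the real inverse branch
  have hex : ∀ x : ℝ, ∃ t, x ∈ Ioo (-(11 / 9) : ℝ) (11 / 9) →
      t ∈ Ioo a b ∧ ε * (quad c)^[s - 1] t = u * x := by
    intro x
    by_cases hx : x ∈ Ioo (-(11 / 9) : ℝ) (11 / 9)
    · have l1 : -(11 / 9 * u) < u * x := by nlinarith [hx.1]
      have l2 : u * x < 11 / 9 * u := by nlinarith [hx.2]
      have hcont : Continuous fun x => ε * (quad c)^[s - 1] x :=
        (differentiable_signed_iterate c ε (s - 1)).continuous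
      obtain ⟨t, ht, ht'⟩ := intermediate_value_Ioo hab.le hcont.continuousOn
        (show u * x ∈ Ioo _ _ from ⟨hga.trans_lt l1, l2.trans_le hgb⟩)
      exact ⟨t, fun _ => ⟨ht, ht'⟩⟩
    · exact ⟨0, fun h => absurd h hx⟩
  choose t ht using hex
  have htmem : ∀ x ∈ Ioo (-(11 / 9) : ℝ) (11 / 9), t x ∈ Ioo a b := fun x hx => (ht x hx).1
  have htval : ∀ x ∈ Ioo (-(11 / 9) : ℝ) (11 / 9), (quad c)^[s - 1] (t x) = ε * u * x := by
    intro x hx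
    rw [mul_assoc, ← (ht x hx).2, ← mul_assoc, hεε, one_mul]
  have htuniq : ∀ x ∈ Ioo (-(11 / 9) : ℝ) (11 / 9), ∀ y ∈ Ioo a b,
      ε * (quad c)^[s - 1] y = u * x → t x = y := by
    intro x hx y hy hxy
    exact hεmono.injOn (Ioo_subset_Icc_self (htmem x hx)) (Ioo_subset_Icc_self hy)
      ((ht x hx).2.trans hxy.symm)
  have htmono : StrictMonoOn t (Ioo (-(11 / 9)) (11 / 9)) := by
    intro x hx y hy hxy
    refine (hεmono.lt_iff_lt (Ioo_subset_Icc_self (htmem x hx))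
      (Ioo_subset_Icc_self (htmem y hy))).1 ?_
    simp only [(ht x hx).2, (ht y hy).2]
    exact mul_lt_mul_of_pos_left hxy hu
  have hdom : ∀ w ∈ slitPlaneOf (11 / 9), ((ε * u : ℝ) * w : ℂ) ∈ branchDomain c (s - 1) a b := by
    have hεu : ε * u ≠ 0 := by
      intro h0
      have : ε * (ε * u) = u := by rw [← mul_assoc, hεε, one_mul]
      rw [h0, mul_zero] at this; linarith
    intro w hw
    by_cases him : w.im = 0
    · rcases hw with hw | hw
      · exact absurd him hw
      · right
        refine ⟨t w.re, htmem _ hw, ?_⟩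
        rw [htval _ hw]
        apply Complex.ext <;> simp [him]
    · left
      rw [Complex.im_ofReal_mul]
      exact mul_ne_zero hεu him
  have hu2 : (u : ℂ) ^ 2 ≠ 0 := by
    have : (u : ℂ) ≠ 0 := by exact_mod_cast hu.ne'
    positivity
  have himψ : ∀ z : ℂ, z.im ≠ 0 →
      0 < ((G ((ε * u : ℝ) * z) - c) / (u ^ 2 : ℝ)).im * z.im := by
    intro z hz
    have h1 := hG4 _ (hdom z (Or.inl hz)) (by
      rcases hdom z (Or.inl hz) with h2 | ⟨x, -, hx⟩
      · exact h2
      · have := congrArg Complex.im hx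
        rw [Complex.im_ofReal_mul, Complex.ofReal_im] at this
        have hεu : ε * u ≠ 0 := fun h0 => by
          rcases mul_eq_zero.1 h0 with h0 | h0
          · rw [h0] at hεε; linarith
          · linarith
        exact absurd this (mul_ne_zero hεu hz))
    rw [Complex.im_ofReal_mul] at h1
    rw [Complex.div_ofReal_im, Complex.sub_im, Complex.ofReal_im, sub_zero, div_mul_eq_mul_div]
    refine div_pos ?_ (by positivity)
    have h2 : 0 < κ * ε * u := mul_pos hκε hu
    refine pos_of_mul_pos_right (a := κ * ε * u) ?_ h2.le
    exact h1.trans_eq (by ring)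
  set φ : ℝ → ℝ := fun x => (t x - c) / u ^ 2 with hφ
  set ψ : ℂ → ℂ := fun w => (G ((ε * u : ℝ) * w) - c) / (u ^ 2 : ℝ) with hψ
  have hsqrt : ∀ x ∈ Ioo (-(11 / 9) : ℝ) (11 / 9), 0 < φ x →
      0 < u * √(φ x) ∧ quad c (u * √(φ x)) = t x := by
    intro x _ hx
    refine ⟨mul_pos hu (Real.sqrt_pos.2 hx), ?_⟩
    rw [quad, mul_pow, Real.sq_sqrt hx.le, hφ]
    field_simp
    ring
  have hone : φ 1 = 1 := by
    have : t 1 = quad c u := htuniq 1 (by norm_num) _ mu (by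
      rw [hit, h.signed_endpoint, mul_one])
    simp only [hφ, this, quad]
    field_simp
    ring
  have hφmono : StrictMonoOn φ (Ioo (-(11 / 9)) (11 / 9)) := fun x hx y hy hxy =>
    div_lt_div_of_pos_right (by linarith [htmono hx hy hxy]) (by positivity)
  set m := -(ε * (quad c)^[s] 0) / u with hm
  have hmu : m * u = -(ε * (quad c)^[s] 0) := div_mul_cancel₀ _ hu.ne'
  have hm0 : 0 < m := div_pos (by linarith [h.return_zero_neg]) hu
  have hm1 : m ≤ 1 := (div_le_one hu).2 (by linarith [h.neg_le_return_zero])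
  have hmmem : -m ∈ Ioo (-(11 / 9) : ℝ) (11 / 9) := ⟨by linarith, by linarith⟩
  have hnegm : φ (-m) = 0 := by
    have : t (-m) = quad c 0 := htuniq _ hmmem _ m0 (by
      rw [hit]; linarith)
    simp [hφ, this, hc0]
  have h0mem : (0 : ℝ) ∈ Ioo (-(11 / 9) : ℝ) (11 / 9) := by norm_num
  have hφ0 : 0 < φ 0 := by
    have := hφmono hmmem h0mem (by linarith)
    rwa [hnegm] at this
  have hzero : φ 0 < m ^ 2 := by
    obtain ⟨hα0, hα⟩ := hsqrt 0 h0mem hφ0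
    have hle : √(φ 0) ≤ 1 := by
      have := hφmono h0mem (show (1 : ℝ) ∈ Ioo (-(11 / 9) : ℝ) (11 / 9) by norm_num) (by norm_num)
      exact Real.sqrt_le_iff.2 ⟨zero_le_one, by rw [hone] at this; linarith⟩
    have := h.zero_lt_abs_return_zero (α := u * √(φ 0)) ⟨hα0.le, by nlinarith⟩ (by
      rw [← hit, hα, htval 0 h0mem, mul_zero])
    rw [← hmu, mul_comm] at this
    have := lt_of_mul_lt_mul_right this hu.le
    exact (Real.sqrt_lt' hm0).1 this
  refine ⟨m, ψ, φ, ⟨hm0, hm1, ?_, ?_, ?_, ?_, hφmono, ?_, hone, hnegm, hzero, ?_, ?_⟩, by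
    rw [hmu, neg_neg], ?_⟩
  · refine DifferentiableOn.div_const (DifferentiableOn.sub_const
      (hG1.comp (fun z _ => ?_) hdom) _) _
    exact ((differentiableAt_id.const_mul _)).differentiableWithinAt
  · intro x hx
    have : ((ε * u : ℝ) * x : ℂ) = ((quad c)^[s - 1] (t x) : ℝ) := by
      rw [htval x hx]; push_cast; ring
    simp only [hψ, this, hG3 _ (htmem x hx), hφ]
    push_cast; ring
  · intro z hz
    exact (mul_pos_iff_of_pos_right hz).1 (himψ z hz.ne')
  · intro z hz
    exact neg_of_mul_pos_left (himψ z hz.ne) hz.le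
  · intro C hC p hp q hq z hz hmem
    have h1 := affine_mem_closedNhd hmem 0 (ε * u)
    simp only [zero_add, Complex.ofReal_zero] at h1
    rw [← htval p hp, ← htval q hq] at h1
    have h2 := hG5 C hC _ (htmem p hp) _ (htmem q hq) _ (hdom z hz) h1
    have h3 := affine_mem_closedNhd h2 (-c / u ^ 2) (1 / u ^ 2)
    have e : ∀ x, -c / u ^ 2 + 1 / u ^ 2 * t x = φ x := fun x => by simp only [hφ]; ring
    rw [e, e] at h3
    convert h3 using 1
    simp only [hψ]; push_cast; ring
  · intro q hq
    have hqm : q ∈ Ioo (-(11 / 9) : ℝ) (11 / 9) := ⟨by linarith [hq.1], hq.2⟩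
    have h1 : 1 < φ q := by
      have := hφmono (show (1 : ℝ) ∈ Ioo (-(11 / 9) : ℝ) (11 / 9) by norm_num) hqm hq.1
      rwa [hone] at this
    obtain ⟨hp0, hp⟩ := hsqrt q hqm (by linarith)
    have h2 : 1 < √(φ q) := by rw [Real.lt_sqrt (by norm_num)]; linarith
    have hnz' : NoZero c s 0 (u * √(φ q)) := by
      intro j hj x hx h0
      rcases Nat.eq_zero_or_pos j with rfl | hj0
      · exact hx.1.ne' h0
      obtain ⟨j, rfl⟩ := Nat.exists_eq_succ_of_ne_zero hj0.ne'
      refine hnz j (by omega) (quad c x) ⟨?_, ?_⟩ (by rwa [← Function.iterate_succ_apply])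
      · exact ha.trans (quad_strictMonoOn c (mem_Ici.2 le_rfl) (mem_Ici.2 hx.1.le) hx.1)
      · refine lt_trans ?_ (htmem q hqm).2
        rw [← hp]
        exact quad_strictMonoOn c (mem_Ici.2 hx.1.le) (mem_Ici.2 hp0.le) hx.2
    have h3 := h.lt_return (p := u * √(φ q)) (by nlinarith) hnz'
    rw [← hit, hp, (ht q hqm).2] at h3
    have h4 := lt_of_mul_lt_mul_left h3 hu.le
    exact (Real.sqrt_lt' (by linarith [hq.1])).1 h4
  · -- the expansion of cross-ratios on four points to the left of `0`
    have n1 : (-(61 / 50) : ℝ) ∈ Ioo (-(11 / 9) : ℝ) (11 / 9) := by norm_num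
    have n2 : (-(6 / 5) : ℝ) ∈ Ioo (-(11 / 9) : ℝ) (11 / 9) := by norm_num
    have hnz' := hnz.mono le_rfl (htmem _ n1).1.le (htmem _ h0mem).2.le
    have hcr := hnz'.crossRatio_le (htmono n1 n2 (by norm_num)) (htmono n2 hmmem (by linarith))
      (htmono hmmem h0mem (by linarith))
    rw [← crossRatio_affine (t _) _ _ _ c (u ^ 2) (by positivity)] at hcr
    rw [htval _ n1, htval _ n2, htval _ hmmem, htval _ h0mem] at hcr
    have hεu : ε * u ≠ 0 := by
      rcases h.sign with h | h <;> rw [h] <;> simp [hu.ne']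
    rw [crossRatio_mul_left _ _ _ _ hεu] at hcr
    change crossRatio (φ _) (φ _) (φ _) (φ 0) ≤ _ at hcr
    rw [hnegm, ← neg_neg (φ (-(61 / 50))), ← neg_neg (φ (-(6 / 5)))] at hcr
    have l1 := hφmono n1 n2 (by norm_num)
    have l2 := hφmono n2 hmmem (by linarith)
    have := le_of_crossRatio hm0 hm1 hφ0 hzero (by linarith) (by linarith) hcr
    linarith
  · intro w hw
    have e : (c + u ^ 2 * ψ w : ℂ) = G ((ε * u : ℝ) * w) := by
      simp only [hψ]
      push_cast
      rw [mul_div_cancel₀ _ hu2]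
      ring
    rw [e, hG2 _ (hdom w hw)]
    push_cast; ring

end IsRepellingInterval

section

open Filter Topology

/-! ### Functions preserving the upper half-plane -/

/-- A Schwarz formula: on the real diameter of the unit disc, the real part of a holomorphic
function is the integral of its boundary imaginary part against a kernel that has the sign of
`w * z.im`. -/
theorem re_sub_eq_circleAverage {f : ℂ → ℂ} (hf : DiffContOnCl ℂ f (Metric.ball 0 1)) {w : ℝ}
    (hw : |w| < 1) :
    (f w).re - (f 0).re =
      Real.circleAverage (fun z => 2 * w / (1 - 2 * w * z.re + w ^ 2) * (z.im * (f z).im)) 0 1 := by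
  have hw2 : w ^ 2 < 1 := (sq_lt_one_iff_abs_lt_one w).2 hw
  have hcont : ContinuousOn f (Metric.sphere 0 1) :=
    hf.continuousOn_ball.mono Metric.sphere_subset_closedBall
  have hne1 : ∀ z ∈ Metric.closedBall (0:ℂ) 1, 1 - w * z ≠ 0 := by
    intro z hz h0
    have h1 : (w : ℂ) * z = 1 := (sub_eq_zero.1 h0).symm
    have h2 := congrArg norm h1
    rw [norm_mul, Complex.norm_real, Real.norm_eq_abs, norm_one] at h2
    have h3 : ‖z‖ ≤ 1 := by simpa using hz
    nlinarith [abs_nonneg w]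
  have hne2 : ∀ z ∈ Metric.sphere (0:ℂ) 1, z - w ≠ 0 := by
    intro z hz h0
    have h1 : z = w := sub_eq_zero.1 h0
    have h2 : ‖z‖ = 1 := by simpa using hz
    rw [h1, Complex.norm_real, Real.norm_eq_abs] at h2
    linarith
  have e1 : Real.circleAverage (fun z => ((z - 0) / (z - w)) • f z) 0 1 = f w := by
    refine DiffContOnCl.circleAverage_smul_div (by simpa using hf) ?_
    simpa using hw
  have e2 : Real.circleAverage (fun z => f z / (1 - w * z)) 0 1 = f 0 := by
    have : DiffContOnCl ℂ (fun z => f z / (1 - w * z)) (Metric.ball 0 |(1:ℝ)|) := by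
      rw [abs_one]
      refine ⟨hf.1.div (by fun_prop) fun z hz => hne1 z (Metric.ball_subset_closedBall hz), ?_⟩
      rw [closure_ball _ one_ne_zero]
      exact hf.continuousOn_ball.div (by fun_prop) hne1
    have := this.circleAverage
    simpa using this
  have i1 : CircleIntegrable (fun z => ((z - 0) / (z - w)) • f z) 0 1 := by
    refine ContinuousOn.circleIntegrable zero_le_one ?_
    exact (ContinuousOn.div (by fun_prop) (by fun_prop) hne2).smul hcont
  have i2 : CircleIntegrable (fun z => f z / (1 - w * z)) 0 1 := by
    refine ContinuousOn.circleIntegrable zero_le_one ?_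
    exact hcont.div (by fun_prop) fun z hz => hne1 z (Metric.sphere_subset_closedBall hz)
  rw [← Complex.sub_re, ← e1, ← e2, ← Real.circleAverage_fun_sub i1 i2]
  have hre := Complex.reCLM.circleAverage_comp_comm (i1.sub i2)
  have : (Real.circleAverage (fun z => ((z - 0) / (z - w)) • f z - f z / (1 - w * z)) 0 1).re =
    Real.circleAverage (Complex.reCLM ∘ fun z =>
      ((z - 0) / (z - w)) • f z - f z / (1 - w * z)) 0 1 := by
    exact hre.symm
  rw [this]
  refine Real.circleAverage_congr_sphere fun z hz => ?_
  rw [abs_one] at hz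
  have hz1 : z.re ^ 2 + z.im ^ 2 = 1 := by
    have h2 : ‖z‖ = 1 := by simpa using hz
    have := Complex.sq_norm z
    rw [h2, Complex.normSq_apply] at this
    linarith
  have hn1 := hne1 z (Metric.sphere_subset_closedBall hz)
  have hn2 := hne2 z hz
  have hD : (1 - 2 * w * z.re + w ^ 2 : ℝ) ≠ 0 := by
    have h3 : Complex.normSq (1 - w * z) = 1 - 2 * w * z.re + w ^ 2 := by
      rw [Complex.normSq_apply]
      simp
      linear_combination w ^ 2 * hz1
    rw [← h3]
    exact fun h0 => hn1 (Complex.normSq_eq_zero.1 h0)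
  have hcz : (starRingEnd ℂ) z * z = 1 := by
    rw [mul_comm, Complex.mul_conj, Complex.normSq_apply]
    norm_cast; linarith
  have key : z / (z - w) - 1 / (1 - w * z) =
      ((-2 * w * z.im / (1 - 2 * w * z.re + w ^ 2) : ℝ) : ℂ) * Complex.I := by
    have hDc : ((1 - 2 * w * z.re + w ^ 2 : ℝ) : ℂ) ≠ 0 := by exact_mod_cast hD
    have h4 : ((1 - 2 * w * z.re + w ^ 2 : ℝ) : ℂ) * z = (z - w) * (1 - w * z) := by
      have h5 : (2 * z.re : ℂ) = z + (starRingEnd ℂ) z := by rw [Complex.add_conj]; push_cast; ring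
      push_cast
      linear_combination (-w * z) * h5 - w * hcz
    have h6 : (2 * z.im * Complex.I : ℂ) = z - (starRingEnd ℂ) z := by
      rw [Complex.sub_conj]; push_cast; ring
    have h7 : z ≠ 0 := by rintro rfl; simp at hcz
    rw [div_sub_div _ _ hn2 hn1, ← h4, Complex.ofReal_div, div_mul_eq_mul_div,
      div_eq_div_iff (mul_ne_zero hDc h7) hDc]
    generalize ((1 - 2 * w * z.re + w ^ 2 : ℝ) : ℂ) = D
    push_cast
    linear_combination w * D * z * h6 - w * D * hcz
  have : (((z - 0) / (z - w)) • f z - f z / (1 - w * z)) =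
      (((-2 * w * z.im / (1 - 2 * w * z.re + w ^ 2) : ℝ) : ℂ) * Complex.I) * f z := by
    rw [← key, sub_zero, smul_eq_mul]; ring
  simp only [Function.comp, this, Complex.reCLM_apply]
  rw [mul_assoc, Complex.re_ofReal_mul, Complex.I_mul_re]
  ring

/-- A combination of values of `f` at real points is nonnegative if `f` maps the upper and the lower
half of the unit circle to the closed upper and lower half-planes and the combination of the Schwarz
kernels is nonnegative. -/
theorem sum_mul_re_sub_nonneg {ι : Type*} (S : Finset ι) (k w : ι → ℝ) {f : ℂ → ℂ}
    (hf : DiffContOnCl ℂ f (Metric.ball 0 1)) (hw : ∀ i ∈ S, |w i| < 1)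
    (hpos : ∀ z ∈ Metric.sphere (0 : ℂ) 1, 0 ≤ z.im * (f z).im)
    (hk : ∀ z ∈ Metric.sphere (0 : ℂ) 1,
      0 ≤ ∑ i ∈ S, k i * (2 * w i / (1 - 2 * w i * z.re + w i ^ 2))) :
    0 ≤ ∑ i ∈ S, k i * ((f (w i)).re - (f 0).re) := by
  have hcont : ContinuousOn f (Metric.sphere 0 1) :=
    hf.continuousOn_ball.mono Metric.sphere_subset_closedBall
  have e : ∑ i ∈ S, k i * ((f (w i)).re - (f 0).re) = Real.circleAverage (fun z => ∑ i ∈ S,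
      k i • (2 * w i / (1 - 2 * w i * z.re + w i ^ 2) * (z.im * (f z).im))) 0 1 := by
    rw [Real.circleAverage_fun_sum]
    · refine Finset.sum_congr rfl fun i hi => ?_
      rw [re_sub_eq_circleAverage hf (hw i hi), Real.circleAverage_fun_smul, smul_eq_mul]
    · intro i hi
      refine ContinuousOn.circleIntegrable zero_le_one ?_
      simp only [smul_eq_mul]
      refine ContinuousOn.mul continuousOn_const (ContinuousOn.mul (ContinuousOn.div
        continuousOn_const (Continuous.continuousOn
          (f := fun z : ℂ => 1 - 2 * w i * z.re + w i ^ 2) (by fun_prop))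
        fun z hz => ?_)
        (ContinuousOn.mul Complex.continuous_im.continuousOn
          (Complex.continuous_im.comp_continuousOn hcont)))
      have h1 : |z.re| ≤ 1 := by
        have h2 : ‖z‖ = 1 := by simpa using hz
        exact h2 ▸ Complex.abs_re_le_norm z
      have h2 := abs_lt.1 (hw i hi)
      have h3 := abs_le.1 h1
      have h4 : w i * z.re ≤ |w i| := by
        calc w i * z.re ≤ |w i * z.re| := le_abs_self _
          _ = |w i| * |z.re| := abs_mul _ _
          _ ≤ |w i| * 1 := mul_le_mul_of_nonneg_left h1 (abs_nonneg _)
          _ = |w i| := mul_one _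
      have h5 : 0 < (1 - |w i|) ^ 2 := by have := hw i hi; exact pow_pos (by linarith) 2
      have h6 : |w i| ^ 2 = w i ^ 2 := sq_abs _
      nlinarith
  rw [e]
  refine Real.circleAverage_nonneg_of_nonneg fun z hz => ?_
  rw [abs_one] at hz
  simp only [smul_eq_mul, ← mul_assoc]
  rw [← Finset.sum_mul, ← Finset.sum_mul]
  rw [mul_assoc]
  exact mul_nonneg (by simpa only [mul_div_assoc, mul_assoc] using hk z hz) (hpos z hz)

/-- The map `w ↦ 2 w / (1 + w ^ 2)` of the unit disc onto the plane slit along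
`(-∞, -1] ∪ [1, ∞)`. -/
def slitMap (w : ℂ) : ℂ := 2 * w / (1 + w ^ 2)

theorem one_add_sq_ne_zero {w : ℂ} (hw : ‖w‖ < 1) : 1 + w ^ 2 ≠ 0 := by
  intro h
  have h1 : w ^ 2 = -1 := by linear_combination h
  have h2 := congrArg norm h1
  rw [norm_pow, norm_neg, norm_one] at h2
  nlinarith [norm_nonneg w]

theorem slitMap_im {w : ℂ} : (slitMap w).im =
    2 * w.im * (1 - ‖w‖ ^ 2) / Complex.normSq (1 + w ^ 2) := by
  unfold slitMap
  rw [Complex.div_im, Complex.sq_norm, Complex.normSq_apply w, ← sub_div]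
  congr 1
  simp [sq]
  ring

theorem slitMap_ofReal (w : ℝ) : slitMap w = (2 * w / (1 + w ^ 2) : ℝ) := by
  unfold slitMap; push_cast; ring

theorem abs_slitMap_lt {w : ℝ} (hw : |w| < 1) : |2 * w / (1 + w ^ 2)| < 1 := by
  have h1 := abs_lt.1 hw
  have h2 : 0 < 1 + w ^ 2 := by positivity
  rw [abs_lt, lt_div_iff₀ h2, div_lt_iff₀ h2]
  constructor <;> nlinarith [mul_pos (show 0 < 1 - w by linarith) (show 0 < 1 - w by linarith),
    mul_pos (show 0 < 1 + w by linarith) (show 0 < 1 + w by linarith)]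

theorem mul_slitMap_mem {L : ℝ} (hL : 0 < L) {w : ℂ} (hw : ‖w‖ < 1) :
    (L : ℂ) * slitMap w ∈ slitPlaneOf L := by
  by_cases him : w.im = 0
  · right
    obtain ⟨x, rfl⟩ : ∃ x : ℝ, w = x := ⟨w.re, by apply Complex.ext <;> simp [him]⟩
    rw [slitMap_ofReal, ← Complex.ofReal_mul, Complex.ofReal_re]
    have h1 : |x| < 1 := by simpa using hw
    have h2 := abs_lt.1 (abs_slitMap_lt h1)
    constructor <;> nlinarith [h2.1, h2.2]
  · left
    rw [Complex.im_ofReal_mul, slitMap_im]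
    have h1 : 0 < Complex.normSq (1 + w ^ 2) := Complex.normSq_pos.2 (one_add_sq_ne_zero hw)
    have h2 : 0 < 1 - ‖w‖ ^ 2 := by nlinarith [norm_nonneg w]
    exact mul_ne_zero hL.ne' (div_ne_zero (mul_ne_zero (mul_ne_zero two_ne_zero him) h2.ne') h1.ne')

theorem isOpen_slitPlaneOf (M : ℝ) : IsOpen (slitPlaneOf M) :=
  (isOpen_ne.preimage Complex.continuous_im).union (isOpen_Ioo.preimage Complex.continuous_re)

theorem exists_slitMap_eq {L x : ℝ} (hx : |x| < L) :
    ∃ w : ℝ, |w| < 1 ∧ L * (2 * w / (1 + w ^ 2)) = x := by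
  have hL : 0 < L := (abs_nonneg x).trans_lt hx
  have h0 : x ^ 2 < L ^ 2 := by
    rw [← sq_abs x]
    exact pow_lt_pow_left₀ hx (abs_nonneg _) two_ne_zero
  set r := √(L ^ 2 - x ^ 2) with hr
  have hr2 : r ^ 2 = L ^ 2 - x ^ 2 := Real.sq_sqrt (by linarith)
  have hrp : 0 < r := Real.sqrt_pos.2 (by linarith)
  have hLr : 0 < L + r := by linarith
  refine ⟨x / (L + r), ?_, ?_⟩
  · rw [abs_div, abs_of_pos hLr, div_lt_one hLr]; linarith
  · have h1 : 1 + (x / (L + r)) ^ 2 = 2 * L / (L + r) := by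
      field_simp
      linear_combination hr2
    rw [h1]
    field_simp

/-- Positivity of a combination of values of a holomorphic function on a slit plane that preserves
the half-planes, provided the same combination of the kernels is nonnegative. -/
theorem NormalizedBranch.sum_nonneg {m : ℝ} {ψ : ℂ → ℂ} {φ : ℝ → ℝ} (h : NormalizedBranch m ψ φ)
    {ι : Type*} (S : Finset ι) (k x : ι → ℝ) (hx : ∀ i ∈ S, |x i| < 11 / 9)
    (hk : ∀ σ ∈ Icc (-1 : ℝ) 1, 0 ≤ ∑ i ∈ S, k i * (x i / (11 / 9 - σ * x i))) :
    0 ≤ ∑ i ∈ S, k i * (φ (x i) - φ 0) := by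
  have hL : (0:ℝ) < 11 / 9 := by norm_num
  have hcast : ((11 / 9 : ℝ) : ℂ) = 11 / 9 := by norm_num
  have hex : ∀ i, ∃ w : ℝ, i ∈ S → |w| < 1 ∧ 11 / 9 * (2 * w / (1 + w ^ 2)) = x i := by
    intro i
    by_cases hi : i ∈ S
    · obtain ⟨w, h1, h2⟩ := exists_slitMap_eq (hx i hi)
      exact ⟨w, fun _ => ⟨h1, h2⟩⟩
    · exact ⟨0, fun h => absurd h hi⟩
  choose w hw using hex
  -- the slit plane is parametrized by discs of radius `ρ < 1`, where `ψ` is continuous up to the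
  -- boundary, and `ρ` tends to `1`
  have hρ : ∀ ρ ∈ Ioo (0 : ℝ) 1, 0 ≤ ∑ i ∈ S, k i *
      ((ψ ((11 / 9 : ℝ) * slitMap (ρ * (w i : ℂ)))).re - (ψ 0).re) := by
    intro ρ hρ
    have hball : ∀ z ∈ Metric.closedBall (0 : ℂ) 1, ‖(ρ : ℂ) * z‖ < 1 := by
      intro z hz
      rw [norm_mul, Complex.norm_real, Real.norm_eq_abs, abs_of_pos hρ.1]
      have h3 : ‖z‖ ≤ 1 := by simpa using hz
      nlinarith [hρ.1, hρ.2, norm_nonneg z]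
    have hdiff : DiffContOnCl ℂ (fun z => ψ ((11 / 9 : ℝ) * slitMap (ρ * z)))
        (Metric.ball 0 1) := by
      refine DifferentiableOn.diffContOnCl ?_
      rw [closure_ball _ one_ne_zero]
      refine h.differentiableOn.comp (t := slitPlaneOf (11 / 9)) ?_ fun z hz =>
        mul_slitMap_mem hL (hball z hz)
      unfold slitMap
      refine DifferentiableOn.const_mul (DifferentiableOn.div (by fun_prop) (by fun_prop)
        fun z hz => one_add_sq_ne_zero (hball z hz)) _
    have := sum_mul_re_sub_nonneg S k w hdiff (fun i hi => (hw i hi).1) ?_ ?_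
    · simpa [slitMap] using this
    · intro z hz
      have hz' := hball z (Metric.sphere_subset_closedBall hz)
      have him : ((11 / 9 : ℝ) * slitMap (ρ * z) : ℂ).im = z.im * (11 / 9 * (2 * ρ *
          (1 - ‖(ρ : ℂ) * z‖ ^ 2) / Complex.normSq (1 + (ρ * z) ^ 2))) := by
        rw [Complex.im_ofReal_mul, slitMap_im, Complex.im_ofReal_mul]; ring
      have hpos : 0 < 11 / 9 * (2 * ρ *
          (1 - ‖(ρ : ℂ) * z‖ ^ 2) / Complex.normSq (1 + (ρ * z) ^ 2)) := by
        have h1 : 0 < Complex.normSq (1 + (ρ * z) ^ 2) :=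
          Complex.normSq_pos.2 (one_add_sq_ne_zero hz')
        have h2 : 0 < 1 - ‖(ρ : ℂ) * z‖ ^ 2 := by nlinarith [norm_nonneg ((ρ : ℂ) * z)]
        have := hρ.1
        positivity
      rcases lt_trichotomy z.im 0 with h0 | h0 | h0
      · exact mul_nonneg_of_nonpos_of_nonpos h0.le
          (h.im_neg _ (by rw [him]; exact mul_neg_of_neg_of_pos h0 hpos)).le
      · rw [h0, zero_mul]
      · exact mul_nonneg h0.le (h.im_pos _ (by rw [him]; exact mul_pos h0 hpos)).le
    · intro z hz
      have hre : z.re ∈ Icc (-1 : ℝ) 1 := by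
        have h2 : ‖z‖ = 1 := by simpa using hz
        exact abs_le.1 (h2 ▸ Complex.abs_re_le_norm z)
      refine (hk z.re hre).trans_eq (Finset.sum_congr rfl fun i hi => ?_)
      congr 1
      rw [← (hw i hi).2]
      have h1 : 1 + w i ^ 2 ≠ 0 := by positivity
      rw [show (11 / 9 : ℝ) - z.re * (11 / 9 * (2 * w i / (1 + w i ^ 2))) =
        11 / 9 * ((1 - 2 * w i * z.re + w i ^ 2) / (1 + w i ^ 2)) by field_simp; ring,
        mul_div_mul_left _ _ hL.ne', div_div_div_cancel_right₀ h1]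
  have hlim : Tendsto (fun ρ : ℝ => ∑ i ∈ S, k i *
      ((ψ ((11 / 9 : ℝ) * slitMap (ρ * (w i : ℂ)))).re - (ψ 0).re)) (𝓝[<] 1)
      (𝓝 (∑ i ∈ S, k i * (φ (x i) - φ 0))) := by
    refine tendsto_finsetSum _ fun i hi => ?_
    have h0 : (ψ 0).re = φ 0 := by
      have := h.ofReal 0 (by norm_num)
      rw [Complex.ofReal_zero] at this
      rw [this, Complex.ofReal_re]
    have hxi := abs_lt.1 (hx i hi)
    have hi1 : ψ (x i) = φ (x i) := h.ofReal _ hxi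
    refine Tendsto.const_mul _ ?_
    rw [h0]
    refine Tendsto.sub_const ?_ _
    have hval : ((11 / 9 : ℝ) : ℂ) * slitMap ((1 : ℝ) * (w i : ℂ)) = x i := by
      rw [Complex.ofReal_one, one_mul, slitMap_ofReal, ← Complex.ofReal_mul, (hw i hi).2]
    have hc1 : ContinuousAt ψ (x i) := (h.differentiableOn.differentiableAt
      ((isOpen_slitPlaneOf _).mem_nhds (Or.inr (by simpa using hxi)))).continuousAt
    have hc2 : ContinuousAt (fun ρ : ℝ => ((11 / 9 : ℝ) : ℂ) * slitMap (ρ * (w i : ℂ))) 1 := by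
      unfold slitMap
      refine ContinuousAt.mul continuousAt_const (ContinuousAt.div (by fun_prop) (by fun_prop) ?_)
      refine one_add_sq_ne_zero ?_
      simpa using (hw i hi).1
    have hc1' : ContinuousAt ψ
        ((fun ρ : ℝ => ((11 / 9 : ℝ) : ℂ) * slitMap (ρ * (w i : ℂ))) 1) := by
      change ContinuousAt ψ (((11 / 9 : ℝ) : ℂ) * slitMap ((1 : ℝ) * (w i : ℂ)))
      rwa [hval]
    have hc3 : ContinuousAt (fun ρ : ℝ => (ψ ((11 / 9 : ℝ) * slitMap (ρ * (w i : ℂ)))).re) 1 :=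
      Complex.continuous_re.continuousAt.comp (ContinuousAt.comp (g := ψ)
        (f := fun ρ : ℝ => ((11 / 9 : ℝ) : ℂ) * slitMap (ρ * (w i : ℂ))) hc1' hc2)
    have := hc3.tendsto
    rw [hval, hi1, Complex.ofReal_re] at this
    exact this.mono_left nhdsWithin_le_nhds
  refine ge_of_tendsto hlim ?_
  filter_upwards [Ioo_mem_nhdsLT (show (0:ℝ) < 1 by norm_num)] with ρ h using hρ ρ h

end

/-! ### The image of the left endpoint -/

/-- The combination of the kernels `x / (1 - s x)` at the nodes `-1`, `-m`, `1`, `6 / 5` with the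
weights for which it vanishes at `s = -9 / 11` and doubly at `s = t`. -/
theorem kernel_identity {m s t : ℝ} (hm : 0 < m) (h1 : 1 + s ≠ 0) (h2 : 1 + m * s ≠ 0)
    (h3 : 1 - s ≠ 0) (h4 : 1 - 6 / 5 * s ≠ 0) :
    5 / 99 * (1 + t) ^ 2 * (-1 / (1 + s)) +
      (m - 11 / 9) * (1 + m * t) ^ 2 / ((1 + m) * (m + 6 / 5) * m) * (-m / (1 + m * s)) +
      -(50 / 9 * (1 - m) * (1 - t) ^ 2 / (1 + m)) * (1 / (1 - s)) +
      218 / 33 * (1 - m) * (5 / 6 - t) ^ 2 / (m + 6 / 5) * (6 / 5 / (1 - 6 / 5 * s)) =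
    (1 - m) * (1 + 11 / 9 * s) * (s - t) ^ 2 /
      ((1 + s) * (1 + m * s) * (1 - s) * (1 - 6 / 5 * s)) := by
  have e1 : 1 + m ≠ 0 := by positivity
  have e2 : m + 6 / 5 ≠ 0 := by positivity
  have e4 : 5 - 6 * s ≠ 0 := fun h => h4 (by linarith)
  have e4' : 5 - s * 6 ≠ 0 := fun h => h4 (by linarith)
  have e5 : m * 5 + 6 ≠ 0 := by positivity
  have e6 : 1 + s * m ≠ 0 := by rwa [mul_comm s]
  field_simp
  ring

/-- The sum of the four weights is minus the weight of the value at `0`. -/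
theorem weight_identity {m t : ℝ} (hm : 0 < m) :
    5 / 99 * (1 + t) ^ 2 +
      (m - 11 / 9) * (1 + m * t) ^ 2 / ((1 + m) * (m + 6 / 5) * m) +
      -(50 / 9 * (1 - m) * (1 - t) ^ 2 / (1 + m)) +
      218 / 33 * (1 - m) * (5 / 6 - t) ^ 2 / (m + 6 / 5) = -(55 / 54 * (1 - m) / m) := by
  have e1 : 1 + m ≠ 0 := by positivity
  have e2 : m + 6 / 5 ≠ 0 := by positivity
  have e5 : m * 5 + 6 ≠ 0 := by positivity
  field_simp
  ring

/-- The bound obtained for `-φ (-1)` by the Pick inequality with `φ 0 ≤ m ^ 2`, `φ 1 = 1` and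
`φ (6 / 5) ≤ (6 / 5) ^ 2` is at most `23 / 20`, when the double zero of the kernel is at
`t = 3 / 10 + 14 m / 25`, which is near the optimal position. -/
theorem weight_estimate {m : ℝ} (h0 : 0 < m) (h1 : m ≤ 1) :
    -(50 / 9 * (1 - m) * (1 - (3 / 10 + 14 / 25 * m)) ^ 2 / (1 + m)) +
      218 / 33 * (1 - m) * (5 / 6 - (3 / 10 + 14 / 25 * m)) ^ 2 / (m + 6 / 5) * (36 / 25) +
      55 / 54 * (1 - m) * m ≤ 23 / 20 * (5 / 99 * (1 + (3 / 10 + 14 / 25 * m)) ^ 2) := by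
  have e1 : 0 < 1 + m := by positivity
  have e2 : 0 < m + 6 / 5 := by positivity
  rw [← sub_nonneg]
  have key : 23 / 20 * (5 / 99 * (1 + (3 / 10 + 14 / 25 * m)) ^ 2) -
      (-(50 / 9 * (1 - m) * (1 - (3 / 10 + 14 / 25 * m)) ^ 2 / (1 + m)) +
      218 / 33 * (1 - m) * (5 / 6 - (3 / 10 + 14 / 25 * m)) ^ 2 / (m + 6 / 5) * (36 / 25) +
      55 / 54 * (1 - m) * m) =
      ((1 + m) * (m + 6 / 5) * (23 / 20 * (5 / 99 * (1 + (3 / 10 + 14 / 25 * m)) ^ 2)) +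
       (m + 6 / 5) * (50 / 9 * (1 - m) * (1 - (3 / 10 + 14 / 25 * m)) ^ 2) -
       (1 + m) * (218 / 33 * (1 - m) * (5 / 6 - (3 / 10 + 14 / 25 * m)) ^ 2 * (36 / 25)) -
       (1 + m) * (m + 6 / 5) * (55 / 54 * (1 - m) * m)) / ((1 + m) * (m + 6 / 5)) := by
    have e5 : m * 5 + 6 ≠ 0 := by positivity
    field_simp
    ring
  rw [key]
  refine div_nonneg ?_ (by positivity)
  nlinarith [mul_nonneg h0.le (sq_nonneg (m - 33 / 50)), sq_nonneg (m - 33 / 50),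
    sq_nonneg (m * (m - 33 / 50)), mul_nonneg h0.le (sub_nonneg.2 h1)]

/-- The normalized inverse branch moves the endpoint `-1` of `V` at most slightly to the left. -/
theorem NormalizedBranch.neg_one {m : ℝ} {ψ : ℂ → ℂ} {φ : ℝ → ℝ} (h : NormalizedBranch m ψ φ) :
    -(23 / 20) ≤ φ (-1) := by
  have hm := h.m_pos
  rcases h.m_le.eq_or_lt with hm1 | hm1
  · -- the weights degenerate for `m = 1`, where `φ (-1) = 0`
    have := h.neg_m
    rw [hm1] at this
    rw [this]; norm_num
  set t := 3 / 10 + 14 / 25 * m with ht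
  have hsum := h.sum_nonneg (Finset.univ : Finset (Fin 4))
    ![5 / 99 * (1 + t) ^ 2, (m - 11 / 9) * (1 + m * t) ^ 2 / ((1 + m) * (m + 6 / 5) * m),
      -(50 / 9 * (1 - m) * (1 - t) ^ 2 / (1 + m)),
      218 / 33 * (1 - m) * (5 / 6 - t) ^ 2 / (m + 6 / 5)] ![-1, -m, 1, 6 / 5] ?_ ?_
  · simp only [Fin.sum_univ_four, Matrix.cons_val, h.neg_m, h.one] at hsum
    have hw := weight_identity (t := t) hm
    have hc := weight_estimate hm h.m_le
    rw [← ht] at hc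
    set k0 := 5 / 99 * (1 + t) ^ 2
    set k1 := (m - 11 / 9) * (1 + m * t) ^ 2 / ((1 + m) * (m + 6 / 5) * m)
    set k2 := -(50 / 9 * (1 - m) * (1 - t) ^ 2 / (1 + m))
    set k3 := 218 / 33 * (1 - m) * (5 / 6 - t) ^ 2 / (m + 6 / 5) with hk3
    have hk0 : 0 < k0 := by positivity
    have hk3' : 0 ≤ k3 := by
      have : 0 < 1 - m := by linarith
      positivity
    have h1 : k3 * φ (6 / 5) ≤ k3 * (36 / 25) :=
      mul_le_mul_of_nonneg_left ((h.lt_sq (6 / 5) (by norm_num)).le.trans (by norm_num)) hk3'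
    have h2 : 55 / 54 * (1 - m) / m * φ 0 ≤ 55 / 54 * (1 - m) * m := by
      have h3 : 0 ≤ 55 / 54 * (1 - m) / m := div_nonneg (by linarith) hm.le
      refine (mul_le_mul_of_nonneg_left h.zero_lt.le h3).trans_eq ?_
      field_simp
    have h4 : k1 = -(55 / 54 * (1 - m) / m) - k0 - k2 - k3 := by linarith
    rw [h4] at hsum
    refine le_of_mul_le_mul_left ?_ hk0
    linarith
  · intro i _
    have hma : |m| < 11 / 9 := by rw [abs_of_pos hm]; linarith
    fin_cases i <;> simp [abs_of_pos, hma] <;> norm_num [abs_of_pos]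
  · intro σ hσ
    simp only [Fin.sum_univ_four, Matrix.cons_val]
    obtain ⟨s, rfl⟩ : ∃ s, σ = 11 / 9 * s := ⟨9 / 11 * σ, by ring⟩
    have hs1 : -(9 / 11) ≤ s := by linarith [hσ.1]
    have hs2 : s ≤ 9 / 11 := by linarith [hσ.2]
    have d1 : 0 < 1 + s := by linarith
    have d2 : 0 < 1 + m * s := by nlinarith
    have d3 : 0 < 1 - s := by linarith
    have d4 : 0 < 1 - 6 / 5 * s := by linarith
    have e : ∀ x : ℝ, x / (11 / 9 - 11 / 9 * s * x) = 9 / 11 * (x / (1 - s * x)) := by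
      intro x
      rw [show (11 / 9 - 11 / 9 * s * x : ℝ) = 11 / 9 * (1 - s * x) by ring, ← div_div,
        div_right_comm]
      ring
    rw [e, e, e, e, show 1 - s * -1 = 1 + s by ring, show 1 - s * -m = 1 + m * s by ring,
      show 1 - s * 1 = 1 - s by ring, show 1 - s * (6 / 5) = 1 - 6 / 5 * s by ring]
    have hid := kernel_identity (t := t) hm d1.ne' d2.ne' d3.ne' d4.ne'
    have hpos : 0 ≤ (1 - m) * (1 + 11 / 9 * s) * (s - t) ^ 2 /
      ((1 + s) * (1 + m * s) * (1 - s) * (1 - 6 / 5 * s)) := by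
      have f1 : 0 < 1 - m := by linarith
      have f2 : 0 ≤ 1 + 11 / 9 * s := by linarith
      positivity
    rw [← hid] at hpos
    linarith

/-! ### The inclusion in normalized coordinates -/

/-- The set `Ω` for `V = [-1, 1]`, where `C` is the cotangent of the external angle. -/
def normOmega (C : ℝ) : Set ℂ :=
  {z | z.re ^ 2 + z.im ^ 2 - 1 < 2 * C * |z.im| ∨ z.re ^ 2 + z.im ^ 2 < 6 / 5 * |z.re|}

/-- The closed set obtained from `normOmega` by replacing strict by weak inequalities. -/
def closedNormOmega (C : ℝ) : Set ℂ :=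
  {z | z.re ^ 2 + z.im ^ 2 - 1 ≤ 2 * C * |z.im| ∨ z.re ^ 2 + z.im ^ 2 ≤ 6 / 5 * |z.re|}

theorem neg_mem_normOmega {C : ℝ} {z : ℂ} (h : -z ∈ normOmega C) : z ∈ normOmega C := by
  simpa [normOmega] using h

theorem closedNormOmega_subset (C : ℝ) {r : ℝ} (hr : 6 / 5 < r) :
    closedNormOmega C ⊆ slitPlaneOf r := by
  intro z hz
  by_cases him : z.im = 0
  · right
    have h1 : |z.re| ≤ 6 / 5 := by
      have h0 := abs_nonneg z.re
      rcases hz with h | h <;> rw [him, ← sq_abs] at h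
      · rw [abs_zero] at h
        nlinarith
      · nlinarith
    have := abs_le.1 h1
    constructor <;> linarith
  · exact Or.inl him

/-- The disc with the diameter `(0, 6 / 5)`: its image lies in the disc with the diameter
`(φ 0, φ (6 / 5))`, and the square root takes the latter into a disc with positive ends below
`6 / 5`. -/
theorem NormalizedBranch.mem_of_right {m : ℝ} {ψ : ℂ → ℂ} {φ : ℝ → ℝ}
    (h : NormalizedBranch m ψ φ) {C : ℝ} {w ζ : ℂ} (hw : w ∈ slitPlaneOf (11 / 9))
    (hζ : ζ ^ 2 = ψ w) (hmem : w ∈ _root_.closedNhd 0 0 (6 / 5)) : ζ ∈ normOmega C := by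
  have hm := h.m_pos
  have m0 : (0:ℝ) ∈ Ioo (-(11 / 9) : ℝ) (11 / 9) := by norm_num
  have m6 : (6 / 5 : ℝ) ∈ Ioo (-(11 / 9) : ℝ) (11 / 9) := by norm_num
  have h1 := h.closedNhd 0 le_rfl 0 m0 (6 / 5) m6 w hw hmem
  have hφ0 : 0 < φ 0 := by
    have := h.strictMonoOn (a := -m) ⟨by linarith [h.m_le], by linarith⟩ m0 (by linarith)
    rwa [h.neg_m] at this
  have hφ6 : φ 0 < φ (6 / 5) := h.strictMonoOn m0 m6 (by norm_num)
  have hlt := h.lt_sq (6 / 5) (by norm_num)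
  set P := √(φ 0)
  set Q := √(φ (6 / 5))
  have hP : 0 < P := Real.sqrt_pos.2 hφ0
  have hQ : 0 < Q := Real.sqrt_pos.2 (hφ0.trans hφ6)
  have hQ6 : Q < 6 / 5 := (Real.sqrt_lt' (by norm_num)).2 hlt
  have hPQ : P < Q := Real.sqrt_lt_sqrt hφ0.le hφ6
  rw [← Real.sq_sqrt hφ0.le, ← Real.sq_sqrt (hφ0.trans hφ6).le, ← hζ] at h1
  -- one of the two square roots lies in the right half-plane
  have main : ∀ ξ : ℂ, ξ ^ 2 ∈ _root_.closedNhd 0 (P ^ 2) (Q ^ 2) → 0 < ξ.re → ξ ∈ normOmega C := by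
    intro ξ hξ hre
    have h2 := sqrt_mem_closedNhd hP hQ hre hξ
    rw [mem_closedNhd] at h2
    right
    rw [abs_of_pos hre]
    have h3 : ξ.re ≤ Q := by
      by_contra! hcon
      nlinarith [sq_nonneg ξ.im, mul_pos (sub_pos.2 (hPQ.trans hcon)) (sub_pos.2 hcon)]
    have h4 : 0 < (6 / 5 - Q) * ξ.re := mul_pos (by linarith) hre
    have h5 : 0 ≤ P * (Q - ξ.re) := mul_nonneg hP.le (by linarith)
    nlinarith
  rcases lt_trichotomy ζ.re 0 with hre | hre | hre
  · refine neg_mem_normOmega (main (-ζ) (by rwa [neg_sq]) (by simpa using hre))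
  · exfalso
    rw [mem_closedNhd] at h1
    have e1 : (ζ ^ 2).re = -ζ.im ^ 2 := by simp [sq, hre]
    have e2 : (ζ ^ 2).im = 0 := by simp [sq, hre]
    rw [e1, e2] at h1
    simp only [zero_mul] at h1
    have : 0 < (ζ.im ^ 2 + P ^ 2) * (ζ.im ^ 2 + Q ^ 2) := by positivity
    nlinarith
  · exact main ζ h1 hre

/-- The disc with the diameter `(-6 / 5, 0)`: its image lies in the disc with the diameter
`(φ (-6 / 5), φ 0)`, whose radius is bounded, and the square roots of its points lie in the Poincaré
neighbourhood if the angle is small. -/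
theorem NormalizedBranch.mem_of_left {m : ℝ} {ψ : ℂ → ℂ} {φ : ℝ → ℝ}
    (h : NormalizedBranch m ψ φ) {C : ℝ} (hC : 10 ≤ C) {w ζ : ℂ} (hw : w ∈ slitPlaneOf (11 / 9))
    (hζ : ζ ^ 2 = ψ w) (hmem : w ∈ _root_.closedNhd 0 (-(6 / 5)) 0) : ζ ∈ normOmega C := by
  have hm := h.m_pos
  have hm1 := h.m_le
  have m0 : (0:ℝ) ∈ Ioo (-(11 / 9) : ℝ) (11 / 9) := by norm_num
  have m6 : (-(6 / 5) : ℝ) ∈ Ioo (-(11 / 9) : ℝ) (11 / 9) := by norm_num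
  have h1 := h.closedNhd 0 le_rfl _ m6 0 m0 w hw hmem
  have mm : -m ∈ Ioo (-(11 / 9) : ℝ) (11 / 9) := ⟨by linarith, by linarith⟩
  have hA : φ (-(6 / 5)) < 0 := by
    have := h.strictMonoOn m6 mm (by linarith)
    rwa [h.neg_m] at this
  have hφ0 : 0 < φ 0 := by
    have := h.strictMonoOn mm m0 (by linarith)
    rwa [h.neg_m] at this
  have hφ1 : φ 0 ≤ 1 := by have := h.zero_lt; nlinarith
  have hA22 := h.left
  rw [← hζ, mem_closedNhd] at h1
  have e1 : (ζ ^ 2).re = ζ.re ^ 2 - ζ.im ^ 2 := by simp [sq]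
  have e2 : (ζ ^ 2).im = 2 * ζ.re * ζ.im := by simp [sq]; ring
  rw [e1, e2] at h1
  obtain ⟨A, hAeq⟩ : ∃ A, φ (-(6 / 5)) = -A := ⟨_, (neg_neg _).symm⟩
  rw [hAeq] at h1 hA hA22
  set a := ζ.re
  set b := ζ.im
  have hb2 : |b| ^ 2 = b ^ 2 := sq_abs b
  have hbn := abs_nonneg b
  simp only [zero_mul] at h1
  have hX : 0 ≤ a ^ 2 - b ^ 2 + A := by
    by_contra! hcon
    nlinarith [sq_nonneg (2 * a * b)]
  have h2 : (a ^ 2 + b ^ 2 - 1) * (a ^ 2 + b ^ 2 + A) ≤ 2 * (A - 1) * b ^ 2 := by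
    nlinarith [mul_nonneg hX (sub_nonneg.2 hφ1)]
  by_contra hcon
  simp only [normOmega, mem_ofPred_eq, not_or, not_lt] at hcon
  obtain ⟨h3, h4⟩ := hcon
  change 2 * C * |b| ≤ a ^ 2 + b ^ 2 - 1 at h3
  change 6 / 5 * |a| ≤ a ^ 2 + b ^ 2 at h4
  set N := a ^ 2 + b ^ 2 with hN
  have hNA : 0 < N + A := by nlinarith [sq_nonneg a, sq_nonneg b]
  rcases hbn.eq_or_lt with hb0 | hb0
  · have hb : b = 0 := abs_eq_zero.1 hb0.symm
    rw [hb] at h2 hN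
    have hN1 : N ≤ 1 := by
      by_contra! hN1
      nlinarith [mul_pos (sub_pos.2 hN1) hNA]
    have hN1' : N = 1 := le_antisymm hN1 (by rw [hb, abs_zero] at h3; linarith)
    have : |a| = 1 := by
      rw [← sq_eq_sq₀ (abs_nonneg a) zero_le_one, sq_abs]; linarith
    rw [this, hN1'] at h4
    norm_num at h4
  · have h5 : 2 * C * |b| * (N + A) ≤ 2 * (A - 1) * |b| ^ 2 := by
      rw [hb2]; exact (mul_le_mul_of_nonneg_right h3 hNA.le).trans h2
    have h6 : C * (N + A) ≤ (A - 1) * |b| := by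
      refine le_of_mul_le_mul_left ?_ hb0
      linarith
    have h7 : 10 * (N + A) ≤ (A - 1) * |b| :=
      (mul_le_mul_of_nonneg_right hC hNA.le).trans h6
    have h8 : |b| ^ 2 ≤ N := by rw [hb2]; nlinarith [sq_nonneg a]
    nlinarith [sq_nonneg (|b| - 1), sq_nonneg (|b| - 2)]

/-- The Poincaré neighbourhood of `(-1, 1)`: its image lies in that of `(φ (-1), 1)`, which is not
much longer. Square roots that leave the Poincaré neighbourhood do so near `1` and `-1`, where they
are absorbed by the discs. -/
theorem NormalizedBranch.mem_of_center {m : ℝ} {ψ : ℂ → ℂ} {φ : ℝ → ℝ}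
    (h : NormalizedBranch m ψ φ) {C : ℝ} (hC : 10 ≤ C) {w ζ : ℂ} (hw : w ∈ slitPlaneOf (11 / 9))
    (hζ : ζ ^ 2 = ψ w) (hmem : w ∈ _root_.closedNhd C (-1) 1) : ζ ∈ normOmega C := by
  have hm := h.m_pos
  have hm1 := h.m_le
  have n1 : (1:ℝ) ∈ Ioo (-(11 / 9) : ℝ) (11 / 9) := by norm_num
  have n2 : (-1 : ℝ) ∈ Ioo (-(11 / 9) : ℝ) (11 / 9) := by norm_num
  have h1 := h.closedNhd C (by linarith) _ n2 1 n1 w hw hmem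
  have mm : -m ∈ Ioo (-(11 / 9) : ℝ) (11 / 9) := ⟨by linarith, by linarith⟩
  have hA : φ (-1) ≤ 0 := by
    have := h.strictMonoOn.monotoneOn n2 mm (by linarith)
    rwa [h.neg_m] at this
  have hA2 := h.neg_one
  rw [h.one, ← hζ, mem_closedNhd] at h1
  have e1 : (ζ ^ 2).re = ζ.re ^ 2 - ζ.im ^ 2 := by simp [sq]
  have e2 : (ζ ^ 2).im = 2 * ζ.re * ζ.im := by simp [sq]; ring
  obtain ⟨A, hAeq⟩ : ∃ A, φ (-1) = -A := ⟨_, (neg_neg _).symm⟩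
  rw [hAeq] at h1 hA hA2
  have hA0 : 0 ≤ A := by linarith
  rw [e1, e2, abs_mul, abs_mul, abs_two, abs_of_nonneg (show 0 ≤ 1 - -A by linarith)] at h1
  by_contra hcon
  simp only [normOmega, mem_ofPred_eq, not_or, not_lt] at hcon
  obtain ⟨h3, h4⟩ := hcon
  set a := ζ.re
  set b := ζ.im
  have ha2 : |a| ^ 2 = a ^ 2 := sq_abs a
  have hb2 : |b| ^ 2 = b ^ 2 := sq_abs b
  have hab2 : (2 * a * b) ^ 2 = 4 * |a| ^ 2 * |b| ^ 2 := by rw [ha2, hb2]; ring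
  have han := abs_nonneg a
  have hbn := abs_nonneg b
  rw [hab2, ← ha2, ← hb2] at h1
  rw [← ha2, ← hb2] at h3 h4
  generalize |a| = α at *
  generalize |b| = β at *
  obtain ⟨N, hN⟩ : ∃ N, N = α ^ 2 + β ^ 2 := ⟨_, rfl⟩
  rw [← hN] at h3 h4
  have h2 : (N - 1) * (N + A) ≤ 2 * (A - 1) * β ^ 2 + (1 + A) * α * (2 * C * β) := by
    rw [hN]; linarith
  have h5 : (1 + A) * α * (2 * C * β) ≤ (1 + A) * α * (N - 1) :=
    mul_le_mul_of_nonneg_left h3 (by positivity)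
  have hCβ : 20 * β ≤ N - 1 := by nlinarith
  have hN1 : 0 ≤ N - 1 := by linarith
  have h6 : 2 * (A - 1) * β ^ 2 ≤ 3 / 4000 * (N - 1) ^ 2 := by
    have h7 : (20 * β) ^ 2 ≤ (N - 1) ^ 2 := pow_le_pow_left₀ (by positivity) hCβ 2
    nlinarith [sq_nonneg β]
  -- the remaining factor is positive because `N` exceeds both `6 α / 5` and `α ^ 2`
  have h8 : 0 < (N + A - (1 + A) * α) - 3 / 4000 * (N - 1) := by
    have h9 : α ^ 2 ≤ N := by nlinarith [sq_nonneg β]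
    have h10 : 0 < 3997 / 4000 * N + 3 / 4000 - α ∨ α = 0 := by
      rcases han.eq_or_lt with h | h
      · exact Or.inr h.symm
      · left; linarith
    have h11 : 0 < 3997 / 4000 * N + 23 / 20 + 3 / 4000 - 43 / 20 * α := by
      rcases le_total α (6 / 5) with h | h
      · linarith
      · nlinarith
    have h12 : 0 < 3997 / 4000 * N + 3 / 4000 - α := by
      rcases h10 with h | h
      · exact h
      · rw [h]; linarith
    nlinarith [mul_nonneg hA0 h11.le, mul_nonneg (show 0 ≤ 23 / 20 - A by linarith) h12.le]
  rcases hN1.eq_or_lt with hN0 | hN0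
  · have hβ : β = 0 := by linarith
    rw [hβ] at hN
    have : α = 1 := by
      rw [← sq_eq_sq₀ han zero_le_one]; linarith
    rw [this] at h4
    linarith
  · have := mul_pos hN0 h8
    nlinarith

/-- All square roots of points of `ψ (Ω)`, boundary included, lie in `Ω`. -/
theorem NormalizedBranch.mem_normOmega {m : ℝ} {ψ : ℂ → ℂ} {φ : ℝ → ℝ}
    (h : NormalizedBranch m ψ φ) {C : ℝ} (hC : 10 ≤ C) {w ζ : ℂ} (hw : w ∈ closedNormOmega C)
    (hζ : ζ ^ 2 = ψ w) : ζ ∈ normOmega C := by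
  have hslit := closedNormOmega_subset C (by norm_num : (6 / 5 : ℝ) < 11 / 9) hw
  rcases hw with hw | hw
  · refine h.mem_of_center hC hslit hζ ?_
    rw [mem_closedNhd, show (1:ℝ) - -1 = 2 by norm_num, abs_two]
    linarith
  · rcases le_total 0 w.re with hre | hre
    · refine h.mem_of_right hslit hζ ?_
      rw [mem_closedNhd]
      rw [abs_of_nonneg hre] at hw
      linarith
    · refine h.mem_of_left hC hslit hζ ?_
      rw [mem_closedNhd]
      rw [abs_of_nonpos hre] at hw
      linarith

/-! ### The geometry of `Ω` -/

theorem mem_discStar_iff {a b : ℝ} (hab : a < b) {z : ℂ} :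
    z ∈ discStar a b ↔ (z.re - a) * (z.re - b) + z.im ^ 2 < 0 := by
  rw [discStar, Metric.mem_ball, ← sq_lt_sq₀ dist_nonneg (by linarith), Complex.dist_eq,
    Complex.sq_norm, Complex.normSq_apply, Complex.sub_re, Complex.sub_im, Complex.ofReal_re,
    Complex.ofReal_im]
  constructor <;> intro h <;> nlinarith

theorem mem_poincareNhd_iff {u θ : ℝ} (hu : 0 < u) (h0 : 0 < θ) (hpi : θ ≤ Real.pi / 2) {z : ℂ} :
    z ∈ poincareNhd (-u) u θ ↔
      z.re ^ 2 + z.im ^ 2 - u ^ 2 < 2 * (Real.cos θ / Real.sin θ) * u * |z.im| := by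
  have hs : 0 < Real.sin θ := Real.sin_pos_of_pos_of_lt_pi h0 (by linarith [Real.pi_pos])
  have hc : 0 ≤ Real.cos θ := Real.cos_nonneg_of_mem_Icc ⟨by linarith, hpi⟩
  set C := Real.cos θ / Real.sin θ with hC
  have hC0 : 0 ≤ C := div_nonneg hc hs.le
  have e : (u / Real.sin θ) ^ 2 = u ^ 2 + (u * C) ^ 2 := by
    rw [hC]
    field_simp
    rw [Real.sin_sq_add_cos_sq]
  have hR : 0 ≤ u / Real.sin θ := (div_pos hu hs).le
  have key : ∀ y : ℝ, z ∈ Metric.ball (⟨0, y⟩ : ℂ) (u / Real.sin θ) ↔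
      z.re ^ 2 + (z.im - y) ^ 2 < u ^ 2 + (u * C) ^ 2 := by
    intro y
    rw [Metric.mem_ball, ← sq_lt_sq₀ dist_nonneg hR, Complex.dist_eq,
      Complex.sq_norm, Complex.normSq_apply, Complex.sub_re, Complex.sub_im, e]
    simp only [sub_zero, sq]
  rw [poincareNhd, show (-u + u) / 2 = 0 by ring, show (u - -u) / 2 = u by ring, mem_union,
    key, key]
  have hCu : 0 ≤ C * u := mul_nonneg hC0 hu.le
  constructor
  · rintro (h | h)
    · nlinarith [mul_le_mul_of_nonneg_left (le_abs_self z.im) hCu]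
    · nlinarith [mul_le_mul_of_nonneg_left (neg_abs_le z.im) hCu]
  · intro h
    rcases abs_cases z.im with ⟨h1, -⟩ | ⟨h1, -⟩ <;> rw [h1] at h
    · left; linarith
    · right; linarith

theorem mem_Omega_iff {u θ : ℝ} (hu : 0 < u) (h0 : 0 < θ) (hpi : θ ≤ Real.pi / 2) {z : ℂ} :
    z ∈ Omega u θ ↔ z / u ∈ normOmega (Real.cos θ / Real.sin θ) := by
  have hre : z.re = u * (z / u).re := by rw [Complex.div_ofReal_re]; field_simp
  have him : z.im = u * (z / u).im := by rw [Complex.div_ofReal_im]; field_simp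
  have hu2 : 0 < u ^ 2 := by positivity
  have scale : ∀ a b : ℝ, u ^ 2 * a < u ^ 2 * b ↔ a < b := fun a b => mul_lt_mul_iff_right₀ hu2
  rw [Omega, mem_union, mem_union, mem_poincareNhd_iff hu h0 hpi, mem_discStar_iff (by linarith),
    mem_discStar_iff (by linarith), hre, him, abs_mul, abs_of_pos hu, or_assoc]
  generalize z / u = w
  refine or_congr ?_ ?_
  · rw [← scale (w.re ^ 2 + w.im ^ 2 - 1)]
    constructor <;> intro h <;> linarith
  · rw [← scale (w.re ^ 2 + w.im ^ 2)]
    constructor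
    · rintro (h | h)
      · nlinarith [le_abs_self w.re]
      · nlinarith [neg_abs_le w.re]
    · intro h
      rcases abs_cases w.re with ⟨h1, -⟩ | ⟨h1, -⟩ <;> rw [h1] at h
      · left; linarith
      · right; linarith

theorem isOpen_Omega (u θ : ℝ) : IsOpen (Omega u θ) :=
  ((Metric.isOpen_ball.union Metric.isOpen_ball).union Metric.isOpen_ball).union Metric.isOpen_ball

theorem isCompact_closure_Omega (u θ : ℝ) : IsCompact (closure (Omega u θ)) :=
  (((Metric.isBounded_ball.union Metric.isBounded_ball).union Metric.isBounded_ball).union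
    Metric.isBounded_ball).isCompact_closure

theorem isClosed_closedNormOmega (C : ℝ) : IsClosed (closedNormOmega C) := by
  have hre := Complex.continuous_re
  have him := Complex.continuous_im
  exact (isClosed_le (((hre.pow 2).add (him.pow 2)).sub continuous_const)
    (continuous_const.mul him.abs)).union
    (isClosed_le ((hre.pow 2).add (him.pow 2)) (continuous_const.mul hre.abs))

theorem normOmega_subset (C : ℝ) : normOmega C ⊆ closedNormOmega C :=
  fun _ h => h.imp le_of_lt le_of_lt

theorem closure_Omega_subset {u θ : ℝ} (hu : 0 < u) (h0 : 0 < θ) (hpi : θ ≤ Real.pi / 2) :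
    closure (Omega u θ) ⊆ {z | z / u ∈ closedNormOmega (Real.cos θ / Real.sin θ)} := by
  refine closure_minimal (fun z hz => normOmega_subset _ ((mem_Omega_iff hu h0 hpi).1 hz)) ?_
  exact (isClosed_closedNormOmega _).preimage (continuous_id.div_const _)

theorem sign_mul_mem_closedNormOmega {C ε : ℝ} (hε : ε = 1 ∨ ε = -1) {z : ℂ}
    (hz : z ∈ closedNormOmega C) : ε * z ∈ closedNormOmega C := by
  rcases hε with rfl | rfl
  · simpa using hz
  · simpa [closedNormOmega] using hz

/-- Angles below `1 / 20` have a cotangent of at least `10`, as required by the inclusion. -/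
theorem ten_le_cot {θ : ℝ} (h0 : 0 < θ) (h : θ < 1 / 20) : 10 ≤ Real.cos θ / Real.sin θ := by
  have hs : 0 < Real.sin θ :=
    Real.sin_pos_of_pos_of_lt_pi h0 (by linarith [Real.pi_gt_three])
  rw [le_div_iff₀ hs]
  have h1 := Real.sin_lt h0
  have h2 := Real.one_sub_sq_div_two_le_cos (x := θ)
  nlinarith

theorem ofReal_mem_normOmega (C : ℝ) {v : ℝ} (hv : |v| ≤ 1) : (v : ℂ) ∈ normOmega C := by
  by_cases h : |v| = 1
  · right
    simp only [Complex.ofReal_re, Complex.ofReal_im]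
    rw [← sq_abs v, h]; norm_num
  · left
    simp only [Complex.ofReal_re, Complex.ofReal_im, abs_zero]
    rw [← sq_abs v]
    nlinarith [lt_of_le_of_ne hv h, abs_nonneg v]

/-- The points of a segment from a point `v` of `[-1, 1]` to a point of the right half of `Ω`. -/
theorem segment_mem_normOmega {C v a b : ℝ} (hC : 10 ≤ C) (hv : |v| ≤ 1) {z : ℂ}
    (hz : z ∈ normOmega C) (hre : 0 ≤ z.re) (ha : 0 ≤ a) (hb : 0 < b) (hab : a + b = 1) :
    (a * v + b * z : ℂ) ∈ normOmega C := by
  obtain ⟨hv1, hv2⟩ := abs_le.1 hv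
  have er : (a * v + b * z : ℂ).re = a * v + b * z.re := by simp
  have ei : (a * v + b * z : ℂ).im = b * z.im := by simp
  have habs : |b * z.im| = b * |z.im| := by rw [abs_mul, abs_of_pos hb]
  have ea : a = 1 - b := by linarith
  have hb1 : b ≤ 1 := by linarith
  by_cases hD : z.re ^ 2 + z.im ^ 2 - 1 < 2 * C * |z.im|
  · -- `|·|² - 1` is convex and is nonpositive at `v`
    left
    rw [er, ei, habs]
    have h1 : (a * v + b * z.re) ^ 2 ≤ a + b * z.re ^ 2 := by
      rw [ea]
      nlinarith [mul_nonneg (mul_nonneg (ea ▸ ha) hb.le) (sq_nonneg (v - z.re)),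
        mul_nonneg (ea ▸ ha) (show 0 ≤ 1 - v ^ 2 by nlinarith)]
    have h2 : (b * z.im) ^ 2 ≤ b * z.im ^ 2 := by
      rw [mul_pow]
      exact mul_le_mul_of_nonneg_right (by nlinarith) (sq_nonneg _)
    have h3 := mul_lt_mul_of_pos_left hD hb
    nlinarith
  · have h' : z.re ^ 2 + z.im ^ 2 < 6 / 5 * z.re := by
      rcases hz with h | h
      · exact absurd h hD
      · rwa [abs_of_nonneg hre] at h
    push Not at hD
    rcases le_or_gt 0 v with hv0 | hv0
    · right
      have h1 : 0 ≤ a * v + b * z.re := by positivity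
      rw [er, ei, abs_of_nonneg h1]
      have h2 := mul_lt_mul_of_pos_left h' hb
      have h3 : (a * v + b * z.re) ^ 2 ≤ a * v ^ 2 + b * z.re ^ 2 := by
        rw [ea]
        nlinarith [mul_nonneg (mul_nonneg (ea ▸ ha) hb.le) (sq_nonneg (v - z.re))]
      have h4 : (b * z.im) ^ 2 ≤ b * z.im ^ 2 := by
        rw [mul_pow]
        exact mul_le_mul_of_nonneg_right (by nlinarith) (sq_nonneg _)
      have h5 : a * v ^ 2 ≤ a * (6 / 5 * v) := mul_le_mul_of_nonneg_left (by nlinarith) ha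
      nlinarith
    · -- outside the Poincaré neighbourhood the disc is a thin piece near its right end
      have him : 0 ≤ |z.im| := abs_nonneg _
      have h20 : 20 * |z.im| ≤ z.re ^ 2 + z.im ^ 2 - 1 :=
        (mul_le_mul_of_nonneg_right (by linarith) him).trans hD
      have hx : 5 / 6 < z.re := by nlinarith [sq_nonneg z.im]
      have hx2 : z.re < 6 / 5 := by nlinarith [sq_nonneg z.im]
      have hi : |z.im| ≤ 1 / 40 := by linarith
      have hi2 : z.im ^ 2 ≤ 1 / 1600 := by rw [← sq_abs]; nlinarith
      have hbi : (b * z.im) ^ 2 ≤ b * z.im ^ 2 := by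
        rw [mul_pow]
        exact mul_le_mul_of_nonneg_right (by nlinarith) (sq_nonneg _)
      have hbi' : (b * z.im) ^ 2 ≤ z.im ^ 2 := hbi.trans (by nlinarith [sq_nonneg z.im])
      have hpos : 0 ≤ 2 * C * |b * z.im| := by positivity
      have hXx : a * v + b * z.re ≤ z.re := by nlinarith
      have hXl : -a + 5 / 6 * b ≤ a * v + b * z.re := by nlinarith
      obtain ⟨X, hX⟩ : ∃ X, X = a * v + b * z.re := ⟨_, rfl⟩
      rcases le_or_gt X 0 with hX0 | hX0
      · left
        rw [er, ei, ← hX]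
        rw [← hX] at hXl
        have h1 : 0 ≤ -X * (1 + X) := mul_nonneg (by linarith) (by linarith)
        have h2 := mul_le_mul_of_nonneg_left hi2 hb.le
        linarith
      · rcases le_or_gt X (9 / 10) with hX9 | hX9
        · left
          rw [er, ei, ← hX]
          have h1 : X ^ 2 ≤ (9 / 10) ^ 2 := pow_le_pow_left₀ hX0.le hX9 2
          linarith
        · right
          rw [er, ei, ← hX, abs_of_pos hX0]
          rw [← hX] at hXx
          have h1 := mul_nonneg (sub_nonneg.2 hX9.le) (sub_nonneg.2 hXx)
          have h2 : 0 ≤ (z.re - X) * (z.re - 3 / 10) :=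
            mul_nonneg (sub_nonneg.2 hXx) (by linarith)
          linarith

theorem starConvex_normOmega {C v : ℝ} (hC : 10 ≤ C) (hv : |v| ≤ 1) :
    StarConvex ℝ (v : ℂ) (normOmega C) := by
  intro z hz a b ha hb hab
  rw [Complex.real_smul, Complex.real_smul]
  rcases hb.eq_or_lt with rfl | hb
  · have : a = 1 := by linarith
    subst this
    simpa using ofReal_mem_normOmega C hv
  rcases le_total 0 z.re with hre | hre
  · exact segment_mem_normOmega hC hv hz hre ha hb hab
  · have hz' : -z ∈ normOmega C := neg_mem_normOmega (by rwa [neg_neg])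
    have := segment_mem_normOmega (v := -v) hC (by rwa [abs_neg]) hz' (by simpa using hre)
      ha hb hab
    refine neg_mem_normOmega ?_
    convert this using 1
    push_cast; ring

theorem starConvex_Omega {u θ v : ℝ} (hu : 0 < u) (h0 : 0 < θ) (hθ : θ < 1 / 20)
    (hv : |v| ≤ u) : StarConvex ℝ (v : ℂ) (Omega u θ) := by
  have hpi : θ ≤ Real.pi / 2 := by linarith [Real.pi_gt_three]
  intro z hz a b ha hb hab
  rw [mem_Omega_iff hu h0 hpi] at hz ⊢
  have hv' : |v / u| ≤ 1 := by rw [abs_div, abs_of_pos hu]; exact (div_le_one hu).2 hv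
  have := starConvex_normOmega (ten_le_cot h0 hθ) hv' hz ha hb hab
  convert this using 1
  simp only [Complex.real_smul]
  push_cast; ring

theorem ofReal_mem_Omega {u θ v : ℝ} (hu : 0 < u) (h0 : 0 < θ) (hpi : θ ≤ Real.pi / 2)
    (hv : |v| ≤ u) : (v : ℂ) ∈ Omega u θ := by
  rw [mem_Omega_iff hu h0 hpi, ← Complex.ofReal_div]
  refine ofReal_mem_normOmega _ ?_
  rw [abs_div, abs_of_pos hu]
  exact (div_le_one hu).2 hv

section

open scoped unitInterval Topology

/-! ### Pulling back by the quadratic map -/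

theorem differentiable_quadC_iterate (c : ℝ) (n : ℕ) : Differentiable ℂ (quadC c)^[n] := by
  induction n with
  | zero => exact differentiable_id
  | succ n ih =>
    rw [Function.iterate_succ]
    exact ih.comp ((differentiable_id.pow 2).add_const _)

theorem continuous_quadC (c : ℝ) : Continuous (quadC c) :=
  (continuous_id.pow 2).add continuous_const

/-- The full preimage of a compact set is bounded, being the preimage under a polynomial. -/
theorem isCompact_preimage_quadC (c : ℝ) {K : Set ℂ} (hK : IsCompact K) :
    IsCompact (quadC c ⁻¹' K) := by
  refine Metric.isCompact_of_isClosed_isBounded (hK.isClosed.preimage (continuous_quadC c)) ?_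
  obtain ⟨R, hR⟩ := hK.isBounded.exists_norm_le
  refine (Metric.isBounded_closedBall (x := (0 : ℂ)) (r := R + |c| + 1)).subset fun z hz => ?_
  have h1 := hR _ hz
  have h2 : ‖z‖ ^ 2 ≤ R + |c| := by
    have : z ^ 2 = quadC c z - c := by simp [quadC]
    rw [← norm_pow, this]
    refine (norm_sub_le _ _).trans ?_
    rw [Complex.norm_real, Real.norm_eq_abs]
    linarith
  rw [mem_closedBall_zero_iff]
  nlinarith [norm_nonneg z, sq_nonneg (‖z‖ - 1)]

/-- The double cover of a star-shaped domain, branched over its centre, is contractible: the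
contraction of the domain to its centre lifts. -/
theorem isSimplyConnected_preimage_quadC {c : ℝ} {U : Set ℂ} {v : ℂ} {F g : ℂ → ℂ}
    (hU : IsOpen U) (hstar : StarConvex ℝ v U) (hv : v ∈ U) (hF : DifferentiableOn ℂ F U)
    (hg : Continuous g) (hinv : ∀ w ∈ U, g (F w) = w) (hFv : F v = c) (hF' : deriv F v ≠ 0) :
    IsSimplyConnected (quadC c ⁻¹' (F '' U)) := by
  have hUsc : IsSimplyConnected U := by
    have : ContractibleSpace U := hstar.contractibleSpace ⟨v, hv⟩
    exact SimplyConnectedSpace.ofContractible U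
  have hK : ContinuousOn (dslope F v) U :=
    (continuousOn_dslope (hU.mem_nhds hv)).2
      ⟨hF.continuousOn, hF.differentiableAt (hU.mem_nhds hv)⟩
  have hK0 : ∀ w ∈ U, dslope F v w ≠ 0 := by
    intro w hw
    by_cases hwv : w = v
    · rw [hwv, dslope_same]; exact hF'
    · rw [dslope_of_ne _ hwv, slope_def_field]
      refine div_ne_zero (sub_ne_zero.2 fun h => hwv ?_) (sub_ne_zero.2 hwv)
      rw [← hinv w hw, h, hinv v hv]
  have hKF : ∀ w, F w - c = (w - v) * dslope F v w := by
    intro w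
    rw [← hFv, ← smul_eq_mul, sub_smul_dslope]
  obtain ⟨κ, hκ, hκ2⟩ := Complex.exists_continuousOn_pow_eq hUsc hU hK
    (by rintro ⟨w, hw, h⟩; exact hK0 w hw h) two_ne_zero
  have hκ0 : ∀ w ∈ U, κ w ≠ 0 := fun w hw h => hK0 w hw (by rw [← hκ2, h, zero_pow two_ne_zero])
  set X := quadC c ⁻¹' (F '' U) with hX
  have hπ : ∀ z : X, g (quadC c z) ∈ U ∧ F (g (quadC c z)) = quadC c z := by
    rintro ⟨z, w, hw, hz⟩
    simp only [← hz, hinv w hw, hw, and_self]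
  let h : I × X → ℂ := fun p => v + ((p.1 : ℝ) : ℂ) * (g (quadC c p.2) - v)
  have hh : ∀ p, h p ∈ U := fun p => by
    have := hstar.add_smul_sub_mem (hπ p.2).1 p.1.2.1 p.1.2.2
    rwa [Complex.real_smul] at this
  have hhc : Continuous h := by
    have := continuous_quadC c
    fun_prop
  let H : I × X → ℂ := fun p =>
    p.2 * ((√(p.1 : ℝ) : ℝ) : ℂ) * (κ (h p) / κ (g (quadC c p.2)))
  have hHc : Continuous H := by
    have h1 : Continuous fun p => κ (h p) := hκ.comp_continuous hhc hh
    have h2 : Continuous fun p : I × X => κ (g (quadC c p.2)) :=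
      hκ.comp_continuous (by have := continuous_quadC c; fun_prop) fun p => (hπ p.2).1
    refine Continuous.mul ?_ (h1.div h2 fun p => hκ0 _ (hπ p.2).1)
    fun_prop
  have hH2 : ∀ p, quadC c (H p) = F (h p) := by
    intro p
    have h1 := hKF (g (quadC c p.2))
    rw [(hπ p.2).2] at h1
    have h2 := hKF (h p)
    have h3 : (((√(p.1 : ℝ) : ℝ) : ℂ)) ^ 2 = ((p.1 : ℝ) : ℂ) := by
      rw [← Complex.ofReal_pow, Real.sq_sqrt p.1.2.1]
    have h4 : H p ^ 2 = F (h p) - c := by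
      simp only [H]
      rw [mul_pow, mul_pow, div_pow, h3, hκ2, hκ2, h2]
      have h5 := hK0 _ (hπ p.2).1
      rw [show (p.2 : ℂ) ^ 2 = quadC c p.2 - c by rw [quadC, add_sub_cancel_right], h1]
      simp only [h, add_sub_cancel_left]
      field_simp
    rw [quadC, h4]; ring
  let Hc : C(I × X, X) :=
    ⟨fun p => ⟨H p, h p, hh p, (hH2 p).symm⟩, hHc.subtype_mk _⟩
  have hcontr : ContractibleSpace X := by
    rw [contractible_iff_id_nullhomotopic]
    refine ⟨⟨0, v, hv, by rw [hFv]; simp [quadC]⟩, ContinuousMap.Homotopic.symm ⟨⟨Hc, ?_, ?_⟩⟩⟩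
    · intro x
      apply Subtype.ext
      simp [Hc, H]
    · intro x
      apply Subtype.ext
      have := hκ0 _ (hπ x).1
      simp [Hc, H, h, this]
  exact SimplyConnectedSpace.ofContractible X

/-- A full quadratic preimage of a univalent pull-back of a star-shaped domain is the domain of
a polynomial-like map of degree two as soon as it is relatively compact in the domain. -/
theorem isPolynomialLike_of_inverseBranch {c : ℝ} {n : ℕ} {U W : Set ℂ} {v : ℂ} {F : ℂ → ℂ}
    (hU : IsOpen U) (hstar : StarConvex ℝ v U) (hv : v ∈ U) (hW : IsOpen W)
    (hUW : closure U ⊆ W) (hcomp : IsCompact (closure U)) (hF : DifferentiableOn ℂ F W)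
    (hinv : ∀ w ∈ W, (quadC c)^[n] (F w) = w) (hFv : F v = c)
    (hincl : quadC c ⁻¹' (F '' closure U) ⊆ U) :
    IsPolynomialLike (quadC c)^[n + 1] (quadC c ⁻¹' (F '' U)) U 2 := by
  have hUW' : U ⊆ W := subset_closure.trans hUW
  set g := (quadC c)^[n] with hg
  have hgd : Differentiable ℂ g := differentiable_quadC_iterate c n
  have hfs : ∀ z, (quadC c)^[n + 1] z = g (quadC c z) := fun z => Function.iterate_succ_apply _ _ _
  -- the chain rule for `g ∘ F = id`
  have hderiv : ∀ w ∈ W, deriv g (F w) * deriv F w = 1 := by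
    intro w hw
    have h1 := (hgd (F w)).hasDerivAt.comp w (hF.differentiableAt (hW.mem_nhds hw)).hasDerivAt
    have h2 : (g ∘ F) =ᶠ[𝓝 w] id := by
      filter_upwards [hW.mem_nhds hw] with y hy using hinv y hy
    exact h1.unique ((hasDerivAt_id w).congr_of_eventuallyEq h2)
  have hF' : ∀ w ∈ W, deriv F w ≠ 0 := fun w hw => right_ne_zero_of_mul_eq_one (hderiv w hw)
  have hg' : ∀ w ∈ W, deriv g (F w) ≠ 0 := fun w hw => left_ne_zero_of_mul_eq_one (hderiv w hw)
  have hmem : ∀ z, ∀ S ⊆ W, z ∈ quadC c ⁻¹' (F '' S) →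
      g (quadC c z) ∈ S ∧ F (g (quadC c z)) = quadC c z := by
    rintro z S hS ⟨w, hw, hz⟩
    simp only [← hz, hinv w (hS hw), hw, and_self]
  have hclos : closure (quadC c ⁻¹' (F '' U)) ⊆ quadC c ⁻¹' (F '' closure U) := by
    refine closure_minimal (preimage_mono (image_mono subset_closure)) ?_
    exact (hcomp.image_of_continuousOn (hF.continuousOn.mono hUW)).isClosed.preimage
      (continuous_quadC c)
  have hfibre : ∀ w ∈ U, quadC c ⁻¹' (F '' U) ∩ (quadC c)^[n + 1] ⁻¹' {w} =
      {z | z ^ 2 = F w - c} := by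
    intro w hw
    ext z
    have e : z ^ 2 = F w - c ↔ quadC c z = F w := by rw [quadC, eq_sub_iff_add_eq]
    rw [mem_ofPred_eq, e]
    constructor
    · rintro ⟨h1, h2⟩
      rw [mem_preimage, hfs, mem_singleton_iff] at h2
      rw [← (hmem z U hUW' h1).2, h2]
    · intro h
      refine ⟨⟨w, hw, h.symm⟩, ?_⟩
      rw [mem_preimage, hfs, h, hinv w (hUW' hw), mem_singleton_iff]
  have hpair : ∀ w, ∃ ζ : ℂ, ζ ^ 2 = F w - c ∧ {z | z ^ 2 = F w - c} = {ζ, -ζ} := by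
    intro w
    obtain ⟨ζ, hζ⟩ := IsAlgClosed.exists_pow_nat_eq (F w - c) two_pos
    refine ⟨ζ, hζ, ?_⟩
    ext z
    rw [mem_ofPred_eq, ← hζ, sq_eq_sq_iff_eq_or_eq_neg]
    rfl
  have hpd : ∀ z, HasDerivAt (quadC c) (2 * z) z := by
    intro z
    have := (hasDerivAt_pow 2 z).add_const (c : ℂ)
    rwa [Nat.cast_ofNat, Nat.add_one_sub_one, pow_one] at this
  have horder : ∀ w ∈ U, ∀ z, z ^ 2 = F w - c →
      analyticOrderNatAt (fun y => (quadC c)^[n + 1] y - w) z = if z = 0 then 2 else 1 := by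
    intro w hw z hz
    have hz' : quadC c z = F w := by rw [quadC, hz]; ring
    have hpa : AnalyticAt ℂ (quadC c) z :=
      (analyticAt_id.pow 2).add analyticAt_const
    have hga : AnalyticAt ℂ g (quadC c z) := hgd.analyticAt _
    have h1 : analyticOrderAt (fun y => g y - w) (quadC c z) = 1 := by
      have := hga.analyticOrderAt_sub_eq_one_of_deriv_ne_zero (by rw [hz']; exact hg' w (hUW' hw))
      rwa [show g (quadC c z) = w by rw [hz', hinv w (hUW' hw)]] at this
    have h2 : analyticOrderAt (fun y => quadC c y - quadC c z) z = if z = 0 then 2 else 1 := by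
      split_ifs with h0
      · have e : (fun y => quadC c y - quadC c z) = id ^ 2 := by
          ext y; simp [quadC, h0]
        rw [e, analyticOrderAt_pow analyticAt_id, h0, analyticOrderAt_id]
        rfl
      · exact hpa.analyticOrderAt_sub_eq_one_of_deriv_ne_zero (by
          rw [(hpd z).deriv]; exact mul_ne_zero two_ne_zero h0)
    have h3 := AnalyticAt.analyticOrderAt_comp (f := fun y => g y - w)
      (hga.sub analyticAt_const) hpa
    rw [h1, h2, one_mul] at h3
    have e : (fun y => (quadC c)^[n + 1] y - w) = (fun y => g y - w) ∘ quadC c := by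
      ext y; simp [hfs]
    rw [analyticOrderNatAt, e, h3]
    split_ifs <;> rfl
  refine ⟨?_, hU, ?_, ?_, ?_, hclos.trans hincl, ?_, ?_, ?_, ?_, ?_⟩
  · refine IsOpen.preimage (continuous_quadC c) (isOpen_iff_mem_nhds.2 ?_)
    rintro _ ⟨w, hw, rfl⟩
    have hs : HasStrictDerivAt F (deriv F w) w :=
      (hF.analyticAt (hW.mem_nhds (hUW' hw))).hasStrictDerivAt
    rw [← hs.map_nhds_eq (hF' w (hUW' hw))]
    exact Filter.image_mem_map (hU.mem_nhds hw)
  · exact isSimplyConnected_preimage_quadC hU hstar hv (hF.mono hUW') hgd.continuous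
      (fun w hw => hinv w (hUW' hw)) hFv (hF' v (hUW' hv))
  · have : ContractibleSpace U := hstar.contractibleSpace ⟨v, hv⟩
    exact SimplyConnectedSpace.ofContractible U
  · exact hcomp.of_isClosed_subset isClosed_closure
      ((hclos.trans hincl).trans subset_closure)
  · exact (differentiable_quadC_iterate c (n + 1)).differentiableOn
  · intro z hz
    rw [hfs]
    exact (hmem z U hUW' hz).1
  · intro K hKU hK
    have e : quadC c ⁻¹' (F '' U) ∩ (quadC c)^[n + 1] ⁻¹' K = quadC c ⁻¹' (F '' K) := by
      ext z
      constructor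
      · rintro ⟨h1, h2⟩
        rw [mem_preimage, hfs] at h2
        exact ⟨_, h2, (hmem z U hUW' h1).2⟩
      · intro h
        refine ⟨preimage_mono (image_mono hKU) h, ?_⟩
        rw [mem_preimage, hfs]
        exact (hmem z K (hKU.trans hUW') h).1
    rw [e]
    exact isCompact_preimage_quadC c
      (hK.image_of_continuousOn (hF.continuousOn.mono (hKU.trans hUW')))
  · intro w hw
    obtain ⟨ζ, -, h⟩ := hpair w
    rw [hfibre w hw, h]
    exact Set.toFinite _
  · intro w hw
    obtain ⟨ζ, hζ, h⟩ := hpair w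
    rw [hfibre w hw, h]
    have o1 := horder w hw ζ hζ
    have o2 := horder w hw (-ζ) (by rw [neg_sq, hζ])
    by_cases h0 : ζ = 0
    · rw [if_pos h0] at o1
      rw [h0, neg_zero, pair_eq_singleton, finsum_mem_singleton, ← h0, o1]
    · rw [if_neg h0] at o1
      rw [if_neg (neg_ne_zero.2 h0)] at o2
      rw [finsum_mem_pair (self_ne_neg.2 h0), o1, o2]

end

section

open scoped Topology

/-! ### Uniqueness of the inverse branch -/

theorem quadC_iterate_ofReal (c : ℝ) (n : ℕ) (x : ℝ) :
    (quadC c)^[n] x = ((quad c)^[n] x : ℝ) := by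
  induction n with
  | zero => rfl
  | succ n ih =>
    rw [Function.iterate_succ_apply', Function.iterate_succ_apply', ih, quadC, quad]
    push_cast
    rfl

theorem slitPlaneOf_mono {M M' : ℝ} (h : M ≤ M') : slitPlaneOf M ⊆ slitPlaneOf M' :=
  fun _ hz => hz.imp id fun h1 => ⟨(neg_le_neg h).trans_lt h1.1, h1.2.trans_le h⟩

theorem isPreconnected_slitPlaneOf {M : ℝ} (hM : 0 < M) : IsPreconnected (slitPlaneOf M) := by
  have h0 : (0 : ℂ) ∈ slitPlaneOf M := Or.inr ⟨by simpa using hM, by simpa using hM⟩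
  have hstar : StarConvex ℝ (0 : ℂ) (slitPlaneOf M) := by
    intro z hz a b ha hb hab
    rw [smul_zero, zero_add, Complex.real_smul]
    rcases hb.eq_or_lt with rfl | hb
    · simpa using h0
    rcases hz with hz | hz
    · left
      rw [Complex.im_ofReal_mul]
      exact mul_ne_zero hb.ne' hz
    · right
      rw [Complex.re_ofReal_mul]
      have hz1 : |z.re| < M := abs_lt.2 hz
      refine abs_lt.1 ?_
      rw [abs_mul, abs_of_pos hb]
      nlinarith [abs_nonneg z.re]
  exact (hstar.isPathConnected h0).isConnected.isPreconnected

/-- Two inverse branches with a common real value agree near it, because `f^(s-1)` is univalent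
near the critical value; hence they agree on the smaller of the two slit planes. -/
theorem IsInverseBranch.eqOn {c M M' v : ℝ} {s : ℕ} {F F' : ℂ → ℂ} (h : IsInverseBranch c s M F)
    (h' : IsInverseBranch c s M' F') (hM : M ≤ M') (hv : (quadC c)^[s] 0 = (v : ℂ))
    (hvM : |v| < M) : EqOn F F' (slitPlaneOf M) := by
  have hvm : (v : ℂ) ∈ slitPlaneOf M := Or.inr (by simpa using abs_lt.1 hvM)
  have hvm' := slitPlaneOf_mono hM hvm
  have hd := h.differentiableOn
  have hd' := h'.differentiableOn
  have hn := (isOpen_slitPlaneOf M).mem_nhds hvm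
  have hn' := (isOpen_slitPlaneOf M').mem_nhds hvm'
  have hF : F v = c := by rw [← hv]; exact h.apply_critical
  have hF' : F' v = c := by rw [← hv]; exact h'.apply_critical
  have hg := differentiable_quadC_iterate c (s - 1)
  have hne : deriv (quadC c)^[s - 1] c ≠ 0 := by
    have h1 := (hg (F v)).hasDerivAt.comp (v : ℂ) (hd.differentiableAt hn).hasDerivAt
    have h2 : ((quadC c)^[s - 1] ∘ F) =ᶠ[𝓝 (v : ℂ)] id := by
      filter_upwards [hn] with y hy using h.right_inv y hy
    have h3 := h1.unique ((hasDerivAt_id _).congr_of_eventuallyEq h2)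
    rw [hF] at h3
    exact left_ne_zero_of_mul_eq_one h3
  have hloc := ((hg.analyticAt (c : ℂ)).hasStrictDerivAt).eventually_left_inverse hne
  have key : F =ᶠ[𝓝 (v : ℂ)] F' := by
    have t1 := (hd.differentiableAt hn).continuousAt.tendsto
    have t2 := (hd'.differentiableAt hn').continuousAt.tendsto
    rw [hF] at t1
    rw [hF'] at t2
    filter_upwards [t1.eventually hloc, t2.eventually hloc, hn, hn'] with w e1 e2 m1 m2
    rw [← e1, ← e2, h.right_inv w m1, h'.right_inv w m2]
  refine AnalyticOnNhd.eqOn_of_preconnected_of_eventuallyEq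
    (hd.analyticOnNhd (isOpen_slitPlaneOf M))
    ((hd'.mono (slitPlaneOf_mono hM)).analyticOnNhd (isOpen_slitPlaneOf M))
    (isPreconnected_slitPlaneOf ((abs_nonneg v).trans_lt hvM)) hvm key

/-- The inverse branch in the original coordinates. -/
theorem NormalizedBranch.isInverseBranch {m : ℝ} {ψ : ℂ → ℂ} {φ : ℝ → ℝ} {c u ε : ℝ} {s : ℕ}
    (h : NormalizedBranch m ψ φ) (hu : 0 < u) (hε : ε = 1 ∨ ε = -1)
    (hm : ε * (quad c)^[s] 0 = -(m * u))
    (hinv : ∀ w ∈ slitPlaneOf (11 / 9), (quadC c)^[s - 1] (c + u ^ 2 * ψ w) = ε * u * w) :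
    IsInverseBranch c s (11 / 9 * u) fun z => c + u ^ 2 * ψ ((ε / u : ℝ) * z) := by
  have hdom : ∀ z ∈ slitPlaneOf (11 / 9 * u), ((ε / u : ℝ) * z : ℂ) ∈ slitPlaneOf (11 / 9) := by
    have hne : ε / u ≠ 0 := by rcases hε with rfl | rfl <;> simp [hu.ne']
    intro z hz
    rcases hz with hz | hz
    · left
      rw [Complex.im_ofReal_mul]
      exact mul_ne_zero hne hz
    · right
      rw [Complex.re_ofReal_mul]
      refine abs_lt.1 ?_
      have h1 : |ε| = 1 := by rcases hε with rfl | rfl <;> simp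
      rw [abs_mul, abs_div, h1, abs_of_pos hu, one_div_mul_eq_div, div_lt_iff₀ hu]
      exact abs_lt.2 hz
  have hεε : ε * ε = 1 := by rcases hε with rfl | rfl <;> norm_num
  refine ⟨?_, ?_, ?_⟩
  · refine DifferentiableOn.const_add _ (DifferentiableOn.const_mul ?_ _)
    exact h.differentiableOn.comp
      (fun z _ => (differentiableAt_id.const_mul _).differentiableWithinAt) hdom
  · intro z hz
    rw [hinv _ (hdom z hz)]
    have hu' : (u : ℂ) ≠ 0 := by exact_mod_cast hu.ne'
    have hεε' : (ε : ℂ) * ε = 1 := by exact_mod_cast hεε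
    push_cast
    field_simp
    linear_combination z * hεε'
  · have e : ((ε / u : ℝ) * (quadC c)^[s] 0 : ℂ) = ((-m : ℝ) : ℂ) := by
      rw [← Complex.ofReal_zero, quadC_iterate_ofReal, ← Complex.ofReal_mul, div_mul_eq_mul_div, hm]
      congr 1
      field_simp
    rw [e, h.ofReal _ ⟨by linarith [h.m_le], by linarith [h.m_pos]⟩, h.neg_m]
    simp

end

end

/-! ### The polynomial-like return map -/

theorem mainTheorem6 :
    ∃ θ₀ : ℝ, 0 < θ₀ ∧ θ₀ ≤ Real.pi / 2 ∧
      ∀ (c₁ u : ℝ) (s : ℕ),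
        IsInfinitelyRenormalizable c₁ ∨ AllPeriodicRepelling c₁ →
        IsPeriodicInterval c₁ u s →
        (∀ r : ℕ, s = 2 * r → ¬ IsRenormalizable c₁ r) →
        (∃ M : ℝ, 6 / 5 * u < M ∧ ∃ F : ℂ → ℂ, IsInverseBranch c₁ s M F) ∧
        ∀ (M : ℝ) (F : ℂ → ℂ), 6 / 5 * u < M → IsInverseBranch c₁ s M F →
          ∀ θ : ℝ, 0 < θ → θ < θ₀ →
            quadC c₁ ⁻¹' (F '' frontier (Omega u θ)) ⊆ Omega u θ ∧
            IsPolynomialLike (quadC c₁)^[s]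
              (quadC c₁ ⁻¹' (F '' Omega u θ)) (Omega u θ) 2 := by
  refine ⟨1 / 20, by norm_num, by linarith [Real.pi_gt_three], ?_⟩
  intro c u s hc hV _
  have hr : AllPeriodicRepelling c := hc.elim allPeriodicRepelling_of_isInfinitelyRenormalizable id
  obtain ⟨ε, hR⟩ := hV.exists_sign hr
  have hu := hV.pos
  obtain ⟨m, ψ, φ, hψ, hm, hinv⟩ := hR.exists_normalizedBranch
  have hF₀ := hψ.isInverseBranch hu hR.sign hm hinv
  refine ⟨⟨11 / 9 * u, by linarith, _, hF₀⟩, ?_⟩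
  intro M F hM hF θ h0 hθ
  have hpi : θ ≤ Real.pi / 2 := by linarith [Real.pi_gt_three]
  set v := (quad c)^[s] 0
  have hv : (quadC c)^[s] 0 = (v : ℂ) := by rw [← Complex.ofReal_zero, quadC_iterate_ofReal]
  have hvu : |v| ≤ u := by
    have h1 := congrArg abs hm
    rw [abs_mul, hR.abs_sign, one_mul, abs_neg, abs_of_pos (mul_pos hψ.m_pos hu)] at h1
    rw [h1]
    nlinarith [hψ.m_le]
  have hcl := closure_Omega_subset hu h0 hpi
  have hslit : ∀ {r : ℝ}, 6 / 5 * u < r → closure (Omega u θ) ⊆ slitPlaneOf r := by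
    intro r hr z hz
    have hr' : 6 / 5 < r / u := (lt_div_iff₀ hu).2 hr
    rcases closedNormOmega_subset _ hr' (hcl hz) with h | h
    · left
      rw [Complex.div_ofReal_im] at h
      exact fun h2 => h (by rw [h2, zero_div])
    · right
      rw [Complex.div_ofReal_re] at h
      exact ⟨by have := h.1; rwa [← neg_div, div_lt_div_iff_of_pos_right hu] at this,
        (div_lt_div_iff_of_pos_right hu).1 h.2⟩
  have hincl : quadC c ⁻¹' (F '' closure (Omega u θ)) ⊆ Omega u θ := by
    rintro z ⟨w, hw, hz⟩
    rw [mem_Omega_iff hu h0 hpi]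
    -- the given branch coincides with the normalized one on the smaller of the two slit planes
    have hFw : F w = c + u ^ 2 * ψ ((ε / u : ℝ) * w) := by
      rcases le_total M (11 / 9 * u) with hle | hle
      · exact hF.eqOn hF₀ hle hv (by linarith) (hslit hM hw)
      · exact (hF₀.eqOn hF hle hv (by linarith) (hslit (by linarith) hw)).symm
    have hw' : ((ε / u : ℝ) * w : ℂ) ∈ closedNormOmega (Real.cos θ / Real.sin θ) := by
      have := sign_mul_mem_closedNormOmega hR.sign (hcl hw)
      convert this using 1
      push_cast; ring
    refine hψ.mem_normOmega (ten_le_cot h0 hθ) hw' ?_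
    have hu' : (u : ℂ) ≠ 0 := by exact_mod_cast hu.ne'
    rw [hFw, quadC] at hz
    field_simp
    linear_combination -hz
  have hs1 : s - 1 + 1 = s := Nat.sub_add_cancel hR.period_pos
  refine ⟨(preimage_mono (image_mono frontier_subset_closure)).trans hincl, ?_⟩
  have := isPolynomialLike_of_inverseBranch (isOpen_Omega u θ) (starConvex_Omega hu h0 hθ hvu)
    (ofReal_mem_Omega hu h0 hpi hvu) (isOpen_slitPlaneOf M) (hslit hM)
    (isCompact_closure_Omega u θ) hF.differentiableOn hF.right_inv
    (by rw [← hv]; exact hF.apply_critical) hincl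
  rwa [hs1] at this
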